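/- Let $(M,g)$ be a complete connected smooth Riemannian manifold of dimension $n$ that is asymptotically cylindrical (ACyl): there are a bounded domain $U\subset M$, a closed (not necessarily connected) smooth Riemannian manifold $(X,h)$, and a diffeomorphism $\Phi:[0,\infty)\times X\to M\setminus U$ such that, for some $\delta>0$ and all integers $k\ge 0$, $|\nabla^k(\Phi^*g-g_\infty)|=O(e^{-\delta t})$ as $t\to\infty$, where $t$ is the projection onto $[0,\infty)$ and $\nabla$ and $|\cdot|$ are taken with respect to the product metric $g_\infty=dt^2+h$. Extend the function $t\circ\Phi^{-1}$ by zero to all of $M$ and call the extension $t$ again. Then for every $\mu>0$ there is a piecewise constant function $\psi_\mu:M\to(0,\infty)$ with $\psi_\mu=O(e^{-2\mu t})$ and $\int_M\psi_\mu\,d\mathrm{vol}=1$ such that the following holds. For every real $\sigma\ge 1$, with $\sigma\le\frac{n}{n-2}$ if $n>2$, there is a constant $C=C_{M,\mu,\sigma}$ such that $$\|e^{-\mu t}(u-\bar u_\mu)\|_{L^{2\sigma}(M)}\le C\,\|\nabla u\|_{L^2(M)}\qquad\text{for all } u\in C_0^\infty(M),$$ where $\bar u_\mu=\int_M u\,\psi_\mu\,d\mathrm{vol}$.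 Here piecewise constant means constant on each of countably many pairwise disjoint open sets that form a locally finite family, have boundaries of measure zero, and whose closures cover $M$. -/

import Mathlib

open Set Filter MeasureTheory Bundle
open scoped Manifold ContDiff Topology ENNReal NNReal

noncomputable section

namespace ACyl

/-! ### Riemannian volume and length of the gradient -/

section Riemannian

variable {n : ℕ} {M : Type*} [TopologicalSpace M] [ChartedSpace (EuclideanSpace ℝ (Fin n)) M]
  [RiemannianBundle (fun x : M ↦ TangentSpace (𝓡 n) x)]

/-- The coordinate vector fields `∂₁, …, ∂ₙ` of a chart `c`, at the point with coordinates `y`. -/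
def coordVec (c : OpenPartialHomeomorph M (EuclideanSpace ℝ (Fin n)))
    (y : EuclideanSpace ℝ (Fin n)) (i : Fin n) : TangentSpace (𝓡 n) (c.symm y) :=
  mfderiv (𝓡 n) (𝓡 n) c.symm y (EuclideanSpace.single i (1 : ℝ))

/-- The Riemannian volume density `√ det (g_ij)` of a chart `c`, as a function of the
coordinates. -/
def volDensity (c : OpenPartialHomeomorph M (EuclideanSpace ℝ (Fin n)))
    (y : EuclideanSpace ℝ (Fin n)) : ℝ :=
  √ (Matrix.of fun i j : Fin n ↦ inner ℝ (coordVec c y i) (coordVec c y j)).det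

/-- The Riemannian volume measure of the domain of a chart `c` (extended by zero):
the image of `√ det (g_ij) dy₁ ⋯ dyₙ` under the inverse of `c`. -/
def chartVolume [MeasurableSpace M]
    (c : OpenPartialHomeomorph M (EuclideanSpace ℝ (Fin n))) : Measure M :=
  ((volume.restrict c.target).withDensity fun y ↦ ENNReal.ofReal (volDensity c y)).map c.symm

variable (n M) in
/-- The Riemannian volume measure: the smallest measure that dominates the measures
`√ det (g_ij) dy₁ ⋯ dyₙ` of all the charts of the atlas. As any two of these agree on the overlap
of the charts, it restricts to the latter measure in every chart. -/
def riemVol [MeasurableSpace M] : Measure M :=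
  ⨆ c ∈ atlas (EuclideanSpace ℝ (Fin n)) M, chartVolume c

variable (n) in
/-- The length `|∇u|` of the gradient of `u` at `x`, that is, the norm of the differential of `u`
with respect to the Riemannian inner product on the tangent space. -/
def gradNorm (u : M → ℝ) (x : M) : ℝ :=
  let du : TangentSpace (𝓡 n) x →L[ℝ] ℝ := mfderiv (𝓡 n) 𝓘(ℝ, ℝ) u x
  ‖du‖

end Riemannian

/-- `f` is piecewise constant: there are countably many pairwise disjoint open sets, locally finite
and with boundaries of measure zero, whose closures cover `M`, such that `f` is constant on each. -/
def PiecewiseConstant {M : Type*} [TopologicalSpace M] [MeasurableSpace M] (vol : Measure M)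
    (f : M → ℝ) : Prop :=
  ∃ A : ℕ → Set M, (∀ i, IsOpen (A i)) ∧ Pairwise (fun i j ↦ Disjoint (A i) (A j)) ∧
    LocallyFinite A ∧ ⋃ i, closure (A i) = univ ∧ (∀ i, vol (frontier (A i)) = 0) ∧
    ∀ i, ∃ a : ℝ, ∀ x ∈ A i, f x = a

/-! ### Tensor calculus in coordinates `p = (t, y)` on the cylinder `ℝ × X`

A covariant tensor field of rank `r` in the coordinates is a function
`T : ℝ × ℝᵐ → (Fin r → ℝ × ℝᵐ) → ℝ`, multilinear in the vectors. -/

section Coordinates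

variable {m : ℕ}

/-- The coordinate vectors `∂_t, ∂₁, …, ∂ₘ`. -/
def frame (m : ℕ) : Fin (m + 1) → ℝ × EuclideanSpace ℝ (Fin m) :=
  Fin.cons (1, 0) fun i ↦ (0, EuclideanSpace.single i 1)

/-- The Christoffel symbols of the first kind of the metric `G`:
`½ (∂_u G(v, w) + ∂_v G(u, w) - ∂_w G(u, v))` for constant vectors `u, v, w`. -/
def christoffelFirst
    (G : ℝ × EuclideanSpace ℝ (Fin m) → ℝ × EuclideanSpace ℝ (Fin m) →
      ℝ × EuclideanSpace ℝ (Fin m) → ℝ)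
    (p u v w : ℝ × EuclideanSpace ℝ (Fin m)) : ℝ :=
  (fderiv ℝ (fun q ↦ G q v w) p u + fderiv ℝ (fun q ↦ G q u w) p v
    - fderiv ℝ (fun q ↦ G q u v) p w) / 2

/-- The Christoffel symbols of the metric `G`: the Levi-Civita covariant derivative `∇_u v` of the
constant vector field `v`. The index of `christoffelFirst` is raised with the inverse matrix of
`G`. -/
def christoffel
    (G : ℝ × EuclideanSpace ℝ (Fin m) → ℝ × EuclideanSpace ℝ (Fin m) →
      ℝ × EuclideanSpace ℝ (Fin m) → ℝ)
    (p u v : ℝ × EuclideanSpace ℝ (Fin m)) : ℝ × EuclideanSpace ℝ (Fin m) :=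
  ∑ a, ∑ b, ((Matrix.of fun i j ↦ G p (frame m i) (frame m j))⁻¹ a b *
    christoffelFirst G p u v (frame m b)) • frame m a

/-- The covariant derivative of a covariant tensor field `T` with respect to the Levi-Civita
connection of `G`:
`(∇T)(v₀, v₁, …, v_r) = ∂_{v₀} (T(v₁, …, v_r)) - ∑ₛ T(v₁, …, ∇_{v₀} vₛ, …, v_r)`. -/
def covDeriv
    (G : ℝ × EuclideanSpace ℝ (Fin m) → ℝ × EuclideanSpace ℝ (Fin m) →
      ℝ × EuclideanSpace ℝ (Fin m) → ℝ) {r : ℕ}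
    (T : ℝ × EuclideanSpace ℝ (Fin m) → (Fin r → ℝ × EuclideanSpace ℝ (Fin m)) → ℝ)
    (p : ℝ × EuclideanSpace ℝ (Fin m)) (v : Fin (r + 1) → ℝ × EuclideanSpace ℝ (Fin m)) : ℝ :=
  fderiv ℝ (fun q ↦ T q (Fin.tail v)) p (v 0)
    - ∑ s, T p (Function.update (Fin.tail v) s (christoffel G p (v 0) (Fin.tail v s)))

/-- The `k`-th covariant derivative `∇ᵏT` of a covariant 2-tensor field. -/
def iterCovDeriv
    (G : ℝ × EuclideanSpace ℝ (Fin m) → ℝ × EuclideanSpace ℝ (Fin m) →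
      ℝ × EuclideanSpace ℝ (Fin m) → ℝ)
    (T : ℝ × EuclideanSpace ℝ (Fin m) → (Fin 2 → ℝ × EuclideanSpace ℝ (Fin m)) → ℝ) :
    (k : ℕ) → ℝ × EuclideanSpace ℝ (Fin m) →
      (Fin (2 + k) → ℝ × EuclideanSpace ℝ (Fin m)) → ℝ
  | 0 => T
  | k + 1 => covDeriv G (iterCovDeriv G T k)

variable {X : Type*} [TopologicalSpace X] [ChartedSpace (EuclideanSpace ℝ (Fin m)) X]
  [RiemannianBundle (fun x : X ↦ TangentSpace (𝓡 m) x)]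

/-- The product metric `g_∞ = dt² + h` on `ℝ × X`, in the coordinates `(t, y)` given by a chart `c`
of `X`. -/
def cylMetric (c : OpenPartialHomeomorph X (EuclideanSpace ℝ (Fin m)))
    (p v w : ℝ × EuclideanSpace ℝ (Fin m)) : ℝ :=
  v.1 * w.1 + inner ℝ (mfderiv (𝓡 m) (𝓡 m) c.symm p.2 v.2 : TangentSpace (𝓡 m) (c.symm p.2))
    (mfderiv (𝓡 m) (𝓡 m) c.symm p.2 w.2 : TangentSpace (𝓡 m) (c.symm p.2))

variable {n : ℕ} {M : Type*} [TopologicalSpace M] [ChartedSpace (EuclideanSpace ℝ (Fin n)) M]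
  [RiemannianBundle (fun x : M ↦ TangentSpace (𝓡 n) x)]

/-- The map `Φ : ℝ × X → M` in the coordinates `(t, y)` given by a chart `c` of `X`. -/
def inCoord (Φ : ℝ × X → M) (c : OpenPartialHomeomorph X (EuclideanSpace ℝ (Fin m)))
    (p : ℝ × EuclideanSpace ℝ (Fin m)) : M :=
  Φ (p.1, c.symm p.2)

variable (n) in
/-- The pullback metric `Φ^*g`, in the coordinates `(t, y)` given by a chart `c` of `X`. -/
def pullbackMetric (Φ : ℝ × X → M) (c : OpenPartialHomeomorph X (EuclideanSpace ℝ (Fin m)))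
    (p v w : ℝ × EuclideanSpace ℝ (Fin m)) : ℝ :=
  inner ℝ
    (mfderiv 𝓘(ℝ, ℝ × EuclideanSpace ℝ (Fin m)) (𝓡 n) (inCoord Φ c) p v :
      TangentSpace (𝓡 n) (inCoord Φ c p))
    (mfderiv 𝓘(ℝ, ℝ × EuclideanSpace ℝ (Fin m)) (𝓡 n) (inCoord Φ c) p w :
      TangentSpace (𝓡 n) (inCoord Φ c p))

variable (n m) in
/-- `|∇ᵏ(Φ^*g - g_∞)| = O(e^{-δt})` as `t → ∞`, for the Levi-Civita connection and the norm of the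
product metric `g_∞`. The norm of a tensor is that of a multilinear form, that is, its supremum on
unit vectors. -/
def MetricDecay (Φ : ℝ × X → M) (δ : ℝ) (k : ℕ) : Prop :=
  ∃ C : ℝ, ∀ᶠ t : ℝ in atTop, ∀ c ∈ atlas (EuclideanSpace ℝ (Fin m)) X, ∀ y ∈ c.target,
    ∀ v : Fin (2 + k) → ℝ × EuclideanSpace ℝ (Fin m),
      |iterCovDeriv (cylMetric c)
          (fun p w ↦ pullbackMetric n Φ c p (w 0) (w 1) - cylMetric c p (w 0) (w 1)) k (t, y) v|
        ≤ C * Real.exp (-δ * t) * ∏ i, √ (cylMetric c (t, y) (v i) (v i))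

end Coordinates

/-! ### Asymptotically cylindrical manifolds -/

/-- The data that make a complete Riemannian manifold `M` of dimension `n` asymptotically
cylindrical with cross-section the closed Riemannian manifold `X`: a bounded domain `U` and a
diffeomorphism `Φ` of `[0, ∞) × X` onto `M \ U` such that all the derivatives of `Φ^*g - g_∞` are
`O(e^{-δt})` for some `δ > 0`. -/
structure ACylStructure (n m : ℕ)
    (M : Type*) [MetricSpace M] [ChartedSpace (EuclideanSpace ℝ (Fin n)) M]
    [RiemannianBundle (fun x : M ↦ TangentSpace (𝓡 n) x)]
    (X : Type*) [TopologicalSpace X] [ChartedSpace (EuclideanSpace ℝ (Fin m)) X]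
    [RiemannianBundle (fun x : X ↦ TangentSpace (𝓡 m) x)] where
  /-- the bounded domain -/
  U : Set M
  isOpen_U : IsOpen U
  isConnected_U : IsConnected U
  isBounded_U : Bornology.IsBounded U
  /-- the diffeomorphism, with its inverse -/
  Φ : PartialEquiv (ℝ × X) M
  source_eq : Φ.source = Ici (0 : ℝ) ×ˢ univ
  target_eq : Φ.target = Uᶜ
  smooth : ContMDiffOn (𝓘(ℝ, ℝ).prod (𝓡 m)) (𝓡 n) ∞ Φ Φ.source
  smooth_symm : ContMDiffOn (𝓡 n) (𝓘(ℝ, ℝ).prod (𝓡 m)) ∞ Φ.symm Φ.target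
  decay : ∃ δ : ℝ, 0 < δ ∧ ∀ k : ℕ, MetricDecay m n Φ δ k

open Classical in
/-- The cylindrical coordinate function: `t ∘ Φ⁻¹` on `M \ U`, extended by zero to `U`. -/
def ACylStructure.t {n m : ℕ}
    {M : Type*} [MetricSpace M] [ChartedSpace (EuclideanSpace ℝ (Fin n)) M]
    [RiemannianBundle (fun x : M ↦ TangentSpace (𝓡 n) x)]
    {X : Type*} [TopologicalSpace X] [ChartedSpace (EuclideanSpace ℝ (Fin m)) X]
    [RiemannianBundle (fun x : X ↦ TangentSpace (𝓡 m) x)]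
    (S : ACylStructure n m M X) (x : M) : ℝ :=
  if x ∈ S.U then 0 else (S.Φ.symm x).1

end ACyl

end

/-! On the cylindrical end the metric is uniformly comparable to the translation invariant product
metric, so a local Sobolev-Poincaré inequality $\|u-c\|_{L^{2\sigma}(B)}\le K\|\nabla u\|_{L^2(M)}$
holds there on balls `B` of fixed coordinate size with a constant `K` independent of the height. The
constants `c` belonging to neighbouring balls differ by at most a multiple of $\|\nabla u\|_{L^2}$.
Climbing from the core to height `t` therefore changes the constant by $O(t+1)\|\nabla u\|_{L^2}$,
and the weight $e^{-\mu t}$ makes the sum of these errors converge.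

The local inequality starts on Euclidean balls: `exists_poincare_ball` in $L^2$, improved by a
cut-off and the Sobolev inequality to `exists_sobolev_poincare`. A parametrization that distorts
lengths by a bounded factor (`DistortionOn`) carries it to `M`, which is
`exists_sobolevPoincareOn_image_ball`. Overlapping open sets can be joined
(`SobolevPoincareOn.union`), so connectedness of `M` gives a neighbourhood of any compact set on
which the inequality holds (`exists_sobolevPoincareOn_superset`). Since `SobolevPoincareOn` measures
the gradient on all of `M`, no bounded overlap of the balls is needed: the weights alone make the
sums finite.

The rest of `M` is covered by finitely many towers of balls, one over each member of a finite cover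
of `X` (`ACylStructure.exists_isTower`). `IsTower.exists_weighted_le` sums along a tower, always
relative to the constant `c` of the core. The outcome is $\|e^{-\mu t}(u-c)\|_{L^{2\sigma}}\le
A\|\nabla u\|_{L^2}$ for some `c` depending on `u`.

Finally `c` is replaced by the average against `ψ`. As $\psi=O(e^{-2\mu t})$ and $e^{-\mu t}$ lies
in every $L^p$ with $0<p<\infty$, Hölder's inequality bounds $|c-\bar u_\mu|$ by the left side just
estimated (`exists_eLpNorm_mul_sub_average_le`). The function `ψ` is a normalized step function of
`max t R`, with steps placed at levels of measure zero. -/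

namespace ACyl

/-! ### The $L^2$ Poincaré inequality on Euclidean balls -/

section Poincare

variable {E : Type*} [NormedAddCommGroup E] [NormedSpace ℝ E] [FiniteDimensional ℝ E]
  [MeasurableSpace E] [BorelSpace E]

/-- Cauchy-Schwarz against the constant 1. It is applied to the parameter interval `[0, 1/2]`, whose
length is at most 1. -/
theorem lintegral_sq_le_of_measure_univ_le_one {α : Type*} [MeasurableSpace α] {ν : Measure α}
    (hν : ν univ ≤ 1) {f : α → ℝ≥0∞} (hf : AEMeasurable f ν) :
    (∫⁻ a, f a ∂ν) ^ 2 ≤ ∫⁻ a, f a ^ 2 ∂ν := by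
  have h := ENNReal.lintegral_mul_le_Lp_mul_Lq ν (p := 2) (q := 2)
    (Real.holderConjugate_iff.2 ⟨by norm_num, by norm_num⟩) hf (aemeasurable_const (b := (1 : ℝ≥0∞)))
  simp only [Pi.mul_apply, mul_one, ENNReal.one_rpow, lintegral_const, one_mul] at h
  have h1 : (ν univ) ^ (1 / 2 : ℝ) ≤ 1 := by
    calc (ν univ) ^ (1 / 2 : ℝ) ≤ 1 ^ (1 / 2 : ℝ) := by gcongr
      _ = 1 := by simp
  have h2 : (∫⁻ a, f a ∂ν) ≤ (∫⁻ a, f a ^ (2 : ℝ) ∂ν) ^ (1 / 2 : ℝ) := by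
    calc _ ≤ _ := h
      _ ≤ (∫⁻ a, f a ^ (2 : ℝ) ∂ν) ^ (1 / 2 : ℝ) * 1 := by gcongr
      _ = _ := mul_one _
  calc (∫⁻ a, f a ∂ν) ^ 2 ≤ ((∫⁻ a, f a ^ (2 : ℝ) ∂ν) ^ (1 / 2 : ℝ)) ^ 2 := by gcongr
    _ = ∫⁻ a, f a ^ (2 : ℝ) ∂ν := by
      rw [← ENNReal.rpow_natCast, ← ENNReal.rpow_mul]; norm_num
    _ = _ := by simp

/-- The increment of `v` from an end to the midpoint of a segment. -/
theorem enorm_sub_midpoint_sq_le {v : E → ℝ} (hv : ContDiff ℝ 1 v) (x y : E) :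
    ‖v x - v (x + (1 / 2 : ℝ) • (y - x))‖ₑ ^ 2 ≤ ‖y - x‖ₑ ^ 2 *
      ∫⁻ s in Icc (0 : ℝ) (1 / 2), ‖fderiv ℝ v (x + s • (y - x))‖ₑ ^ 2 := by
  have hd : Continuous (fderiv ℝ v) := hv.continuous_fderiv (by norm_num)
  have hp : Continuous fun s : ℝ ↦ x + s • (y - x) := by fun_prop
  have hder : ∀ s : ℝ, HasDerivAt (fun s : ℝ ↦ v (x + s • (y - x)))
      (fderiv ℝ v (x + s • (y - x)) (y - x)) s := by
    intro s
    have h1 : HasDerivAt (fun s : ℝ ↦ x + s • (y - x)) (y - x) s := by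
      simpa using ((hasDerivAt_id s).smul_const (y - x)).const_add x
    exact ((hv.differentiable (by norm_num)) _).hasFDerivAt.comp_hasDerivAt s h1
  have hcont : Continuous fun s : ℝ ↦ fderiv ℝ v (x + s • (y - x)) (y - x) :=
    (hd.comp hp).clm_apply continuous_const
  have hint : ∫ s in (0 : ℝ)..(1 / 2), fderiv ℝ v (x + s • (y - x)) (y - x)
      = v (x + (1 / 2 : ℝ) • (y - x)) - v (x + (0 : ℝ) • (y - x)) :=
    intervalIntegral.integral_eq_sub_of_hasDerivAt (fun s _ ↦ hder s)
      (hcont.intervalIntegrable _ _)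
  rw [zero_smul, add_zero, intervalIntegral.integral_of_le (by norm_num)] at hint
  have h1 : ‖v x - v (x + (1 / 2 : ℝ) • (y - x))‖ₑ
      ≤ ‖y - x‖ₑ * ∫⁻ s in Icc (0 : ℝ) (1 / 2), ‖fderiv ℝ v (x + s • (y - x))‖ₑ := by
    rw [← enorm_neg, neg_sub, ← hint, Measure.restrict_congr_set
      (Ioc_ae_eq_Icc (μ := volume) (a := (0 : ℝ)) (b := 1 / 2)).symm,
      ← lintegral_const_mul _ (by fun_prop)]
    refine (enorm_integral_le_lintegral_enorm _).trans (lintegral_mono fun s ↦ ?_)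
    rw [mul_comm]
    exact ContinuousLinearMap.le_opENorm _ _
  calc _ ≤ (‖y - x‖ₑ * ∫⁻ s in Icc (0 : ℝ) (1 / 2), ‖fderiv ℝ v (x + s • (y - x))‖ₑ) ^ 2 := by
        gcongr
    _ = ‖y - x‖ₑ ^ 2 * (∫⁻ s in Icc (0 : ℝ) (1 / 2), ‖fderiv ℝ v (x + s • (y - x))‖ₑ) ^ 2 :=
        mul_pow _ _ _
    _ ≤ _ := by
        gcongr
        refine lintegral_sq_le_of_measure_univ_le_one ?_ (by fun_prop)
        simp only [Measure.restrict_apply_univ, Real.volume_Icc]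
        norm_num
        
/-- Contracting a ball towards one of its points increases integrals at most by the Jacobian. -/
theorem setLIntegral_ball_contract_le (μ : Measure E) [μ.IsAddHaarMeasure] {g : E → ℝ≥0∞}
    (hg : Measurable g) {R : ℝ} {y : E} (hy : y ∈ Metric.ball (0 : E) R) {s : ℝ}
    (hs : s ∈ Icc (0 : ℝ) (1 / 2)) :
    ∫⁻ x in Metric.ball (0 : E) R, g (x + s • (y - x)) ∂μ
      ≤ 2 ^ Module.finrank ℝ E * ∫⁻ x in Metric.ball (0 : E) R, g x ∂μ := by
  have h1s : (0 : ℝ) < 1 - s := by linarith [hs.2]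
  set G : E → ℝ≥0∞ := (Metric.ball (0 : E) R).indicator g with hG
  have hGm : Measurable G := hg.indicator Metric.isOpen_ball.measurableSet
  calc ∫⁻ x in Metric.ball (0 : E) R, g (x + s • (y - x)) ∂μ
      ≤ ∫⁻ x in Metric.ball (0 : E) R, G ((1 - s) • x + s • y) ∂μ := by
        refine setLIntegral_mono' Metric.isOpen_ball.measurableSet fun x hx ↦ ?_
        have he : x + s • (y - x) = (1 - s) • x + s • y := by module
        have hm : (1 - s) • x + s • y ∈ Metric.ball (0 : E) R :=
          convex_ball (0 : E) R hx hy h1s.le hs.1 (by ring)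
        rw [he, hG, indicator_of_mem hm]
    _ ≤ ∫⁻ x, G ((1 - s) • x + s • y) ∂μ := setLIntegral_le_lintegral _ _
    _ = ∫⁻ x, (fun z ↦ G (z + s • y)) x ∂(Measure.map ((1 - s) • ·) μ) := by
        rw [lintegral_map (f := fun z ↦ G (z + s • y)) (hGm.comp (measurable_add_const _))
          (measurable_const_smul _)]
    _ = ENNReal.ofReal |((1 - s) ^ Module.finrank ℝ E)⁻¹| * ∫⁻ x, G x ∂μ := by
        rw [Measure.map_addHaar_smul μ h1s.ne', lintegral_smul_measure, lintegral_add_right_eq_self,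
          smul_eq_mul]
    _ ≤ _ := by
        rw [hG, lintegral_indicator Metric.isOpen_ball.measurableSet]
        gcongr
        rw [abs_of_pos (by positivity), ← inv_pow]
        calc ENNReal.ofReal ((1 - s)⁻¹ ^ Module.finrank ℝ E)
            ≤ ENNReal.ofReal (2 ^ Module.finrank ℝ E) := by
              gcongr
              rw [inv_le_comm₀ h1s (by norm_num)]; linarith [hs.2]
          _ = _ := by rw [ENNReal.ofReal_pow (by norm_num)]; norm_num

/-- The integral over a ball of the squared increment from a point to the midpoint. -/
theorem setLIntegral_sub_midpoint_sq_le (μ : Measure E) [μ.IsAddHaarMeasure] {v : E → ℝ}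
    (hv : ContDiff ℝ 1 v) {R : ℝ} {y : E} (hy : y ∈ Metric.ball (0 : E) R) :
    ∫⁻ x in Metric.ball (0 : E) R, ‖v x - v (x + (1 / 2 : ℝ) • (y - x))‖ₑ ^ 2 ∂μ
      ≤ ENNReal.ofReal (2 * R) ^ 2 * 2 ^ Module.finrank ℝ E *
        ∫⁻ x in Metric.ball (0 : E) R, ‖fderiv ℝ v x‖ₑ ^ 2 ∂μ := by
  have hd : Continuous (fderiv ℝ v) := hv.continuous_fderiv (by norm_num)
  set I := ∫⁻ x in Metric.ball (0 : E) R, ‖fderiv ℝ v x‖ₑ ^ 2 ∂μ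
  calc ∫⁻ x in Metric.ball (0 : E) R, ‖v x - v (x + (1 / 2 : ℝ) • (y - x))‖ₑ ^ 2 ∂μ
      ≤ ∫⁻ x in Metric.ball (0 : E) R, ENNReal.ofReal (2 * R) ^ 2 *
        (∫⁻ s in Icc (0 : ℝ) (1 / 2), ‖fderiv ℝ v (x + s • (y - x))‖ₑ ^ 2) ∂μ := by
        refine setLIntegral_mono' Metric.isOpen_ball.measurableSet fun x hx ↦ ?_
        refine (enorm_sub_midpoint_sq_le hv x y).trans ?_
        gcongr
        rw [← ofReal_norm]
        apply ENNReal.ofReal_le_ofReal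
        rw [mem_ball_zero_iff] at hx hy
        linarith [norm_sub_le y x]
    _ = ENNReal.ofReal (2 * R) ^ 2 * ∫⁻ x in Metric.ball (0 : E) R, 
        (∫⁻ s in Icc (0 : ℝ) (1 / 2), ‖fderiv ℝ v (x + s • (y - x))‖ₑ ^ 2) ∂μ :=
        lintegral_const_mul' _ _ (by finiteness)
    _ = ENNReal.ofReal (2 * R) ^ 2 * ∫⁻ s in Icc (0 : ℝ) (1 / 2), 
        ∫⁻ x in Metric.ball (0 : E) R, ‖fderiv ℝ v (x + s • (y - x))‖ₑ ^ 2 ∂μ := by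
        rw [lintegral_lintegral_swap]
        apply Measurable.aemeasurable
        apply Continuous.measurable
        simp only [Function.uncurry_def]
        fun_prop
    _ ≤ ENNReal.ofReal (2 * R) ^ 2 * ∫⁻ s in Icc (0 : ℝ) (1 / 2), 
        2 ^ Module.finrank ℝ E * I := by
        refine mul_le_mul_right ?_ _
        exact setLIntegral_mono' measurableSet_Icc fun s hs ↦ setLIntegral_ball_contract_le μ
          (g := fun z ↦ ‖fderiv ℝ v z‖ₑ ^ 2) (by fun_prop) hy hs
    _ ≤ ENNReal.ofReal (2 * R) ^ 2 * (2 ^ Module.finrank ℝ E * I * 1) := by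
        rw [lintegral_const]
        gcongr
        simp only [Measure.restrict_apply_univ, Real.volume_Icc]
        norm_num
    _ = _ := by ring

/-- The Poincaré inequality on a ball. -/
theorem exists_poincare_ball (μ : Measure E) [μ.IsAddHaarMeasure] {R : ℝ} (hR : 0 < R) :
    ∃ K : ℝ≥0, ∀ v : E → ℝ, ContDiff ℝ 1 v → ∃ c : ℝ,
      ∫⁻ x in Metric.ball (0 : E) R, ‖v x - c‖ₑ ^ 2 ∂μ
        ≤ K * ∫⁻ x in Metric.ball (0 : E) R, ‖fderiv ℝ v x‖ₑ ^ 2 ∂μ := by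
  refine ⟨4 * ((2 * R).toNNReal ^ 2 * 2 ^ Module.finrank ℝ E), fun v hv ↦ ?_⟩
  have hB0 : μ (Metric.ball (0 : E) R) ≠ 0 := (Metric.measure_ball_pos μ 0 hR).ne'
  have hB1 : μ (Metric.ball (0 : E) R) ≠ ⊤ := measure_ball_lt_top.ne
  have hvc : Continuous v := hv.continuous
  set B := Metric.ball (0 : E) R
  set D := ENNReal.ofReal (2 * R) ^ 2 * 2 ^ Module.finrank ℝ E *
        ∫⁻ x in B, ‖fderiv ℝ v x‖ₑ ^ 2 ∂μ
  -- Comparing both ends with the midpoint uses each segment only up to `s = 1/2`, where the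
  -- contraction `x ↦ x + s(y - x)` still has Jacobian at least `2⁻ᵈ`, `d` being the dimension. At
  -- `s = 1` it would degenerate.
  have hmid : ∀ x y : E, x + (1 / 2 : ℝ) • (y - x) = y + (1 / 2 : ℝ) • (x - y) := by
    intro x y; module
  have hsplit : ∀ x y : E, ‖v x - v y‖ₑ ^ 2 ≤ 2 * ‖v x - v (x + (1 / 2 : ℝ) • (y - x))‖ₑ ^ 2
      + 2 * ‖v y - v (y + (1 / 2 : ℝ) • (x - y))‖ₑ ^ 2 := by
    intro x y
    rw [← hmid x y]
    set m := v (x + (1 / 2 : ℝ) • (y - x))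
    have h1 : ‖v x - v y‖ₑ ≤ ‖v x - m‖ₑ + ‖v y - m‖ₑ := by
      have : v x - v y = (v x - m) - (v y - m) := by ring
      rw [this]; exact enorm_sub_le
    have h2 : ∀ a b : ℝ≥0, (a + b) ^ 2 ≤ 2 * a ^ 2 + 2 * b ^ 2 := by
      intro a b
      rw [← NNReal.coe_le_coe]; push_cast
      nlinarith [sq_nonneg ((a : ℝ) - b)]
    calc ‖v x - v y‖ₑ ^ 2 ≤ (‖v x - m‖ₑ + ‖v y - m‖ₑ) ^ 2 := by gcongr
      _ ≤ _ := by
        simp only [enorm_eq_nnnorm]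
        exact_mod_cast h2 _ _
  have hF : Continuous fun p : E × E ↦ ‖v p.1 - v p.2‖ₑ ^ 2 := by fun_prop
  have hG : Continuous fun p : E × E ↦
      ‖v p.1 - v (p.1 + (1 / 2 : ℝ) • (p.2 - p.1))‖ₑ ^ 2 := by fun_prop
  have htot : ∫⁻ y in B, ∫⁻ x in B, ‖v x - v y‖ₑ ^ 2 ∂μ ∂μ ≤ 4 * D * μ B := by
    calc _ ≤ ∫⁻ y in B, (2 * ∫⁻ x in B, ‖v x - v (x + (1 / 2 : ℝ) • (y - x))‖ₑ ^ 2 ∂μ)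
          + 2 * ∫⁻ x in B, ‖v y - v (y + (1 / 2 : ℝ) • (x - y))‖ₑ ^ 2 ∂μ ∂μ := by
          refine lintegral_mono fun y ↦ ?_
          rw [← lintegral_const_mul' _ _ (by norm_num), ← lintegral_const_mul' _ _ (by norm_num),
            ← lintegral_add_left' (by fun_prop)]
          exact lintegral_mono fun x ↦ hsplit x y
      _ = (∫⁻ y in B, (2 * ∫⁻ x in B, ‖v x - v (x + (1 / 2 : ℝ) • (y - x))‖ₑ ^ 2 ∂μ) ∂μ)
          + 2 * ∫⁻ x in B, ∫⁻ y in B, ‖v y - v (y + (1 / 2 : ℝ) • (x - y))‖ₑ ^ 2 ∂μ ∂μ := by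
          rw [lintegral_add_left]
          · congr 1
            rw [lintegral_const_mul' _ _ (by norm_num), lintegral_lintegral_swap]
            exact hG.measurable.aemeasurable
          · refine Measurable.const_mul ?_ _
            exact Measurable.lintegral_prod_left'
              (f := fun p : E × E ↦ ‖v p.1 - v (p.1 + (1 / 2 : ℝ) • (p.2 - p.1))‖ₑ ^ 2)
                hG.measurable
      _ ≤ (∫⁻ y in B, 2 * D ∂μ) + 2 * ∫⁻ x in B, D ∂μ := by
          gcongr ?_ + 2 * ?_
          · exact setLIntegral_mono' Metric.isOpen_ball.measurableSet fun y hy ↦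
              mul_le_mul_right (setLIntegral_sub_midpoint_sq_le μ hv hy) _
          · exact setLIntegral_mono' Metric.isOpen_ball.measurableSet fun y hy ↦
              setLIntegral_sub_midpoint_sq_le μ hv hy
      _ = 4 * D * μ B := by
          simp only [lintegral_const, Measure.restrict_apply_univ]; ring
  -- Instead of the mean of `v`, the constant is a value `v y` at a point where the inner integral
  -- does not exceed its average over the ball.
  obtain ⟨y, hyB, hy⟩ := exists_le_setLAverage (μ := μ) (s := B)
    (f := fun y ↦ ∫⁻ x in B, ‖v x - v y‖ₑ ^ 2 ∂μ) hB0 hB1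
    (Measurable.aemeasurable (Measurable.lintegral_prod_left'
              (f := fun p : E × E ↦ ‖v p.1 - v p.2‖ₑ ^ 2) hF.measurable))
  refine ⟨v y, hy.trans ?_⟩
  rw [setLAverage_eq]
  calc _ ≤ 4 * D * μ B / μ B := by gcongr
    _ = 4 * D := ENNReal.mul_div_cancel_right hB0 hB1
    _ = _ := by
      simp only [D, ENNReal.ofReal]; push_cast; ring

end Poincare

/-! ### Sobolev inequalities, and the Sobolev-Poincaré inequality on Euclidean balls -/

section Sobolev

/-- On functions supported in a set of finite measure, the `Lᵖ` norms increase with `p`, up to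
constants. -/
theorem eLpNorm_le_mul_of_support_subset {α F : Type*} [MeasurableSpace α]
    [NormedAddCommGroup F] {ν : Measure α} {s : Set α} (hs : ν s ≠ ⊤) {p q : ℝ≥0∞} (hpq : p ≤ q) 
    (hp : p ≠ 0) :
    ∃ K : ℝ≥0, ∀ f : α → F, AEStronglyMeasurable f ν → f.support ⊆ s →
      eLpNorm f p ν ≤ K * eLpNorm f q ν := by
  refine ⟨(ν s ^ (1 / p.toReal - 1 / q.toReal)).toNNReal, fun f hf hfs ↦ ?_⟩
  have h := eLpNorm_le_eLpNorm_mul_rpow_measure_univ hpq (hf.restrict (s := s))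
  rw [eLpNorm_restrict_eq_of_support_subset hfs, eLpNorm_restrict_eq_of_support_subset hfs,
    Measure.restrict_apply_univ, mul_comm] at h
  rcases eq_or_ne p ⊤ with rfl | hp'
  · obtain rfl : q = ⊤ := by simpa using hpq
    simp
  rw [ENNReal.coe_toNNReal]
  · exact h
  · refine ENNReal.rpow_ne_top_of_nonneg ?_ hs
    rcases eq_or_ne q ⊤ with rfl | hq
    · simp
    · have h0 : 0 < p.toReal := ENNReal.toReal_pos hp hp'
      have h1 : p.toReal ≤ q.toReal := ENNReal.toReal_mono hq hpq
      rw [sub_nonneg]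
      exact one_div_le_one_div_of_le h0 h1

theorem support_fderiv_subset_tsupport {E F : Type*} [NormedAddCommGroup E] [NormedSpace ℝ E]
    [NormedAddCommGroup F] [NormedSpace ℝ F] (w : E → F) :
    (fderiv ℝ w).support ⊆ tsupport w := support_fderiv_subset ℝ

/-- The Sobolev inequality for functions on the line with support in a bounded set. -/
theorem exists_sobolev_one {R : ℝ} (q : ℝ≥0) (hq : q ≠ 0) :
    ∃ K : ℝ≥0, ∀ w : EuclideanSpace ℝ (Fin 1) → ℝ, ContDiff ℝ 1 w →
      tsupport w ⊆ Metric.closedBall 0 R → eLpNorm w q volume ≤ K * eLpNorm (fderiv ℝ w) 2 volume := by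
  have hfin : volume (Metric.closedBall (0 : EuclideanSpace ℝ (Fin 1)) R) ≠ ⊤ :=
    measure_closedBall_lt_top.ne
  obtain ⟨K₁, hK₁⟩ := eLpNorm_le_mul_of_support_subset (F := ℝ) hfin (p := q) (q := ⊤) le_top
    (by exact_mod_cast hq)
  obtain ⟨K₂, hK₂⟩ := eLpNorm_le_mul_of_support_subset
    (F := EuclideanSpace ℝ (Fin 1) →L[ℝ] ℝ) hfin (p := 1) (q := 2) (by norm_num) (by simp)
  refine ⟨K₁ * K₂, fun w hw hws ↦ ?_⟩
  have hdc : Continuous (fderiv ℝ w) := hw.continuous_fderiv (by norm_num)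
  have hcs : HasCompactSupport w :=
    (isCompact_closedBall _ _).of_isClosed_subset (isClosed_tsupport w) hws
  let ι : ℝ ≃ₗᵢ[ℝ] EuclideanSpace ℝ (Fin 1) := (OrthonormalBasis.singleton (Fin 1) ℝ).repr
  have hmp : MeasurePreserving ι := ι.measurePreserving
  -- In dimension one the fundamental theorem of calculus bounds the supremum by the $L^1$ norm of
  -- the derivative. Bounded support then gives all other exponents.
  have hsup : ∀ x, ‖w x‖ₑ ≤ eLpNorm (fderiv ℝ w) 1 volume := by
    intro x
    obtain ⟨t, rfl⟩ := ι.surjective x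
    have h1 : ContDiff ℝ 1 (w ∘ ι) := hw.comp ι.contDiff
    have h2 : HasCompactSupport (w ∘ ι) := hcs.comp_homeomorph ι.toHomeomorph
    calc ‖w (ι t)‖ₑ ≤ ∫⁻ y in Iic t, ‖deriv (w ∘ ι) y‖ₑ :=
          HasCompactSupport.enorm_le_lintegral_Ici_deriv h1 h2 t
      _ ≤ ∫⁻ y, ‖deriv (w ∘ ι) y‖ₑ := setLIntegral_le_lintegral _ _
      _ ≤ ∫⁻ y, ‖fderiv ℝ w (ι y)‖ₑ := by
          refine lintegral_mono fun y ↦ ?_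
          have : HasDerivAt (w ∘ ι) (fderiv ℝ w (ι y) (ι 1)) y := by
            refine ((hw.differentiable (by norm_num)) _).hasFDerivAt.comp_hasDerivAt y ?_
            exact ι.toContinuousLinearEquiv.toContinuousLinearMap.hasDerivAt
          rw [this.deriv]
          refine (ContinuousLinearMap.le_opENorm _ _).trans ?_
          have : ‖ι 1‖ₑ = 1 := by rw [← ofReal_norm, ι.norm_map]; simp
          rw [this, mul_one]
      _ = ∫⁻ x, ‖fderiv ℝ w x‖ₑ := hmp.lintegral_comp (f := fun x ↦ ‖fderiv ℝ w x‖ₑ) (by fun_prop)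
      _ = _ := eLpNorm_one_eq_lintegral_enorm.symm
  calc eLpNorm w q volume ≤ K₁ * eLpNorm w ⊤ volume :=
        hK₁ w hw.continuous.aestronglyMeasurable ((subset_tsupport w).trans hws)
    _ ≤ K₁ * eLpNorm (fderiv ℝ w) 1 volume := by
        gcongr
        rw [eLpNorm_exponent_top]
        exact eLpNormEssSup_le_of_ae_enorm_bound (ae_of_all _ hsup)
    _ ≤ K₁ * (K₂ * eLpNorm (fderiv ℝ w) 2 volume) := by
        gcongr
        exact hK₂ _ hdc.aestronglyMeasurable ((support_fderiv_subset_tsupport w).trans hws)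
    _ = _ := by push_cast; ring

/-- The Sobolev inequality for functions with support in a bounded set, for all exponents up to the
critical one. -/
theorem exists_sobolev {n : ℕ} (hn : n ≠ 0) {R : ℝ} (q : ℝ≥0) (hq : 2 ≤ q)
    (hqn : 2 < n → (q : ℝ) ≤ 2 * n / (n - 2)) :
    ∃ K : ℝ≥0, ∀ w : EuclideanSpace ℝ (Fin n) → ℝ, ContDiff ℝ 1 w →
      tsupport w ⊆ Metric.closedBall 0 R →
        eLpNorm w q volume ≤ K * eLpNorm (fderiv ℝ w) 2 volume := by
  have hq0 : (0 : ℝ) < q := by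
    have : (2 : ℝ) ≤ q := by exact_mod_cast hq
    linarith
  rcases Nat.lt_or_ge 2 n with h2 | h2
  · have h2' : (2 : ℝ) < n := by exact_mod_cast h2
    refine ⟨eLpNormLESNormFDerivOfLeConst ℝ volume
      (Metric.closedBall (0 : EuclideanSpace ℝ (Fin n)) R) 2 q, fun w hw hws ↦ ?_⟩
    refine eLpNorm_le_eLpNorm_fderiv_of_le volume hw ((subset_tsupport w).trans hws) (p := 2)
      (by norm_num) ?_ ?_ Metric.isBounded_closedBall
    · rw [finrank_euclideanSpace_fin]; exact_mod_cast h2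
    · rw [finrank_euclideanSpace_fin]
      have := hqn h2
      rw [le_inv_comm₀ (by push_cast; rw [sub_pos]; gcongr) hq0]
      refine this.trans_eq ?_
      have h3 : (n : ℝ) - 2 ≠ 0 := by linarith
      have h4 : (n : ℝ) ≠ 0 := by linarith
      push_cast
      rw [inv_sub_inv (by norm_num) h4, inv_div]
  rcases Nat.lt_or_ge n 2 with h1 | h1
  · obtain rfl : n = 1 := by omega
    exact exists_sobolev_one q (by intro h; simp [h] at hq0)
  obtain rfl : n = 2 := le_antisymm h2 h1
  -- In dimension two `p = 2` is the borderline exponent. This `p < 2` has `q` as its Sobolev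
  -- conjugate, `q ≥ 2` makes `p ≥ 1`, and bounded support returns from $L^p$ to $L^2$.
  set p : ℝ≥0 := (1 / 2 + 1 / q)⁻¹ with hp
  have hqp : (0 : ℝ≥0) < q := by exact_mod_cast hq0
  have hp1 : 1 ≤ p := by
    rw [hp, one_le_inv₀ (by positivity), one_div, one_div]
    have : q⁻¹ ≤ 2⁻¹ := by gcongr
    calc (2⁻¹ : ℝ≥0) + q⁻¹ ≤ 2⁻¹ + 2⁻¹ := by gcongr
      _ = 1 := by rw [← two_mul]; simp
  have hp2 : p < 2 := by
    rw [hp, inv_lt_comm₀ (by positivity) (by norm_num), one_div]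
    exact lt_add_of_pos_right _ (by positivity)
  obtain ⟨K₂, hK₂⟩ := eLpNorm_le_mul_of_support_subset (F := EuclideanSpace ℝ (Fin 2) →L[ℝ] ℝ) 
    (ν := volume) (s := Metric.closedBall (0 : EuclideanSpace ℝ (Fin 2)) R)
    measure_closedBall_lt_top.ne (p := p) (q := 2) (by exact_mod_cast hp2.le)
    (by have : p ≠ 0 := by positivity
        exact_mod_cast this)
  refine ⟨eLpNormLESNormFDerivOfLeConst ℝ volume
      (Metric.closedBall (0 : EuclideanSpace ℝ (Fin 2)) R) p q * K₂, fun w hw hws ↦ ?_⟩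
  have hdc : Continuous (fderiv ℝ w) := hw.continuous_fderiv (by norm_num)
  refine (eLpNorm_le_eLpNorm_fderiv_of_le volume hw ((subset_tsupport w).trans hws) hp1
    ?_ ?_ Metric.isBounded_closedBall).trans ?_
  · rw [finrank_euclideanSpace_fin]; exact_mod_cast hp2
  · rw [finrank_euclideanSpace_fin, hp]
    push_cast
    simp
  · push_cast
    rw [mul_assoc]
    gcongr
    exact hK₂ _ hdc.aestronglyMeasurable ((support_fderiv_subset_tsupport w).trans hws)

theorem eLpNorm_two_sq {α F : Type*} [MeasurableSpace α]
    [NormedAddCommGroup F] {ν : Measure α} (f : α → F) :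
    eLpNorm f 2 ν ^ 2 = ∫⁻ x, ‖f x‖ₑ ^ 2 ∂ν := by
  have := eLpNorm_nnreal_pow_eq_lintegral (f := f) (μ := ν) (p := 2) (by norm_num)
  simpa using this

theorem ennreal_add_sq_le (a b : ℝ≥0∞) : (a + b) ^ 2 ≤ 2 * (a ^ 2 + b ^ 2) := by
  have := ENNReal.rpow_add_le_mul_rpow_add_rpow a b (p := 2) (by norm_num)
  norm_num at this
  exact this

/-- The Sobolev-Poincaré inequality on balls, with a constant that does not depend on the
centre. -/
theorem exists_sobolev_poincare (n : ℕ) (q : ℝ≥0) (hq : 2 ≤ q)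
    (hqn : 2 < n → (q : ℝ) ≤ 2 * n / (n - 2)) {r : ℝ} (hr : 0 < r) :
    ∃ K : ℝ≥0, ∀ (a : EuclideanSpace ℝ (Fin n)) (v : EuclideanSpace ℝ (Fin n) → ℝ),
      ContDiff ℝ 1 v → ∃ c : ℝ,
      eLpNorm (fun x ↦ v x - c) q (volume.restrict (Metric.ball a r)) ≤
        K * eLpNorm (fderiv ℝ v) 2 (volume.restrict (Metric.ball a (2 * r))) := by
  rcases eq_or_ne n 0 with rfl | hn
  · refine ⟨0, fun a v _ ↦ ⟨v 0, ?_⟩⟩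
    have : (fun x ↦ v x - v 0) = 0 := by
      ext x; simp [Subsingleton.elim x 0]
    rw [this]; simp
  obtain ⟨K₁, hK₁⟩ := exists_sobolev hn (R := 2 * r) q hq hqn
  obtain ⟨K₂, hK₂⟩ := exists_poincare_ball (volume : Measure (EuclideanSpace ℝ (Fin n)))
    (R := 2 * r) (by positivity)
  -- The Sobolev inequality is applied to `χ (v - c)`, which equals `v - c` on the ball of radius
  -- `r`. The term in which the cut-off is differentiated is controlled by the Poincaré inequality
  -- on the ball of radius `2r`.
  let χ : ContDiffBump (0 : EuclideanSpace ℝ (Fin n)) := ⟨r, 3 / 2 * r, hr, by linarith⟩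
  have hχd : ContDiff ℝ 1 χ := χ.contDiff
  have hχs : tsupport χ = Metric.closedBall 0 (3 / 2 * r) := χ.tsupport_eq
  obtain ⟨A, hA⟩ : ∃ A : ℝ≥0, ∀ x, ‖fderiv ℝ χ x‖₊ ≤ A := by
    obtain ⟨A, hA⟩ := (hχd.continuous_fderiv (by norm_num)).bounded_above_of_compact_support
      (χ.hasCompactSupport.fderiv (𝕜 := ℝ))
    refine ⟨A.toNNReal, fun x ↦ ?_⟩
    rw [← NNReal.coe_le_coe]
    exact (hA x).trans (Real.le_coe_toNNReal A)
  set B := Metric.ball (0 : EuclideanSpace ℝ (Fin n)) (2 * r) with hB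
  have key : ∀ v : EuclideanSpace ℝ (Fin n) → ℝ, ContDiff ℝ 1 v → ∃ c : ℝ,
      eLpNorm (fun x ↦ v x - c) q (volume.restrict (Metric.ball 0 r)) ≤
        (K₁ * NNReal.sqrt (2 * (1 + A ^ 2 * K₂)) : ℝ≥0) *
          eLpNorm (fderiv ℝ v) 2 (volume.restrict B) := by
    intro v hv
    obtain ⟨c, hc⟩ := hK₂ v hv
    refine ⟨c, ?_⟩
    have hvc : ContDiff ℝ 1 fun x ↦ v x - c := hv.sub contDiff_const
    set w : EuclideanSpace ℝ (Fin n) → ℝ := fun x ↦ χ x * (v x - c) with hw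
    have hwd : ContDiff ℝ 1 w := hχd.mul hvc
    have hws : tsupport w ⊆ Metric.closedBall 0 (3 / 2 * r) := by
      rw [← hχs]; exact tsupport_mul_subset_left
    have hwd' : ∀ x, ‖fderiv ℝ w x‖ₑ ≤ ‖fderiv ℝ v x‖ₑ + A * ‖v x - c‖ₑ := by
      intro x
      have h1 : fderiv ℝ w x = χ x • fderiv ℝ v x + (v x - c) • fderiv ℝ χ x := by
        have := ((hχd.differentiable (by norm_num) x).hasFDerivAt.mul
          ((hv.differentiable (by norm_num) x).hasFDerivAt.sub_const c)).fderiv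
        exact this
      rw [h1]
      have h0 : ‖χ x • fderiv ℝ v x + (v x - c) • fderiv ℝ χ x‖ₑ
          ≤ ‖χ x‖ₑ * ‖fderiv ℝ v x‖ₑ + ‖v x - c‖ₑ * ‖fderiv ℝ χ x‖ₑ := by
        simp only [enorm_eq_nnnorm]
        refine (ENNReal.coe_le_coe.2 (nnnorm_add_le _ _)).trans ?_
        rw [nnnorm_smul, nnnorm_smul]
        push_cast
        rfl
      refine h0.trans ?_
      rw [mul_comm (A : ℝ≥0∞)]
      have h2 : ‖χ x‖ₑ ≤ 1 := by
        rw [← ofReal_norm, Real.norm_of_nonneg χ.nonneg]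
        exact ENNReal.ofReal_le_one.2 χ.le_one
      have h3 : ‖fderiv ℝ χ x‖ₑ ≤ A := by
        rw [enorm_eq_nnnorm]; exact_mod_cast hA x
      calc _ ≤ 1 * ‖fderiv ℝ v x‖ₑ + ‖v x - c‖ₑ * A := by gcongr
        _ = _ := by rw [one_mul]
    have hE : eLpNorm (fderiv ℝ w) 2 volume
        ≤ NNReal.sqrt (2 * (1 + A ^ 2 * K₂)) * eLpNorm (fderiv ℝ v) 2 (volume.restrict B) := by
      rw [← ENNReal.pow_le_pow_left_iff (n := 2) (by norm_num), mul_pow, eLpNorm_two_sq,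
        eLpNorm_two_sq]
      have hsupp : (fun x ↦ ‖fderiv ℝ w x‖ₑ ^ 2).support ⊆ B := by
        intro x hx
        have : x ∈ tsupport w := support_fderiv_subset_tsupport w (by
          rw [Function.mem_support] at hx ⊢
          intro h; simp [h, enorm_eq_nnnorm] at hx)
        have := hws this
        rw [mem_closedBall_zero_iff] at this
        rw [hB, mem_ball_zero_iff]; linarith
      rw [← setLIntegral_eq_of_support_subset hsupp]
      calc ∫⁻ x in B, ‖fderiv ℝ w x‖ₑ ^ 2
          ≤ ∫⁻ x in B, (2 * (‖fderiv ℝ v x‖ₑ ^ 2 + A ^ 2 * ‖v x - c‖ₑ ^ 2)) := by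
            refine lintegral_mono fun x ↦ ?_
            calc ‖fderiv ℝ w x‖ₑ ^ 2 ≤ (‖fderiv ℝ v x‖ₑ + A * ‖v x - c‖ₑ) ^ 2 := by
                  gcongr; exact hwd' x
              _ ≤ _ := ennreal_add_sq_le _ _
              _ = _ := by rw [mul_pow]
        _ = 2 * ((∫⁻ x in B, ‖fderiv ℝ v x‖ₑ ^ 2) + A ^ 2 * ∫⁻ x in B, ‖v x - c‖ₑ ^ 2) := by
            have hvc' : Continuous fun x ↦ v x - c := hvc.continuous
            rw [lintegral_const_mul' _ _ (by norm_num), lintegral_add_left (by fun_prop),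
              lintegral_const_mul' _ _ (by finiteness)]
        _ ≤ 2 * ((∫⁻ x in B, ‖fderiv ℝ v x‖ₑ ^ 2) +
              A ^ 2 * (K₂ * ∫⁻ x in B, ‖fderiv ℝ v x‖ₑ ^ 2)) := by gcongr
        _ = _ := by
            rw [show (NNReal.sqrt (2 * (1 + A ^ 2 * K₂)) : ℝ≥0∞) ^ 2
              = ((2 * (1 + A ^ 2 * K₂) : ℝ≥0) : ℝ≥0∞) by rw [← ENNReal.coe_pow, NNReal.sq_sqrt]]
            push_cast; ring
    calc eLpNorm (fun x ↦ v x - c) q (volume.restrict (Metric.ball 0 r))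
        = eLpNorm w q (volume.restrict (Metric.ball 0 r)) := by
          refine eLpNorm_congr_ae ?_
          filter_upwards [ae_restrict_mem Metric.isOpen_ball.measurableSet] with x hx
          rw [hw]
          simp only
          rw [χ.one_of_mem_closedBall (Metric.ball_subset_closedBall hx), one_mul]
      _ ≤ eLpNorm w q volume := eLpNorm_mono_measure _ Measure.restrict_le_self
      _ ≤ K₁ * eLpNorm (fderiv ℝ w) 2 volume := hK₁ w hwd
          (hws.trans (Metric.closedBall_subset_closedBall (by linarith)))
      _ ≤ K₁ * (NNReal.sqrt (2 * (1 + A ^ 2 * K₂)) *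
            eLpNorm (fderiv ℝ v) 2 (volume.restrict B)) := by gcongr
      _ = _ := by push_cast; ring
  refine ⟨K₁ * NNReal.sqrt (2 * (1 + A ^ 2 * K₂)), fun a v hv ↦ ?_⟩
  obtain ⟨c, hc⟩ := key (fun x ↦ v (x + a)) (hv.comp (contDiff_id.add contDiff_const))
  refine ⟨c, ?_⟩
  have hpre : ∀ ρ : ℝ, MeasurePreserving (fun x : EuclideanSpace ℝ (Fin n) ↦ x + a)
      (volume.restrict (Metric.ball 0 ρ)) (volume.restrict (Metric.ball a ρ)) := by
    intro ρ
    have h := (measurePreserving_add_right (volume : Measure (EuclideanSpace ℝ (Fin n))) a)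
    have := h.restrict_preimage (s := Metric.ball a ρ) Metric.isOpen_ball.measurableSet
    convert this using 2
    ext x; simp [dist_eq_norm]
  have hd : Continuous (fderiv ℝ v) := hv.continuous_fderiv (by norm_num)
  rw [← (hpre r).map_eq, ← (hpre (2 * r)).map_eq, eLpNorm_map_measure, eLpNorm_map_measure]
  · have he : fderiv ℝ v ∘ (fun x ↦ x + a) = fderiv ℝ fun x ↦ v (x + a) := by
      ext1 x
      exact (fderiv_comp_add_right a).symm
    rw [he]
    exact hc
  · exact hd.aestronglyMeasurable
  · fun_prop
  · have := hv.continuous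
    exact Continuous.aestronglyMeasurable (by fun_prop)
  · fun_prop

end Sobolev

/-! ### Hopf-Rinow and connectedness from the Riemannian distance -/

section HopfRinow

/-- A complete locally compact metric space in which almost-midpoints exist is proper. -/
theorem properSpace_of_exists_between {M : Type*} [MetricSpace M] [CompleteSpace M]
    [LocallyCompactSpace M]
    (h : ∀ (x y : M) (R ε : ℝ), 0 ≤ R → 0 < ε → dist x y < R + ε → ∃ z, dist x z ≤ R ∧ dist z y < ε) :
    ProperSpace M := by
  suffices H : ∀ x : M, ∀ R : ℝ, IsCompact (Metric.closedBall x R) from ⟨H⟩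
  intro x
  by_contra! hcon
  obtain ⟨R₀, hR₀⟩ := hcon
  set T := {R : ℝ | 0 ≤ R ∧ IsCompact (Metric.closedBall x R)} with hT
  have hdown : ∀ R ∈ T, ∀ r ≤ R, IsCompact (Metric.closedBall x r) := fun R hR r hr ↦
    hR.2.of_isClosed_subset Metric.isClosed_closedBall (Metric.closedBall_subset_closedBall hr)
  have h0 : (0 : ℝ) ∈ T := ⟨le_rfl, by simp⟩
  have hbdd : BddAbove T := ⟨R₀, fun R hR ↦ by
    by_contra! hlt
    exact hR₀ (hdown R hR R₀ hlt.le)⟩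
  set S := sSup T with hS
  have hS0 : 0 ≤ S := le_csSup hbdd h0
  have hlt : ∀ r < S, IsCompact (Metric.closedBall x r) := by
    intro r hr
    obtain ⟨R, hR, hrR⟩ := exists_lt_of_lt_csSup ⟨0, h0⟩ hr
    exact hdown R hR r hrR.le
  -- The supremum `S` of the good radii is itself good: every point of the ball of radius `S` lies
  -- within `ε / 2` of the compact ball of radius `S - ε / 4`, so a finite `ε / 2`-net of the latter
  -- is an `ε`-net of the former.
  have hSc : IsCompact (Metric.closedBall x S) := by
    refine TotallyBounded.isCompact_of_isClosed ?_ Metric.isClosed_closedBall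
    rw [Metric.totallyBounded_iff]
    intro ε hε
    rcases lt_or_ge S (ε / 2) with hSε | hSε
    · refine ⟨{x}, finite_singleton x, fun y hy ↦ ?_⟩
      simp only [mem_singleton_iff, iUnion_iUnion_eq_left, Metric.mem_ball]
      rw [Metric.mem_closedBall] at hy
      linarith
    · obtain ⟨t, ht, hcov⟩ := Metric.totallyBounded_iff.1
        (hlt (S - ε / 4) (by linarith)).totallyBounded (ε / 2) (by positivity)
      refine ⟨t, ht, fun y hy ↦ ?_⟩
      rw [Metric.mem_closedBall, dist_comm] at hy
      obtain ⟨z, hz, hzy⟩ := h x y (S - ε / 4) (ε / 2) (by linarith) (by positivity) (by linarith)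
      have := hcov (show z ∈ Metric.closedBall x (S - ε / 4) by
        rwa [Metric.mem_closedBall, dist_comm])
      simp only [mem_iUnion, Metric.mem_ball, exists_prop] at this ⊢
      obtain ⟨i, hi, hzi⟩ := this
      refine ⟨i, hi, ?_⟩
      rw [dist_comm] at hzy
      linarith [dist_triangle y z i]
  -- Local compactness enlarges the compact ball, so a radius beyond `S` is good as well, a
  -- contradiction.
  obtain ⟨K, hK, hSK⟩ := exists_compact_superset hSc
  obtain ⟨ε, hε, hεK⟩ := hSc.exists_thickening_subset_open isOpen_interior hSK
  have : S + ε / 2 ∈ T := by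
    refine ⟨by linarith, hK.of_isClosed_subset Metric.isClosed_closedBall fun y hy ↦ ?_⟩
    rw [Metric.mem_closedBall, dist_comm] at hy
    obtain ⟨z, hz, hzy⟩ := h x y S ε hS0 hε (by linarith)
    refine interior_subset (hεK ?_)
    rw [Metric.mem_thickening_iff]
    exact ⟨z, by rwa [Metric.mem_closedBall, dist_comm], by rwa [dist_comm]⟩
  linarith [le_csSup hbdd this]

/-- Take a path of length less than `R + ε` and a point on it at distance exactly `R` from `x`. The
path up to there has length at least `R`, so less than `ε` remains. -/
theorem exists_between_of_isRiemannianManifold {n : ℕ} {M : Type*} [MetricSpace M]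
    [ChartedSpace (EuclideanSpace ℝ (Fin n)) M]
    [RiemannianBundle (fun x : M ↦ TangentSpace (𝓡 n) x)] [IsRiemannianManifold (𝓡 n) M]
    (x y : M) (R ε : ℝ) (hR : 0 ≤ R) (hε : 0 < ε)
    (hxy : dist x y < R + ε) : ∃ z, dist x z ≤ R ∧ dist z y < ε := by
  rcases le_or_gt (dist x y) R with hle | hgt
  · exact ⟨y, hle, by simpa using hε⟩
  have h1 : Manifold.riemannianEDist (𝓡 n) x y < ENNReal.ofReal (R + ε) := by
    rw [← IsRiemannianManifold.out (I := 𝓡 n) x y, edist_dist]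
    exact (ENNReal.ofReal_lt_ofReal_iff (by linarith)).2 hxy
  obtain ⟨γ, hγ0, hγ1, hγ, hlen⟩ := Manifold.exists_lt_of_riemannianEDist_lt h1
  have hc : ContinuousOn (fun t ↦ dist x (γ t)) (Icc 0 1) :=
    (continuous_const.dist continuous_id : Continuous fun z ↦ dist x z).comp_continuousOn
      hγ.continuousOn
  obtain ⟨t, ht, hxt⟩ := intermediate_value_Icc (zero_le_one (α := ℝ)) hc
    (show R ∈ Icc (dist x (γ 0)) (dist x (γ 1)) by rw [hγ0, hγ1]; simpa using ⟨hR, hgt.le⟩)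
  simp only at hxt
  refine ⟨γ t, hxt.le, ?_⟩
  rw [← Manifold.pathELength_add ht.1 ht.2] at hlen
  have h2 : edist x (γ t) ≤ Manifold.pathELength (𝓡 n) γ 0 t := by
    rw [IsRiemannianManifold.out (I := 𝓡 n) x (γ t)]
    exact Manifold.riemannianEDist_le_pathELength (hγ.mono (Icc_subset_Icc le_rfl ht.2)) hγ0 rfl ht.1
  have h3 : edist (γ t) y ≤ Manifold.pathELength (𝓡 n) γ t 1 := by
    rw [IsRiemannianManifold.out (I := 𝓡 n) (γ t) y]
    exact Manifold.riemannianEDist_le_pathELength (hγ.mono (Icc_subset_Icc ht.1 le_rfl)) rfl hγ1 ht.2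
  have h4 := (add_le_add h2 h3).trans_lt hlen
  rw [edist_dist, edist_dist, ← ENNReal.ofReal_add dist_nonneg dist_nonneg,
    ENNReal.ofReal_lt_ofReal_iff (by linarith), hxt] at h4
  linarith

/-- The Hopf-Rinow theorem: a complete Riemannian manifold is proper. -/
theorem properSpace_of_isRiemannianManifold (n : ℕ) (M : Type*) [MetricSpace M]
    [ChartedSpace (EuclideanSpace ℝ (Fin n)) M]
    [RiemannianBundle (fun x : M ↦ TangentSpace (𝓡 n) x)] [IsRiemannianManifold (𝓡 n) M]
    [CompleteSpace M] : ProperSpace M :=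
  have : LocallyCompactSpace M := ChartedSpace.locallyCompactSpace (EuclideanSpace ℝ (Fin n)) M
  properSpace_of_exists_between (exists_between_of_isRiemannianManifold (n := n))

/-- The distance in a metric space is finite, and a finite Riemannian distance is witnessed by a
path. -/
theorem preconnectedSpace_of_isRiemannianManifold (n : ℕ) (M : Type*) [MetricSpace M]
    [ChartedSpace (EuclideanSpace ℝ (Fin n)) M]
    [RiemannianBundle (fun x : M ↦ TangentSpace (𝓡 n) x)] [IsRiemannianManifold (𝓡 n) M]
    : PreconnectedSpace M := by
  refine ⟨isPreconnected_of_forall_pair fun x _ y _ ↦ ?_⟩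
  have h1 : Manifold.riemannianEDist (𝓡 n) x y < ⊤ := by
    rw [← IsRiemannianManifold.out (I := 𝓡 n) x y]
    exact edist_lt_top x y
  obtain ⟨γ, hγ0, hγ1, hγ, -⟩ := Manifold.exists_lt_of_riemannianEDist_lt h1
  refine ⟨γ '' Icc 0 1, subset_univ _, ⟨0, by simp, hγ0⟩, ⟨1, by simp, hγ1⟩, ?_⟩
  exact isPreconnected_Icc.image _ hγ.continuousOn

end HopfRinow

/-! ### Gram determinants -/

section Gram

variable {n : ℕ} {V : Type*} [NormedAddCommGroup V] [InnerProductSpace ℝ V]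

/-- The Gram determinant of the images of the standard basis vectors is controlled by the
distortion of the map. -/
theorem sqrt_det_gram_bounds (A : EuclideanSpace ℝ (Fin n) →ₗ[ℝ] V) {lam : ℝ} (hlam : 0 < lam)
    (hl : ∀ v, ‖v‖ ≤ lam * ‖A v‖) (hu : ∀ v, ‖A v‖ ≤ lam * ‖v‖) :
    (lam⁻¹) ^ n ≤ √(Matrix.of fun i j : Fin n ↦ inner ℝ (A (EuclideanSpace.single i 1))
        (A (EuclideanSpace.single j 1))).det ∧
      √(Matrix.of fun i j : Fin n ↦ inner ℝ (A (EuclideanSpace.single i 1))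
        (A (EuclideanSpace.single j 1))).det ≤ lam ^ n := by
  set G : Matrix (Fin n) (Fin n) ℝ := Matrix.of fun i j : Fin n ↦
    inner ℝ (A (EuclideanSpace.single i 1)) (A (EuclideanSpace.single j 1)) with hG
  have hH : G.IsHermitian := by
    ext i j
    simp [hG, Matrix.conjTranspose_apply, real_inner_comm]
  have hquad : ∀ v : EuclideanSpace ℝ (Fin n), dotProduct (v : Fin n → ℝ) (G.mulVec v) = ‖A v‖ ^ 2 := by
    intro v
    have hv : v = ∑ i, v i • EuclideanSpace.single i (1 : ℝ) := by
      ext j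
      simp [Finset.sum_apply, Pi.single_apply]
    conv_rhs => rw [hv]
    rw [map_sum, ← real_inner_self_eq_norm_sq, sum_inner]
    simp only [inner_sum, map_smul, real_inner_smul_left, real_inner_smul_right, dotProduct,
      Matrix.mulVec, hG, Matrix.of_apply, Finset.mul_sum]
    refine Finset.sum_congr rfl fun i _ ↦ Finset.sum_congr rfl fun j _ ↦ by ring
  -- An eigenvalue of the Gram matrix is `‖A e‖²` for a unit eigenvector `e`, and the determinant is
  -- the product of the eigenvalues.
  have heig : ∀ i, (lam⁻¹) ^ 2 ≤ hH.eigenvalues i ∧ hH.eigenvalues i ≤ lam ^ 2 := by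
    intro i
    have h1 := hH.eigenvalues_eq i
    have hn : ‖hH.eigenvectorBasis i‖ = 1 := hH.eigenvectorBasis.norm_eq_one i
    have h2 : hH.eigenvalues i = ‖A (hH.eigenvectorBasis i)‖ ^ 2 := by
      rw [← hquad, h1]
      simp
    have h3 := hl (hH.eigenvectorBasis i)
    have h4 := hu (hH.eigenvectorBasis i)
    rw [hn] at h3 h4
    rw [h2]
    constructor
    · gcongr
      rwa [inv_le_iff_one_le_mul₀' hlam]
    · gcongr
      simpa using h4
  have hdet : G.det = ∏ i, hH.eigenvalues i := by
    simpa using hH.det_eq_prod_eigenvalues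
  rw [hdet]
  constructor
  · apply Real.le_sqrt_of_sq_le
    calc ((lam⁻¹) ^ n) ^ 2 = ∏ i : Fin n, (lam⁻¹) ^ 2 := by simp [← pow_mul, mul_comm]
      _ ≤ _ := Finset.prod_le_prod (fun i _ ↦ by positivity) fun i _ ↦ (heig i).1
  · rw [Real.sqrt_le_left (by positivity)]
    calc _ ≤ ∏ i : Fin n, lam ^ 2 :=
          Finset.prod_le_prod (fun i _ ↦ le_trans (by positivity) (heig i).1) fun i _ ↦ (heig i).2
      _ = _ := by simp [← pow_mul, mul_comm]

/-- The Gram determinant of a composition. -/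
theorem abs_det_mul_sqrt_det_gram (B : EuclideanSpace ℝ (Fin n) →ₗ[ℝ] V)
    (T : EuclideanSpace ℝ (Fin n) →ₗ[ℝ] EuclideanSpace ℝ (Fin n)) :
    |LinearMap.det T| * √(Matrix.of fun i j : Fin n ↦ inner ℝ (B (EuclideanSpace.single i 1))
        (B (EuclideanSpace.single j 1))).det =
      √(Matrix.of fun i j : Fin n ↦ inner ℝ (B (T (EuclideanSpace.single i 1)))
        (B (T (EuclideanSpace.single j 1)))).det := by
  set G : Matrix (Fin n) (Fin n) ℝ := Matrix.of fun i j : Fin n ↦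
    inner ℝ (B (EuclideanSpace.single i 1)) (B (EuclideanSpace.single j 1)) with hG
  set J := LinearMap.toMatrix (EuclideanSpace.basisFun (Fin n) ℝ).toBasis
    (EuclideanSpace.basisFun (Fin n) ℝ).toBasis T with hJ
  have hT : ∀ i, B (T (EuclideanSpace.single i 1)) =
      ∑ k, J k i • B (EuclideanSpace.single k 1) := by
    intro i
    have : T (EuclideanSpace.single i 1) = ∑ k, J k i • EuclideanSpace.single k (1 : ℝ) := by
      ext j
      simp [hJ, LinearMap.toMatrix_apply, Finset.sum_apply, Pi.single_apply]
    rw [this, map_sum]; simp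
  have h1 : (Matrix.of fun i j : Fin n ↦ inner ℝ (B (T (EuclideanSpace.single i 1)))
        (B (T (EuclideanSpace.single j 1)))) = J.transpose * G * J := by
    ext i j
    simp only [Matrix.of_apply, hT, sum_inner, inner_sum, real_inner_smul_left,
      real_inner_smul_right, Matrix.mul_apply, Matrix.transpose_apply, hG, Finset.sum_mul]
    refine Finset.sum_congr rfl fun k _ ↦ Finset.sum_congr rfl fun l _ ↦ by ring
  have hd : LinearMap.det T = J.det := (LinearMap.det_toMatrix _ T).symm
  rw [h1, Matrix.det_mul, Matrix.det_mul, Matrix.det_transpose, hd,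
    show J.det * G.det * J.det = J.det ^ 2 * G.det by ring, Real.sqrt_mul (sq_nonneg _),
    Real.sqrt_sq_eq_abs]

end Gram

/-! ### Riemannian volume under parametrizations of bounded distortion -/

section Distortion

theorem measurableSet_inter_preimage_of_continuousOn {α β : Type*} [TopologicalSpace α]
    [MeasurableSpace α] [OpensMeasurableSpace α] [TopologicalSpace β] [MeasurableSpace β]
    [BorelSpace β] {f : α → β} {s : Set α} (hf : ContinuousOn f s) (hs : MeasurableSet s)
    {A : Set β} (hA : MeasurableSet A) : MeasurableSet (s ∩ f ⁻¹' A) := by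
  have h1 : Measurable fun x : s ↦ f x := (continuousOn_iff_continuous_domRestrict.1 hf).measurable
  have h2 := hs.subtype_image (h1 hA)
  convert h2 using 1
  ext x
  simp [and_comm]

/-- All tangent spaces are the same vector space by definition, but their norms depend on the base
point. This moves a norm along an equality such as `c.symm (c p) = p`. -/
theorem norm_tangent_congr {n : ℕ} {M : Type*} [TopologicalSpace M]
    [ChartedSpace (EuclideanSpace ℝ (Fin n)) M]
    [RiemannianBundle (fun x : M ↦ TangentSpace (𝓡 n) x)] {p q : M} (hpq : p = q)
    (w : TangentSpace (𝓡 n) p) (w' : TangentSpace (𝓡 n) q)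
    (hw : @Eq (EuclideanSpace ℝ (Fin n)) w w') : ‖w‖ = ‖w'‖ := by
  subst hpq
  exact congrArg _ hw

theorem chartVolume_le_riemVol {n : ℕ} {M : Type*} [TopologicalSpace M]
    [ChartedSpace (EuclideanSpace ℝ (Fin n)) M]
    [RiemannianBundle (fun x : M ↦ TangentSpace (𝓡 n) x)] [MeasurableSpace M]
    {c : OpenPartialHomeomorph M (EuclideanSpace ℝ (Fin n))}
    (hc : c ∈ atlas (EuclideanSpace ℝ (Fin n)) M) : chartVolume c ≤ riemVol n M :=
  le_iSup₂ (f := fun c (_ : c ∈ atlas (EuclideanSpace ℝ (Fin n)) M) ↦ chartVolume c) c hc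

/-- `φ` is an injective `C¹` parametrization on the open set `W` whose differential distorts
lengths at most by the factor `lam`. -/
structure DistortionOn {n : ℕ} {M : Type*} [TopologicalSpace M]
    [ChartedSpace (EuclideanSpace ℝ (Fin n)) M]
    [RiemannianBundle (fun x : M ↦ TangentSpace (𝓡 n) x)]
    (φ : EuclideanSpace ℝ (Fin n) → M) (W : Set (EuclideanSpace ℝ (Fin n))) (lam : ℝ≥0) :
    Prop where
  isOpen : IsOpen W
  contMDiffOn : ContMDiffOn (𝓡 n) (𝓡 n) 1 φ W
  injOn : InjOn φ W
  pos : 0 < lam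
  lower : ∀ y ∈ W, ∀ v : EuclideanSpace ℝ (Fin n),
    ‖v‖ ≤ lam * ‖(mfderiv (𝓡 n) (𝓡 n) φ y v : TangentSpace (𝓡 n) (φ y))‖
  upper : ∀ y ∈ W, ∀ v : EuclideanSpace ℝ (Fin n),
    ‖(mfderiv (𝓡 n) (𝓡 n) φ y v : TangentSpace (𝓡 n) (φ y))‖ ≤ lam * ‖v‖

variable {n : ℕ} {M : Type*} [MetricSpace M]
  [ChartedSpace (EuclideanSpace ℝ (Fin n)) M]
  [RiemannianBundle (fun x : M ↦ TangentSpace (𝓡 n) x)]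
  {φ : EuclideanSpace ℝ (Fin n) → M} {W : Set (EuclideanSpace ℝ (Fin n))} {lam : ℝ≥0}

theorem DistortionOn.mono (h : DistortionOn φ W lam) {W' : Set (EuclideanSpace ℝ (Fin n))}
    (hW' : IsOpen W') (hWW' : W' ⊆ W) : DistortionOn φ W' lam :=
  ⟨hW', h.contMDiffOn.mono hWW', h.injOn.mono hWW', h.pos, fun y hy ↦ h.lower y (hWW' hy),
    fun y hy ↦ h.upper y (hWW' hy)⟩

theorem DistortionOn.mdifferentiableAt (h : DistortionOn φ W lam) {z : EuclideanSpace ℝ (Fin n)}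
    (hz : z ∈ W) : MDifferentiableAt (𝓡 n) (𝓡 n) φ z :=
  (h.contMDiffOn.contMDiffAt (h.isOpen.mem_nhds hz)).mdifferentiableAt (by norm_num)

/-- The Jacobian of a parametrization, computed in a chart. -/
theorem DistortionOn.jacobian_bounds [IsManifold (𝓡 n) 1 M] (h : DistortionOn φ W lam)
    {c : OpenPartialHomeomorph M (EuclideanSpace ℝ (Fin n))}
    (hc : c ∈ atlas (EuclideanSpace ℝ (Fin n)) M) {z : EuclideanSpace ℝ (Fin n)} (hz : z ∈ W)
    (hzc : φ z ∈ c.source) :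
    DifferentiableAt ℝ (c ∘ φ) z ∧
    ((lam : ℝ)⁻¹) ^ n ≤ |(fderiv ℝ (c ∘ φ) z).det| * volDensity c (c (φ z)) ∧
      |(fderiv ℝ (c ∘ φ) z).det| * volDensity c (c (φ z)) ≤ (lam : ℝ) ^ n := by
  have hcd := mdifferentiable_of_mem_atlas (I := 𝓡 n) hc
  have hφ := h.mdifferentiableAt hz
  have hτ : MDifferentiableAt (𝓡 n) (𝓡 n) (c ∘ φ) z :=
    (hcd.mdifferentiableAt hzc).comp z hφ
  have hct : c (φ z) ∈ c.target := c.map_source hzc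
  have hev : c.symm ∘ (c ∘ φ) =ᶠ[𝓝 z] φ := by
    filter_upwards [hφ.continuousAt.preimage_mem_nhds (c.open_source.mem_nhds hzc)] with w hw
    exact c.left_inv hw
  have hcomp : mfderiv (𝓡 n) (𝓡 n) (c.symm ∘ (c ∘ φ)) z
      = (mfderiv (𝓡 n) (𝓡 n) c.symm ((c ∘ φ) z)).comp (mfderiv (𝓡 n) (𝓡 n) (c ∘ φ) z) :=
    mfderiv_comp z (hcd.mdifferentiableAt_symm hct) hτ
  set B : EuclideanSpace ℝ (Fin n) →L[ℝ] TangentSpace (𝓡 n) (c.symm (c (φ z))) :=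
    mfderiv (𝓡 n) (𝓡 n) c.symm (c (φ z)) with hB
  set T : EuclideanSpace ℝ (Fin n) →L[ℝ] EuclideanSpace ℝ (Fin n) := fderiv ℝ (c ∘ φ) z with hT
  have hnorm : ∀ v : EuclideanSpace ℝ (Fin n), ‖B (T v)‖
      = ‖(mfderiv (𝓡 n) (𝓡 n) φ z v : TangentSpace (𝓡 n) (φ z))‖ := by
    intro v
    have h1 : (B (T v) : EuclideanSpace ℝ (Fin n)) = mfderiv (𝓡 n) (𝓡 n) φ z v := by
      rw [← hev.mfderiv_eq, hcomp, mfderiv_eq_fderiv]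
      rfl
    exact norm_tangent_congr (c.left_inv hzc) _ _ h1
  -- The Jacobian of the transition map times the density of the chart is the Gram density of the
  -- differential of `φ`, which the distortion bounds control without reference to the chart.
  have hjac := abs_det_mul_sqrt_det_gram (V := TangentSpace (𝓡 n) (c.symm (c (φ z))))
    (B : EuclideanSpace ℝ (Fin n) →ₗ[ℝ] TangentSpace (𝓡 n) (c.symm (c (φ z))))
    (T : EuclideanSpace ℝ (Fin n) →ₗ[ℝ] EuclideanSpace ℝ (Fin n))
  have hbd := sqrt_det_gram_bounds (V := TangentSpace (𝓡 n) (c.symm (c (φ z))))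
    ((B : EuclideanSpace ℝ (Fin n) →ₗ[ℝ] TangentSpace (𝓡 n) (c.symm (c (φ z)))).comp
      (T : EuclideanSpace ℝ (Fin n) →ₗ[ℝ] EuclideanSpace ℝ (Fin n)))
    (lam := lam) (by exact_mod_cast h.pos)
    (fun v ↦ (h.lower z hz v).trans_eq (by rw [← hnorm v]; rfl))
    (fun v ↦ (h.upper z hz v).trans_eq' (by rw [← hnorm v]; rfl))
  refine ⟨mdifferentiableAt_iff_differentiableAt.1 hτ, ?_⟩
  have he : |(fderiv ℝ (c ∘ φ) z).det| * volDensity c (c (φ z)) = _ := hjac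
  rw [he]
  exact hbd

variable [MeasurableSpace M] [BorelSpace M]

/-- The volume of a measurable set in the domain of a chart. -/
theorem chartVolume_apply (c : OpenPartialHomeomorph M (EuclideanSpace ℝ (Fin n))) {A : Set M}
    (hA : MeasurableSet A) :
    chartVolume c A = ∫⁻ y in c '' (A ∩ c.source), ENNReal.ofReal (volDensity c y) := by
  have hm : AEMeasurable c.symm (volume.restrict c.target) :=
    c.symm.continuousOn.aemeasurable c.open_target.measurableSet
  have hset : c.target ∩ c.symm ⁻¹' A = c '' (A ∩ c.source) := by
    ext y
    constructor
    · rintro ⟨hy, hyA⟩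
      exact ⟨c.symm y, ⟨hyA, c.map_target hy⟩, c.right_inv hy⟩
    · rintro ⟨x, ⟨hxA, hx⟩, rfl⟩
      exact ⟨c.map_source hx, by rwa [mem_preimage, c.left_inv hx]⟩
  have hnm : NullMeasurableSet (c.symm ⁻¹' A) (volume.restrict c.target) :=
    hm.nullMeasurableSet_preimage hA
  unfold chartVolume
  rw [Measure.map_apply_of_aemeasurable (hm.mono_ac (withDensity_absolutelyContinuous _ _)) hA,
    withDensity_apply₀ _ hnm, Measure.restrict_restrict₀ hnm, inter_comm, hset]

/-- The Lusin-Souslin theorem: injective continuous images of Borel sets are Borel. -/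
theorem DistortionOn.measurableSet_image (h : DistortionOn φ W lam)
    {S : Set (EuclideanSpace ℝ (Fin n))} (hS : MeasurableSet S) (hSW : S ⊆ W) :
    MeasurableSet (φ '' S) :=
  hS.image_of_continuousOn_injOn (h.contMDiffOn.continuousOn.mono hSW) (h.injOn.mono hSW)

/-- Change of variables by `c ∘ φ`: the resulting integrand is the quantity bounded in
`DistortionOn.jacobian_bounds`. -/
theorem DistortionOn.chartVolume_image_bounds [IsManifold (𝓡 n) 1 M] (h : DistortionOn φ W lam)
    {c : OpenPartialHomeomorph M (EuclideanSpace ℝ (Fin n))}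
    (hc : c ∈ atlas (EuclideanSpace ℝ (Fin n)) M) {S : Set (EuclideanSpace ℝ (Fin n))}
    (hS : MeasurableSet S) (hSW : S ⊆ W) (hSc : MapsTo φ S c.source) :
    volume S ≤ lam ^ n * chartVolume c (φ '' S) ∧
      chartVolume c (φ '' S) ≤ lam ^ n * volume S := by
  have hlam : (0 : ℝ) < lam := by exact_mod_cast h.pos
  have himg : c '' (φ '' S ∩ c.source) = (c ∘ φ) '' S := by
    rw [inter_eq_left.2 (image_subset_iff.2 hSc), image_comp]
  have hd : ∀ z ∈ S, HasFDerivWithinAt (c ∘ φ) (fderiv ℝ (c ∘ φ) z) S z := fun z hz ↦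
    (h.jacobian_bounds hc (hSW hz) (hSc hz)).1.hasFDerivAt.hasFDerivWithinAt
  have hinj : InjOn (c ∘ φ) S := c.injOn.comp (h.injOn.mono hSW) hSc
  have hval : chartVolume c (φ '' S) = ∫⁻ z in S, ENNReal.ofReal
      (|(fderiv ℝ (c ∘ φ) z).det| * volDensity c (c (φ z))) := by
    rw [chartVolume_apply c (h.measurableSet_image hS hSW), himg,
      lintegral_image_eq_lintegral_abs_det_fderiv_mul volume hS hd hinj]
    refine lintegral_congr fun z ↦ ?_
    rw [ENNReal.ofReal_mul (abs_nonneg _)]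
    rfl
  have hlamE : ENNReal.ofReal ((lam : ℝ) ^ n) = (lam : ℝ≥0∞) ^ n := by
    rw [ENNReal.ofReal_pow hlam.le, ENNReal.ofReal_coe_nnreal]
  constructor
  · have h1 : ENNReal.ofReal (((lam : ℝ)⁻¹) ^ n) * volume S ≤ chartVolume c (φ '' S) := by
      rw [hval, ← setLIntegral_const]
      exact setLIntegral_mono' hS fun z hz ↦ ENNReal.ofReal_le_ofReal
        (h.jacobian_bounds hc (hSW hz) (hSc hz)).2.1
    calc volume S = ENNReal.ofReal ((lam : ℝ) ^ n * ((lam : ℝ)⁻¹) ^ n) * volume S := by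
          rw [← mul_pow, mul_inv_cancel₀ hlam.ne']; simp
      _ = lam ^ n * (ENNReal.ofReal (((lam : ℝ)⁻¹) ^ n) * volume S) := by
          rw [ENNReal.ofReal_mul (by positivity), hlamE, mul_assoc]
      _ ≤ _ := by gcongr
  · rw [hval, ← hlamE, ← setLIntegral_const]
    exact setLIntegral_mono' hS fun z hz ↦ ENNReal.ofReal_le_ofReal
        (h.jacobian_bounds hc (hSW hz) (hSc hz)).2.2

/-- A supremum of measures is not computed set by set, so bounds on the individual `chartVolume` do
not suffice. Instead one measure is exhibited that dominates them all: the scaled image of Lebesgue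
measure on `φ '' W`, and `riemVol` itself off `φ '' W`. -/
theorem DistortionOn.riemVol_image_le [IsManifold (𝓡 n) 1 M] (h : DistortionOn φ W lam)
    {S : Set (EuclideanSpace ℝ (Fin n))} (hS : MeasurableSet S) (hSW : S ⊆ W) :
    riemVol n M (φ '' S) ≤ lam ^ n * volume S := by
  have hφm : AEMeasurable φ (volume.restrict W) :=
    h.contMDiffOn.continuousOn.aemeasurable h.isOpen.measurableSet
  have hWm : MeasurableSet (φ '' W) := h.measurableSet_image h.isOpen.measurableSet subset_rfl
  set ν : Measure M := ((lam : ℝ≥0∞) ^ n) • (volume.restrict W).map φ with hν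
  have hνA : ∀ A, MeasurableSet A → ν A = lam ^ n * volume (W ∩ φ ⁻¹' A) := by
    intro A hA
    rw [hν, Measure.smul_apply, smul_eq_mul, Measure.map_apply_of_aemeasurable hφm hA,
      Measure.restrict_apply₀ (hφm.nullMeasurableSet_preimage hA), inter_comm]
  have key : riemVol n M ≤ ν + (riemVol n M).restrict (φ '' W)ᶜ := by
    refine iSup₂_le fun c hc ↦ Measure.le_iff.2 fun A hA ↦ ?_
    rw [Measure.add_apply, Measure.restrict_apply hA, ← measure_inter_add_sdiff A hWm]
    refine add_le_add ?_ (chartVolume_le_riemVol hc _)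
    set S' := W ∩ φ ⁻¹' (A ∩ c.source) with hS'
    have hAc : MeasurableSet (A ∩ c.source) := hA.inter c.open_source.measurableSet
    have hS'm : MeasurableSet S' :=
      measurableSet_inter_preimage_of_continuousOn h.contMDiffOn.continuousOn
        h.isOpen.measurableSet hAc
    have hcv : chartVolume c (A ∩ φ '' W) = chartVolume c (φ '' S') := by
      have hm' := h.measurableSet_image hS'm inter_subset_left
      rw [chartVolume_apply c (hA.inter hWm), chartVolume_apply c hm']
      congr 3
      ext x
      constructor
      · rintro ⟨⟨hxA, z, hz, rfl⟩, hxc⟩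
        exact ⟨⟨z, ⟨hz, hxA, hxc⟩, rfl⟩, hxc⟩
      · rintro ⟨⟨z, ⟨hz, hxA, hxc⟩, rfl⟩, -⟩
        exact ⟨⟨hxA, z, hz, rfl⟩, hxc⟩
    rw [hcv, hνA A hA]
    refine (h.chartVolume_image_bounds hc hS'm inter_subset_left fun z hz ↦ hz.2.2).2.trans ?_
    gcongr
    exact inter_subset_inter_right _ (preimage_mono inter_subset_left)
  have hm := h.measurableSet_image hS hSW
  refine (key _).trans ?_
  rw [Measure.add_apply, Measure.restrict_apply hm, hνA _ hm,
    show φ '' S ∩ (φ '' W)ᶜ = ∅ from disjoint_iff_inter_eq_empty.1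
      (disjoint_compl_right.mono_left (image_mono hSW)), measure_empty, add_zero]
  gcongr
  rintro z ⟨hz, z', hz', he⟩
  rwa [← h.injOn (hSW hz') hz he]

/-- Countably many charts cover `M`. Cutting `S` into pieces that each lie over one chart, the bound
in that chart applies to each piece, and injectivity of `φ` keeps the images disjoint so that they
can be added. -/
theorem DistortionOn.volume_le_riemVol_image [SecondCountableTopology M] [IsManifold (𝓡 n) 1 M]
    (h : DistortionOn φ W lam)
    {S : Set (EuclideanSpace ℝ (Fin n))} (hS : MeasurableSet S) (hSW : S ⊆ W) :
    volume S ≤ lam ^ n * riemVol n M (φ '' S) := by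
  obtain ⟨t, htc, ht⟩ := TopologicalSpace.countable_cover_nhds
    (fun x : M ↦ chart_source_mem_nhds (EuclideanSpace ℝ (Fin n)) x)
  rcases isEmpty_or_nonempty M with hM | hM
  · have : S = ∅ := eq_empty_of_forall_notMem fun z _ ↦ hM.elim (φ z)
    simp [this]
  obtain ⟨f, hf⟩ : ∃ f : ℕ → M, ⋃ k, (chartAt (EuclideanSpace ℝ (Fin n)) (f k)).source = univ := by
    have htn : t.Nonempty := by
      by_contra! h0
      rw [h0] at ht
      simp only [mem_empty_iff_false, iUnion_of_empty, iUnion_empty] at ht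
      exact empty_ne_univ ht
    obtain ⟨f, hf⟩ := htc.exists_eq_range htn
    refine ⟨f, ?_⟩
    rw [hf, biUnion_range] at ht
    exact ht
  set D := disjointed fun k ↦ (chartAt (EuclideanSpace ℝ (Fin n)) (f k)).source with hD
  have hDm : ∀ k, MeasurableSet (D k) := fun k ↦ MeasurableSet.disjointed
    (fun k ↦ (chartAt (EuclideanSpace ℝ (Fin n)) (f k)).open_source.measurableSet) k
  set P : ℕ → Set (EuclideanSpace ℝ (Fin n)) := fun k ↦ S ∩ φ ⁻¹' (D k) with hP
  have hPm : ∀ k, MeasurableSet (P k) := fun k ↦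
    measurableSet_inter_preimage_of_continuousOn
    (h.contMDiffOn.continuousOn.mono hSW) hS (hDm k)
  have hPW : ∀ k, P k ⊆ W := fun k ↦ inter_subset_left.trans hSW
  have hPS : S ⊆ ⋃ k, P k := by
    intro z hz
    have : φ z ∈ ⋃ k, D k := by rw [hD, iUnion_disjointed, hf]; trivial
    obtain ⟨k, hk⟩ := mem_iUnion.1 this
    exact mem_iUnion.2 ⟨k, hz, hk⟩
  calc volume S ≤ ∑' k, volume (P k) := (measure_mono hPS).trans (measure_iUnion_le _)
    _ ≤ ∑' k, lam ^ n * riemVol n M (φ '' P k) := by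
        refine ENNReal.tsum_le_tsum fun k ↦ ?_
        have hk := chart_mem_atlas (EuclideanSpace ℝ (Fin n)) (f k)
        refine (h.chartVolume_image_bounds hk (hPm k) (hPW k)
          fun z hz ↦ disjointed_subset
            (fun k ↦ (chartAt (EuclideanSpace ℝ (Fin n)) (f k)).source) k hz.2).1.trans ?_
        gcongr
        exact chartVolume_le_riemVol hk
    _ = lam ^ n * riemVol n M (⋃ k, φ '' P k) := by
        rw [ENNReal.tsum_mul_left, measure_iUnion]
        · intro i j hij
          refine disjoint_left.2 ?_
          rintro _ ⟨z, hz, rfl⟩ ⟨z', hz', he⟩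
          have := h.injOn (hPW j hz') (hPW i hz) he
          subst this
          exact disjoint_left.1 (disjoint_disjointed
            (fun k ↦ (chartAt (EuclideanSpace ℝ (Fin n)) (f k)).source) hij) hz.2 hz'.2
        · exact fun k ↦ h.measurableSet_image (hPm k) (hPW k)
    _ ≤ _ := by
        gcongr
        exact iUnion_subset fun k ↦ image_mono inter_subset_left

end Distortion

/-! ### The Sobolev-Poincaré inequality in parametrized balls of the manifold -/

section Local

/-- By Lusin-Souslin `φ` is a measurable embedding on `S`, so `f` may be arbitrary. This allows `f`
to be `gradNorm n u` without a proof that it is measurable. -/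
theorem eLpNorm_map_of_injOn {α β F : Type*} [TopologicalSpace α] [PolishSpace α]
    [MeasurableSpace α] [BorelSpace α] [MetricSpace β] [SecondCountableTopology β]
    [MeasurableSpace β] [BorelSpace β] [NormedAddCommGroup F] {ν : Measure α} {φ : α → β}
    {S : Set α} (hS : MeasurableSet S) (hφ : ContinuousOn φ S) (hinj : InjOn φ S)
    (f : β → F) (p : ℝ≥0∞) :
    eLpNorm f p ((ν.restrict S).map φ) = eLpNorm (f ∘ φ) p (ν.restrict S) := by
  have hm : Measurable fun x : S ↦ φ x :=
    (continuousOn_iff_continuous_domRestrict.1 hφ).measurable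
  have : StandardBorelSpace S := hS.standardBorel
  have he : MeasurableEmbedding fun x : S ↦ φ x :=
    hm.measurableEmbedding fun x y h ↦ Subtype.ext (hinj x.2 y.2 h)
  have h1 : (ν.restrict S).map φ = (ν.comap (Subtype.val : S → α)).map fun x : S ↦ φ x := by
    rw [← map_comap_subtype_coe hS, AEMeasurable.map_map_of_aemeasurable]
    · rfl
    · rw [map_comap_subtype_coe hS]; exact hφ.aemeasurable hS
    · exact measurable_subtype_coe.aemeasurable
  rw [h1, he.eLpNorm_map_measure, ← map_comap_subtype_coe hS,
    (MeasurableEmbedding.subtype_coe hS).eLpNorm_map_measure]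
  rfl


/-- Around each point there are parametrized balls of bounded distortion. -/
theorem exists_distortionOn_nhds (n : ℕ) {M : Type*} [TopologicalSpace M]
    [ChartedSpace (EuclideanSpace ℝ (Fin n)) M]
    [RiemannianBundle (fun x : M ↦ TangentSpace (𝓡 n) x)] [IsManifold (𝓡 n) 1 M]
    [IsContinuousRiemannianBundle (EuclideanSpace ℝ (Fin n)) (fun x : M ↦ TangentSpace (𝓡 n) x)]
    (x : M) : ∃ (r : ℝ) (lam : ℝ≥0), 0 < r ∧
      Metric.ball (chartAt (EuclideanSpace ℝ (Fin n)) x x) (4 * r)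
        ⊆ (chartAt (EuclideanSpace ℝ (Fin n)) x).target ∧
      DistortionOn (chartAt (EuclideanSpace ℝ (Fin n)) x).symm
        (Metric.ball (chartAt (EuclideanSpace ℝ (Fin n)) x x) (4 * r)) lam := by
  set c := chartAt (EuclideanSpace ℝ (Fin n)) x with hc
  have hcd := mdifferentiable_chart (I := 𝓡 n) x
  obtain ⟨C₁, hC₁, h1⟩ := eventually_norm_mfderiv_extChartAt_lt (𝓡 n) x
  obtain ⟨C₂, hC₂, h2⟩ := eventually_norm_mfderivWithin_symm_extChartAt_comp_lt (𝓡 n) x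
  have hxs : x ∈ c.source := mem_chart_source _ x
  have hxt : c x ∈ c.target := c.map_source hxs
  have hcont : Tendsto c.symm (𝓝 (c x)) (𝓝 x) := by
    have := c.continuousAt_symm hxt
    rwa [ContinuousAt, c.left_inv hxs] at this
  obtain ⟨ε, hε, hball⟩ := Metric.mem_nhds_iff.1
    (inter_mem (c.open_target.mem_nhds hxt) (hcont (h1.and h2)))
  -- The factor 4 leaves room for later: the inequality will hold on radius `r`, its gradient lives
  -- on `2r`, and a cut-off ends at `3r`.
  refine ⟨ε / 4, max C₁.toNNReal C₂.toNNReal, by positivity, ?_, ?_⟩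
  · rw [show 4 * (ε / 4) = ε by ring]
    exact fun y hy ↦ (hball hy).1
  rw [show 4 * (ε / 4) = ε by ring]
  have ht : Metric.ball (c x) ε ⊆ c.target := fun y hy ↦ (hball hy).1
  refine ⟨Metric.isOpen_ball, ?_, c.symm.injOn.mono ht, ?_, ?_, ?_⟩
  · exact (contMDiffOn_chart_symm (I := 𝓡 n) (n := 1) (x := x)).mono ht
  · exact lt_max_of_lt_left (by simpa using hC₁)
  · intro y hy v
    have hy1 := (hball hy).2.1
    have hyt := ht hy
    have hcomp := hcd.comp_symm_deriv hyt
    have hv : (mfderiv (𝓡 n) (𝓡 n) c (c.symm y)) (mfderiv (𝓡 n) (𝓡 n) c.symm y v) = v := by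
      have := congrArg (fun L : EuclideanSpace ℝ (Fin n) →L[ℝ] EuclideanSpace ℝ (Fin n) ↦ L v) hcomp
      exact this
    have hle : ∀ (L : TangentSpace (𝓡 n) (c.symm y) →L[ℝ] EuclideanSpace ℝ (Fin n))
      (w : TangentSpace (𝓡 n) (c.symm y)), ‖L‖ < C₁ →
        ‖L w‖ ≤ (max C₁.toNNReal C₂.toNNReal : ℝ≥0) * ‖w‖ := fun L w hL ↦
      (L.le_opNorm w).trans (mul_le_mul_of_nonneg_right
        (hL.le.trans ((Real.le_coe_toNNReal C₁).trans (by exact_mod_cast le_max_left _ _)))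
          (norm_nonneg _))
    conv_lhs => rw [← hv]
    exact hle (mfderiv (𝓡 n) (𝓡 n) c (c.symm y)) _ hy1
  · intro y hy v
    have hy2 := (hball hy).2.2
    have hyt := ht hy
    have hle : ∀ (L : EuclideanSpace ℝ (Fin n) →L[ℝ] TangentSpace (𝓡 n) (c.symm y)) 
      (w : EuclideanSpace ℝ (Fin n)), ‖L‖ < C₂ →
        ‖L w‖ ≤ (max C₁.toNNReal C₂.toNNReal : ℝ≥0) * ‖w‖ := fun L w hL ↦
      (L.le_opNorm w).trans (mul_le_mul_of_nonneg_right
        (hL.le.trans ((Real.le_coe_toNNReal C₂).trans (by exact_mod_cast le_max_right _ _)))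
          (norm_nonneg _))
    refine hle (mfderiv (𝓡 n) (𝓡 n) c.symm y) v ?_
    have h3 : extChartAt (𝓡 n) x (c.symm y) = y := c.right_inv hyt
    rw [h3] at hy2
    have h4 : mfderivWithin 𝓘(ℝ, EuclideanSpace ℝ (Fin n)) (𝓡 n) (extChartAt (𝓡 n) x).symm
        (range (𝓡 n)) y = mfderiv (𝓡 n) (𝓡 n) c.symm y := by
      rw [ModelWithCorners.range_eq_univ, mfderivWithin_univ]
      rfl
    rw [h4] at hy2
    exact hy2

variable {n : ℕ} {M : Type*} [MetricSpace M]
  [ChartedSpace (EuclideanSpace ℝ (Fin n)) M]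
  [RiemannianBundle (fun x : M ↦ TangentSpace (𝓡 n) x)]

theorem gradNorm_nonneg (u : M → ℝ) (x : M) : 0 ≤ gradNorm n u x := by
  let du : TangentSpace (𝓡 n) x →L[ℝ] ℝ := mfderiv (𝓡 n) 𝓘(ℝ, ℝ) u x
  exact norm_nonneg du

variable {φ : EuclideanSpace ℝ (Fin n) → M} {W : Set (EuclideanSpace ℝ (Fin n))} {lam : ℝ≥0}

theorem DistortionOn.norm_fderiv_comp_le (h : DistortionOn φ W lam) {u : M → ℝ}
    (hu : ContMDiff (𝓡 n) 𝓘(ℝ, ℝ) ∞ u) {z : EuclideanSpace ℝ (Fin n)} (hz : z ∈ W) :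
    ‖fderiv ℝ (u ∘ φ) z‖ ≤ lam * gradNorm n u (φ z) := by
  refine ContinuousLinearMap.opNorm_le_bound _
    (mul_nonneg lam.2 (gradNorm_nonneg u _)) fun v ↦ ?_
  have hud : MDifferentiableAt (𝓡 n) 𝓘(ℝ, ℝ) u (φ z) := hu.mdifferentiable (by simp) _
  have hcomp : fderiv ℝ (u ∘ φ) z v =
      (mfderiv (𝓡 n) 𝓘(ℝ, ℝ) u (φ z) : TangentSpace (𝓡 n) (φ z) →L[ℝ] ℝ)
        (mfderiv (𝓡 n) (𝓡 n) φ z v) := by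
    rw [← mfderiv_eq_fderiv, mfderiv_comp z hud (h.mdifferentiableAt hz)]
    rfl
  have hle : ∀ (L : TangentSpace (𝓡 n) (φ z) →L[ℝ] ℝ) (w : TangentSpace (𝓡 n) (φ z)),
      ‖L w‖ ≤ ‖L‖ * ‖w‖ := fun L w ↦ L.le_opNorm w
  rw [hcomp]
  calc _ ≤ gradNorm n u (φ z) * ‖(mfderiv (𝓡 n) (𝓡 n) φ z v : TangentSpace (𝓡 n) (φ z))‖ :=
        hle (mfderiv (𝓡 n) 𝓘(ℝ, ℝ) u (φ z)) _
    _ ≤ gradNorm n u (φ z) * (lam * ‖v‖) := by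
        gcongr
        · exact gradNorm_nonneg u _
        · exact h.upper z hz v
    _ = _ := by ring

variable [MeasurableSpace M] [BorelSpace M]

theorem DistortionOn.aemeasurable (h : DistortionOn φ W lam) :
    AEMeasurable φ (volume.restrict W) :=
  h.contMDiffOn.continuousOn.aemeasurable h.isOpen.measurableSet

theorem DistortionOn.map_apply (h : DistortionOn φ W lam) {A : Set M} (hA : MeasurableSet A) :
    (volume.restrict W).map φ A = volume (W ∩ φ ⁻¹' A) := by
  rw [Measure.map_apply_of_aemeasurable h.aemeasurable hA,
      Measure.restrict_apply₀ (h.aemeasurable.nullMeasurableSet_preimage hA), inter_comm]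

/-- The volume bound as an inequality of measures, in which form it compares $L^p$ norms directly.
`DistortionOn.map_volume_le` is the reverse comparison. -/
theorem DistortionOn.restrict_riemVol_le [IsManifold (𝓡 n) 1 M] (h : DistortionOn φ W lam) :
    (riemVol n M).restrict (φ '' W) ≤ ((lam : ℝ≥0∞) ^ n) • (volume.restrict W).map φ := by
  refine Measure.le_iff.2 fun A hA ↦ ?_
  have hm : MeasurableSet (W ∩ φ ⁻¹' A) :=
    measurableSet_inter_preimage_of_continuousOn h.contMDiffOn.continuousOn
      h.isOpen.measurableSet hA
  rw [Measure.restrict_apply hA, Measure.smul_apply, h.map_apply hA, smul_eq_mul,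
    inter_comm A, ← image_inter_preimage]
  exact h.riemVol_image_le hm inter_subset_left

theorem DistortionOn.map_volume_le [SecondCountableTopology M] [IsManifold (𝓡 n) 1 M]
    (h : DistortionOn φ W lam) :
    (volume.restrict W).map φ ≤ ((lam : ℝ≥0∞) ^ n) • riemVol n M := by
  refine Measure.le_iff.2 fun A hA ↦ ?_
  have hm : MeasurableSet (W ∩ φ ⁻¹' A) :=
    measurableSet_inter_preimage_of_continuousOn h.contMDiffOn.continuousOn
      h.isOpen.measurableSet hA
  rw [h.map_apply hA, Measure.smul_apply, smul_eq_mul]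
  refine (h.volume_le_riemVol_image hm inter_subset_left).trans ?_
  gcongr
  rintro _ ⟨z, hz, rfl⟩
  exact hz.2

/-- The Sobolev-Poincaré inequality on a set `B`, with the gradient measured on all of `M`. -/
def SobolevPoincareOn (n : ℕ) {M : Type*} [TopologicalSpace M] [MeasurableSpace M]
    [ChartedSpace (EuclideanSpace ℝ (Fin n)) M]
    [RiemannianBundle (fun x : M ↦ TangentSpace (𝓡 n) x)] (q : ℝ≥0) (B : Set M) (K : ℝ≥0) : Prop :=
  ∀ u : M → ℝ, ContMDiff (𝓡 n) 𝓘(ℝ, ℝ) ∞ u → ∃ c : ℝ,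
    eLpNorm (fun x ↦ u x - c) q ((riemVol n M).restrict B) ≤
      K * eLpNorm (gradNorm n u) 2 (riemVol n M)

variable (n M) in
/-- The Sobolev-Poincaré inequality in parametrized balls, with a constant that depends only on
the radius and on the distortion. -/
theorem exists_sobolevPoincareOn_image_ball [SecondCountableTopology M] [IsManifold (𝓡 n) 1 M]
    (q : ℝ≥0) (hq : 2 ≤ q) (hqn : 2 < n → (q : ℝ) ≤ 2 * n / (n - 2)) {r : ℝ} (hr : 0 < r)
    (lam : ℝ≥0) :
    ∃ K : ℝ≥0, ∀ (φ : EuclideanSpace ℝ (Fin n) → M) (a : EuclideanSpace ℝ (Fin n)),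
      DistortionOn φ (Metric.ball a (4 * r)) lam →
        SobolevPoincareOn n q (φ '' Metric.ball a r) K := by
  obtain ⟨K, hK⟩ := exists_sobolev_poincare n q hq hqn hr
  refine ⟨(lam ^ n) ^ (1 / (q : ℝ)) * (K * (lam * (lam ^ n) ^ (1 / 2 : ℝ))), fun φ a h u hu ↦ ?_⟩
  have hsub1 : Metric.ball a r ⊆ Metric.ball a (4 * r) := Metric.ball_subset_ball (by linarith)
  have hsub2 : Metric.ball a (2 * r) ⊆ Metric.ball a (4 * r) :=
    Metric.ball_subset_ball (by linarith)
  have h1 := h.mono Metric.isOpen_ball hsub1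
  have h2 := h.mono Metric.isOpen_ball hsub2
  -- The Euclidean inequality wants a function on the whole space, while `u ∘ φ` is known to be
  -- differentiable only on the ball of radius `4r`. The cut-off is 1 on radius `2r`, the only
  -- region the inequality sees.
  let χ : ContDiffBump a := ⟨2 * r, 3 * r, by linarith, by linarith⟩
  have hχd : ContDiff ℝ 1 χ := χ.contDiff
  have hv : ContDiffOn ℝ 1 (u ∘ φ) (Metric.ball a (4 * r)) :=
    contMDiffOn_iff_contDiffOn.1
      ((hu.of_le (by norm_num)).comp_contMDiffOn h.contMDiffOn)
  set v : EuclideanSpace ℝ (Fin n) → ℝ := fun z ↦ χ z * u (φ z) with hvdef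
  have hvd : ContDiff ℝ 1 v := by
    rw [contDiff_iff_contDiffAt]
    intro z
    by_cases hz : z ∈ Metric.ball a (4 * r)
    · exact hχd.contDiffAt.mul (hv.contDiffAt (Metric.isOpen_ball.mem_nhds hz))
    · have hz' : z ∉ tsupport χ := by
        rw [χ.tsupport_eq, Metric.mem_closedBall]
        rw [Metric.mem_ball] at hz
        have : χ.rOut = 3 * r := rfl
        rw [this]; linarith
      refine (contDiffAt_const (c := (0 : ℝ))).congr_of_eventuallyEq ?_
      filter_upwards [notMem_tsupport_iff_eventuallyEq.1 hz'] with w hw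
      simp [hvdef, hw]
  have hveq : EqOn v (u ∘ φ) (Metric.ball a (2 * r)) := by
    intro z hz
    have : χ z = 1 := χ.one_of_mem_closedBall (Metric.ball_subset_closedBall hz)
    simp [hvdef, this]
  obtain ⟨c, hc⟩ := hK a v hvd
  refine ⟨c, ?_⟩
  have hq0 : (0 : ℝ) ≤ 1 / (q : ℝ) := by positivity
  calc eLpNorm (fun x ↦ u x - c) q ((riemVol n M).restrict (φ '' Metric.ball a r))
      ≤ eLpNorm (fun x ↦ u x - c) q
          (((lam : ℝ≥0∞) ^ n) • (volume.restrict (Metric.ball a r)).map φ) :=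
        eLpNorm_mono_measure _ h1.restrict_riemVol_le
    _ = ((lam : ℝ≥0∞) ^ n) ^ (1 / (q : ℝ)) * eLpNorm (fun x ↦ u x - c) q
          ((volume.restrict (Metric.ball a r)).map φ) := by
        rw [eLpNorm_smul_measure_of_ne_top ENNReal.coe_ne_top]
        simp
    _ = ((lam : ℝ≥0∞) ^ n) ^ (1 / (q : ℝ)) * eLpNorm ((fun x ↦ u x - c) ∘ φ) q
          (volume.restrict (Metric.ball a r)) := by
        rw [eLpNorm_map_of_injOn h1.isOpen.measurableSet h1.contMDiffOn.continuousOn h1.injOn]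
    _ = ((lam : ℝ≥0∞) ^ n) ^ (1 / (q : ℝ)) * eLpNorm (fun z ↦ v z - c) q
          (volume.restrict (Metric.ball a r)) := by
        congr 1
        refine eLpNorm_congr_ae ?_
        filter_upwards [ae_restrict_mem Metric.isOpen_ball.measurableSet] with z hz
        have := hveq (Metric.ball_subset_ball (by linarith) hz)
        simp only [Function.comp_apply] at this ⊢
        rw [this]
    _ ≤ ((lam : ℝ≥0∞) ^ n) ^ (1 / (q : ℝ)) * (K * eLpNorm (fderiv ℝ v) 2
          (volume.restrict (Metric.ball a (2 * r)))) := by gcongr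
    _ ≤ ((lam : ℝ≥0∞) ^ n) ^ (1 / (q : ℝ)) * (K * (lam * eLpNorm (gradNorm n u ∘ φ) 2
          (volume.restrict (Metric.ball a (2 * r))))) := by
        gcongr
        have := eLpNorm_le_nnreal_smul_eLpNorm_of_ae_le_mul (f := fderiv ℝ v)
          (g := gradNorm n u ∘ φ) (c := lam) (p := 2)
          (μ := volume.restrict (Metric.ball a (2 * r))) ?_
        · exact this
        · filter_upwards [ae_restrict_mem Metric.isOpen_ball.measurableSet] with z hz
          have hz1 : fderiv ℝ v z = fderiv ℝ (u ∘ φ) z :=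
            (hveq.eventuallyEq_of_mem (Metric.isOpen_ball.mem_nhds hz)).fderiv_eq
          rw [hz1, ← NNReal.coe_le_coe]
          push_cast
          refine (h2.norm_fderiv_comp_le hu hz).trans_eq ?_
          rw [Function.comp_apply, Real.norm_of_nonneg (gradNorm_nonneg u _)]
    _ = ((lam : ℝ≥0∞) ^ n) ^ (1 / (q : ℝ)) * (K * (lam * eLpNorm (gradNorm n u) 2
          ((volume.restrict (Metric.ball a (2 * r))).map φ))) := by
        rw [eLpNorm_map_of_injOn h2.isOpen.measurableSet h2.contMDiffOn.continuousOn h2.injOn]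
    _ ≤ ((lam : ℝ≥0∞) ^ n) ^ (1 / (q : ℝ)) * (K * (lam * eLpNorm (gradNorm n u) 2
          (((lam : ℝ≥0∞) ^ n) • riemVol n M))) := by
        gcongr
        exact h2.map_volume_le
    _ = _ := by
        have hs : eLpNorm (gradNorm n u) 2 (((lam : ℝ≥0∞) ^ n) • riemVol n M) =
            ((lam : ℝ≥0∞) ^ n) ^ (1 / 2 : ℝ) * eLpNorm (gradNorm n u) 2 (riemVol n M) := by
          rw [eLpNorm_smul_measure_of_ne_top (by simp)]
          simp
        rw [hs]
        push_cast
        rw [ENNReal.coe_rpow_of_nonneg _ hq0, ENNReal.coe_rpow_of_nonneg _ (by norm_num)]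
        simp only [ENNReal.coe_pow]
        ring

end Local

/-! ### Comparing the constants on overlapping sets -/

section Chaining

theorem eLpNorm_restrict_union_le {α F : Type*} [MeasurableSpace α] [NormedAddCommGroup F]
    {ν : Measure α} (f : α → F) {q : ℝ≥0} (hq : 1 ≤ q) (s t : Set α) :
    eLpNorm f q (ν.restrict (s ∪ t)) ≤ eLpNorm f q (ν.restrict s) + eLpNorm f q (ν.restrict t) := by
  have hq0 : q ≠ 0 := (zero_lt_one.trans_le hq).ne'
  have hq1 : (1 : ℝ) ≤ q := by exact_mod_cast hq
  simp only [eLpNorm_nnreal_eq_lintegral hq0]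
  refine le_trans ?_ (ENNReal.rpow_add_le_add_rpow _ _ (by positivity) ?_)
  · gcongr
    exact lintegral_union_le _ _ _
  · rw [one_div]; exact inv_le_one_of_one_le₀ hq1

variable {α : Type*} [MeasurableSpace α] {ν : Measure α} {f : α → ℝ} {q : ℝ≥0}

theorem eLpNorm_sub_const_le_add (hf : AEStronglyMeasurable f ν) (hq : 1 ≤ q) (B : Set α)
    (c c' : ℝ) : eLpNorm (fun x ↦ f x - c) q (ν.restrict B) ≤
      eLpNorm (fun x ↦ f x - c') q (ν.restrict B) + ‖c' - c‖ₑ * ν B ^ (1 / (q : ℝ)) := by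
  have hq0 : q ≠ 0 := (zero_lt_one.trans_le hq).ne'
  have h1 : (fun x ↦ f x - c) = (fun x ↦ f x - c') + fun _ ↦ c' - c := by
    ext x; simp
  have h2 : eLpNorm (fun _ : α ↦ c' - c) q (ν.restrict B) = ‖c' - c‖ₑ * ν B ^ (1 / (q : ℝ)) := by
    rw [eLpNorm_const' _ (by exact_mod_cast hq0) ENNReal.coe_ne_top]
    simp
  rw [h1, ← h2]
  exact eLpNorm_add_le (hf.restrict.sub aestronglyMeasurable_const) aestronglyMeasurable_const
    (by exact_mod_cast hq)

/-- Constants that approximate the same function on overlapping sets are close. -/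
theorem enorm_sub_le_of_overlap (hf : AEStronglyMeasurable f ν) (hq : 1 ≤ q) {B B' : Set α}
    {c c' : ℝ} {a a' : ℝ≥0∞} (h : eLpNorm (fun x ↦ f x - c) q (ν.restrict B) ≤ a)
    (h' : eLpNorm (fun x ↦ f x - c') q (ν.restrict B') ≤ a') {ε : ℝ≥0} (hε : ε ≠ 0)
    (hBB' : (ε : ℝ≥0∞) ≤ ν (B ∩ B')) :
    ‖c - c'‖ₑ ≤ (ε ^ (1 / (q : ℝ)) : ℝ≥0)⁻¹ * (a + a') := by
  have hq0 : q ≠ 0 := (zero_lt_one.trans_le hq).ne'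
  have hε' : (ε ^ (1 / (q : ℝ)) : ℝ≥0) ≠ 0 := by positivity
  have h1 : (fun _ : α ↦ c - c') = (fun x ↦ f x - c') - fun x ↦ f x - c := by
    ext x; simp
  have h2 : eLpNorm (fun _ : α ↦ c - c') q (ν.restrict (B ∩ B'))
      = ‖c - c'‖ₑ * ν (B ∩ B') ^ (1 / (q : ℝ)) := by
    rw [eLpNorm_const' _ (by exact_mod_cast hq0) ENNReal.coe_ne_top]
    simp
  have h3 : ‖c - c'‖ₑ * (ε ^ (1 / (q : ℝ)) : ℝ≥0) ≤ a + a' := by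
    calc ‖c - c'‖ₑ * (ε ^ (1 / (q : ℝ)) : ℝ≥0) ≤ ‖c - c'‖ₑ * ν (B ∩ B') ^ (1 / (q : ℝ)) := by
          rw [ENNReal.coe_rpow_of_nonneg _ (by positivity)]
          gcongr
      _ = eLpNorm ((fun x ↦ f x - c') - fun x ↦ f x - c) q (ν.restrict (B ∩ B')) := by
          rw [← h2, h1]
      _ ≤ eLpNorm (fun x ↦ f x - c') q (ν.restrict (B ∩ B'))
          + eLpNorm (fun x ↦ f x - c) q (ν.restrict (B ∩ B')) :=
          eLpNorm_sub_le (hf.restrict.sub aestronglyMeasurable_const)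
            (hf.restrict.sub aestronglyMeasurable_const) (by exact_mod_cast hq)
      _ ≤ a' + a := by
          refine add_le_add (le_trans ?_ h') (le_trans ?_ h)
          · exact eLpNorm_mono_measure _ (Measure.restrict_mono inter_subset_right le_rfl)
          · exact eLpNorm_mono_measure _ (Measure.restrict_mono inter_subset_left le_rfl)
      _ = _ := add_comm _ _
  rw [ENNReal.coe_inv hε', mul_comm, ← div_eq_mul_inv, ENNReal.le_div_iff_mul_le]
  · exact h3
  · left; exact_mod_cast hε'
  · left; exact ENNReal.coe_ne_top

end Chaining

/-! ### Joining local inequalities over compact sets -/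

section CompactSets

variable {n : ℕ} {M : Type*} [MetricSpace M] [SecondCountableTopology M]
  [ChartedSpace (EuclideanSpace ℝ (Fin n)) M] [IsManifold (𝓡 n) 1 M]
  [RiemannianBundle (fun x : M ↦ TangentSpace (𝓡 n) x)]
  [IsContinuousRiemannianBundle (EuclideanSpace ℝ (Fin n)) (fun x : M ↦ TangentSpace (𝓡 n) x)]
  [MeasurableSpace M] [BorelSpace M] {q : ℝ≥0}

theorem riemVol_pos_of_isOpen {O : Set M} (hO : IsOpen O) (hne : O.Nonempty) :
    0 < riemVol n M O := by
  obtain ⟨x, hx⟩ := hne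
  obtain ⟨r, lam, hr, hsub, h⟩ := exists_distortionOn_nhds n x
  set c := chartAt (EuclideanSpace ℝ (Fin n)) x
  have hxs : x ∈ c.source := mem_chart_source _ x
  set S := Metric.ball (c x) (4 * r) ∩ c.symm ⁻¹' O with hS
  have hSo : IsOpen S := h.contMDiffOn.continuousOn.isOpen_inter_preimage h.isOpen hO
  have hSne : S.Nonempty := ⟨c x, Metric.mem_ball_self (by positivity), by
    rwa [mem_preimage, c.left_inv hxs]⟩
  have h1 := h.volume_le_riemVol_image hSo.measurableSet inter_subset_left
  have h2 : 0 < volume S := hSo.measure_pos volume hSne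
  have h3 : riemVol n M (c.symm '' S) ≤ riemVol n M O :=
    measure_mono (by rintro _ ⟨z, hz, rfl⟩; exact hz.2)
  by_contra! h0
  rw [le_antisymm (h3.trans h0) bot_le] at h1
  simp at h1
  exact h2.ne' h1

/-- Overlapping open sets on which the Sobolev-Poincaré inequality holds can be joined. -/
theorem SobolevPoincareOn.union (hq : 1 ≤ q) {B B' : Set M} {K K' : ℝ≥0}
    (hB : SobolevPoincareOn n q B K) (hB' : SobolevPoincareOn n q B' K')
    (hBo : IsOpen B) (hBo' : IsOpen B') (hne : (B ∩ B').Nonempty) (hfin : riemVol n M B' < ⊤) :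
    ∃ K'', SobolevPoincareOn n q (B ∪ B') K'' := by
  have hpos := riemVol_pos_of_isOpen (n := n) (hBo.inter hBo') hne
  obtain ⟨ε, hε, hεB⟩ : ∃ ε : ℝ≥0, ε ≠ 0 ∧ (ε : ℝ≥0∞) ≤ riemVol n M (B ∩ B') := by
    obtain ⟨ε, h1, h2⟩ := ENNReal.lt_iff_exists_nnreal_btwn.1 hpos
    exact ⟨ε, by exact_mod_cast h1.ne', h2.le⟩
  obtain ⟨V, hV⟩ : ∃ V : ℝ≥0, (V : ℝ≥0∞) = riemVol n M B' := WithTop.ne_top_iff_exists.1 hfin.ne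
  -- The constant of `B` is kept. On `B'` it replaces the one of `B'`, at the cost of their
  -- difference times the `q`-th root of the volume of `B'`.
  refine ⟨K + (K' + (ε ^ (1 / (q : ℝ)) : ℝ≥0)⁻¹ * (K' + K) * V ^ (1 / (q : ℝ))), fun u hu ↦ ?_⟩
  obtain ⟨c, hc⟩ := hB u hu
  obtain ⟨c', hc'⟩ := hB' u hu
  have hum : AEStronglyMeasurable u (riemVol n M) := hu.continuous.aestronglyMeasurable
  refine ⟨c, (eLpNorm_restrict_union_le _ hq _ _).trans ?_⟩
  have h1 := enorm_sub_le_of_overlap hum hq hc' hc hε (by rwa [inter_comm])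
  have h2 := eLpNorm_sub_const_le_add hum hq B' c c'
  calc _ ≤ K * eLpNorm (gradNorm n u) 2 (riemVol n M) +
      (K' * eLpNorm (gradNorm n u) 2 (riemVol n M) +
        ((ε ^ (1 / (q : ℝ)) : ℝ≥0)⁻¹ * (K' * eLpNorm (gradNorm n u) 2 (riemVol n M) +
          K * eLpNorm (gradNorm n u) 2 (riemVol n M))) * riemVol n M B' ^ (1 / (q : ℝ))) := by
        refine add_le_add hc (h2.trans ?_)
        gcongr
    _ = _ := by
        rw [← hV]
        push_cast
        rw [ENNReal.coe_rpow_of_nonneg V (by positivity)]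
        ring

/-- Every compact set has an open neighbourhood of finite volume on which the Sobolev-Poincaré
inequality holds. -/
theorem exists_sobolevPoincareOn_superset [PreconnectedSpace M] [Nonempty M]
    (hq : 2 ≤ q) (hqn : 2 < n → (q : ℝ) ≤ 2 * n / (n - 2)) {A : Set M} (hA : IsCompact A) :
    ∃ (B : Set M) (K : ℝ≥0), IsOpen B ∧ A ⊆ B ∧ riemVol n M B < ⊤ ∧ SobolevPoincareOn n q B K := by
  have hq1 : 1 ≤ q := one_le_two.trans hq
  have hloc : ∀ x : M, ∃ (B : Set M) (K : ℝ≥0), IsOpen B ∧ x ∈ B ∧ riemVol n M B < ⊤ ∧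
      SobolevPoincareOn n q B K := by
    intro x
    obtain ⟨r, lam, hr, hsub, h⟩ := exists_distortionOn_nhds n x
    obtain ⟨K, hK⟩ := exists_sobolevPoincareOn_image_ball n M q hq hqn hr lam
    set c := chartAt (EuclideanSpace ℝ (Fin n)) x
    have hsub' : Metric.ball (c x) r ⊆ Metric.ball (c x) (4 * r) :=
      Metric.ball_subset_ball (by linarith)
    refine ⟨c.symm '' Metric.ball (c x) r, K, ?_, ?_, ?_, hK _ _ h⟩
    · exact c.symm.isOpen_image_of_subset_source Metric.isOpen_ball (hsub'.trans hsub)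
    · exact ⟨c x, Metric.mem_ball_self hr, c.left_inv (mem_chart_source _ x)⟩
    · refine (h.riemVol_image_le Metric.isOpen_ball.measurableSet hsub').trans_lt ?_
      exact ENNReal.mul_lt_top (by finiteness) measure_ball_lt_top
  obtain ⟨x₀⟩ := ‹Nonempty M›
  -- The points that share a good open set with `x₀`. This set is open and closed, hence all of `M`.
  set G : Set M := {x | ∃ (B : Set M) (K : ℝ≥0), IsOpen B ∧ x₀ ∈ B ∧ x ∈ B ∧ riemVol n M B < ⊤ ∧
      SobolevPoincareOn n q B K} with hG
  have hunion : ∀ (B B' : Set M) (K K' : ℝ≥0), IsOpen B → IsOpen B' → riemVol n M B < ⊤ →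
      riemVol n M B' < ⊤ → SobolevPoincareOn n q B K → SobolevPoincareOn n q B' K' →
      (B ∩ B').Nonempty → riemVol n M (B ∪ B') < ⊤ ∧ ∃ K'', SobolevPoincareOn n q (B ∪ B') K'' :=
    fun B B' K K' hBo hBo' hBf hBf' hB hB' hne ↦
      ⟨(measure_union_le _ _).trans_lt (ENNReal.add_lt_top.2 ⟨hBf, hBf'⟩),
        hB.union hq1 hB' hBo hBo' hne hBf'⟩
  have hGo : IsOpen G := by
    rw [isOpen_iff_mem_nhds]
    rintro x ⟨B, K, hBo, hx₀, hx, hf, hB⟩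
    exact mem_of_superset (hBo.mem_nhds hx) fun y hy ↦ ⟨B, K, hBo, hx₀, hy, hf, hB⟩
  have hGc : IsClosed G := by
    refine isClosed_of_closure_subset fun x hx ↦ ?_
    obtain ⟨B, K, hBo, hxB, hf, hB⟩ := hloc x
    obtain ⟨y, hyB, B', K', hBo', hx₀, hy, hf', hB'⟩ := mem_closure_iff.1 hx B hBo hxB
    obtain ⟨hfU, K'', hK''⟩ := hunion B B' K K' hBo hBo' hf hf' hB hB' ⟨y, hyB, hy⟩
    exact ⟨B ∪ B', K'', hBo.union hBo', Or.inr hx₀, Or.inl hxB, hfU, hK''⟩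
  have hGne : G.Nonempty := by
    obtain ⟨B, K, hBo, hxB, hf, hB⟩ := hloc x₀
    exact ⟨x₀, B, K, hBo, hxB, hxB, hf, hB⟩
  have hGu : G = univ := IsClopen.eq_univ ⟨hGc, hGo⟩ hGne
  -- Requiring `x₀ ∈ B` makes any two of the sets overlap, so that unions in the compactness
  -- induction are admissible.
  have hmain : ∃ (B : Set M) (K : ℝ≥0), IsOpen B ∧ x₀ ∈ B ∧ A ⊆ B ∧ riemVol n M B < ⊤ ∧
      SobolevPoincareOn n q B K := by
    refine hA.induction_on (p := fun A ↦ ∃ (B : Set M) (K : ℝ≥0), IsOpen B ∧ x₀ ∈ B ∧ A ⊆ B ∧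
      riemVol n M B < ⊤ ∧ SobolevPoincareOn n q B K) ?_ ?_ ?_ ?_
    · obtain ⟨B, K, hBo, hxB, hf, hB⟩ := hloc x₀
      exact ⟨B, K, hBo, hxB, empty_subset _, hf, hB⟩
    · rintro s t hst ⟨B, K, hBo, hx₀, ht, hf, hB⟩
      exact ⟨B, K, hBo, hx₀, hst.trans ht, hf, hB⟩
    · rintro s t ⟨B, K, hBo, hx₀, hs, hf, hB⟩ ⟨B', K', hBo', hx₀', ht, hf', hB'⟩
      obtain ⟨hfU, K'', hK''⟩ := hunion B B' K K' hBo hBo' hf hf' hB hB' ⟨x₀, hx₀, hx₀'⟩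
      exact ⟨B ∪ B', K'', hBo.union hBo', Or.inl hx₀, union_subset_union hs ht, hfU, hK''⟩
    · intro x _
      obtain ⟨B, K, hBo, hx₀, hx, hf, hB⟩ : x ∈ G := hGu ▸ mem_univ x
      exact ⟨B, mem_nhdsWithin_of_mem_nhds (hBo.mem_nhds hx), B, K, hBo, hx₀, subset_rfl, hf, hB⟩
  obtain ⟨B, K, hBo, -, h⟩ := hmain
  exact ⟨B, K, hBo, h⟩

end CompactSets

/-! ### A smooth Riemannian metric is continuous -/

section Bundle

theorem isContinuousRiemannianBundle_of_isContMDiff {EB HB B F : Type*} [NormedAddCommGroup EB]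
    [NormedSpace ℝ EB] [TopologicalSpace HB] {IB : ModelWithCorners ℝ EB HB} {k : ℕ∞ω}
    [TopologicalSpace B] [ChartedSpace HB B] [NormedAddCommGroup F] [NormedSpace ℝ F]
    {E : B → Type*} [TopologicalSpace (TotalSpace F E)]
    [∀ x, NormedAddCommGroup (E x)] [∀ x, InnerProductSpace ℝ (E x)]
    [FiberBundle F E] [VectorBundle ℝ F E] (h : IsContMDiffRiemannianBundle IB k F E) :
    IsContinuousRiemannianBundle F E := by
  obtain ⟨g, hg, hinner⟩ := h.exists_contMDiff
  exact ⟨g, hg.continuous, hinner⟩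

end Bundle

/-! ### The cylindrical coordinate and the dimension of the cross-section -/

section Topology

variable {n m : ℕ} {M : Type*} [MetricSpace M]
  [ChartedSpace (EuclideanSpace ℝ (Fin n)) M]
  [RiemannianBundle (fun x : M ↦ TangentSpace (𝓡 n) x)]
  {X : Type*} [TopologicalSpace X]
  [ChartedSpace (EuclideanSpace ℝ (Fin m)) X]
  [RiemannianBundle (fun x : X ↦ TangentSpace (𝓡 m) x)]
  (S : ACylStructure n m M X)

namespace ACylStructure

theorem mem_source {t : ℝ} (ht : 0 ≤ t) (y : X) : (t, y) ∈ S.Φ.source := by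
  rw [S.source_eq]; exact ⟨ht, mem_univ _⟩

theorem t_nonneg (x : M) : 0 ≤ S.t x := by
  unfold t
  split_ifs with h
  · exact le_rfl
  · have : S.Φ.symm x ∈ S.Φ.source := S.Φ.map_target (by rw [S.target_eq]; exact h)
    rw [S.source_eq] at this
    exact this.1

theorem map_notMem_U {t : ℝ} (ht : 0 ≤ t) (y : X) : S.Φ (t, y) ∉ S.U := by
  have := S.Φ.map_source (S.mem_source ht y)
  rwa [S.target_eq] at this

theorem t_map {t : ℝ} (ht : 0 ≤ t) (y : X) : S.t (S.Φ (t, y)) = t := by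
  unfold ACylStructure.t
  rw [if_neg (S.map_notMem_U ht y), S.Φ.left_inv (S.mem_source ht y)]

theorem exists_eq_map {x : M} (hx : x ∉ S.U) : ∃ y : X, x = S.Φ (S.t x, y) := by
  refine ⟨(S.Φ.symm x).2, ?_⟩
  unfold ACylStructure.t
  rw [if_neg hx]
  exact (S.Φ.right_inv (by rw [S.target_eq]; exact hx)).symm

theorem t_of_mem_U {x : M} (hx : x ∈ S.U) : S.t x = 0 := if_pos hx

theorem notMem_U_of_t_pos {x : M} (hx : 0 < S.t x) : x ∉ S.U := fun h ↦ by
  rw [S.t_of_mem_U h] at hx; exact hx.false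

theorem continuousOn_t : ContinuousOn S.t S.Uᶜ := by
  have h : ContinuousOn (fun x ↦ (S.Φ.symm x).1) S.Uᶜ := by
    have := S.smooth_symm.continuousOn
    rw [S.target_eq] at this
    exact continuous_fst.comp_continuousOn this
  exact h.congr fun x hx ↦ if_neg hx

theorem measurable_t [MeasurableSpace M] [BorelSpace M] : Measurable S.t := by
  refine measurable_of_restrict_of_restrict_compl S.isOpen_U.measurableSet ?_ ?_
  · have : S.U.domRestrict S.t = fun _ ↦ 0 := funext fun x ↦ S.t_of_mem_U x.2
    rw [this]
    exact measurable_const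
  · exact (continuousOn_iff_continuous_domRestrict.1 S.continuousOn_t).measurable

/-- A bound for `t` on the closure of the bounded domain. -/
theorem exists_t_le_of_mem_closure_U [ProperSpace M] :
    ∃ R : ℝ, 0 ≤ R ∧ ∀ x ∈ closure S.U, S.t x ≤ R := by
  have hK : IsCompact (closure S.U ∩ S.Uᶜ) :=
    S.isBounded_U.isCompact_closure.inter_right S.isOpen_U.isClosed_compl
  obtain ⟨R, hR⟩ := (hK.image_of_continuousOn (S.continuousOn_t.mono inter_subset_right)).bddAbove
  refine ⟨max R 0, le_max_right _ _, fun x hx ↦ ?_⟩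
  by_cases hxU : x ∈ S.U
  · rw [S.t_of_mem_U hxU]; exact le_max_right _ _
  · exact (hR ⟨x, ⟨hx, hxU⟩, rfl⟩).trans (le_max_left _ _)

/-- Truncating at a level above the values of `t` on the closure of `U` gives continuity without
having to show that `t` vanishes on the boundary of `U`. -/
theorem continuous_max_t {R : ℝ} (hR : ∀ x ∈ closure S.U, S.t x ≤ R) :
    Continuous fun x ↦ max (S.t x) R := by
  have h1 : ContinuousOn (fun x ↦ max (S.t x) R) S.Uᶜ := S.continuousOn_t.sup continuousOn_const
  have h2 : ContinuousOn (fun x ↦ max (S.t x) R) (closure S.U) :=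
    continuousOn_const.congr fun x hx ↦ max_eq_right (hR x hx)
  rw [← continuousOn_univ, show (univ : Set M) = S.Uᶜ ∪ closure S.U from
    (eq_univ_of_forall fun x ↦ (em (x ∈ S.U)).elim (fun h ↦ Or.inr (subset_closure h)) Or.inl).symm]
  exact h1.union_of_isClosed h2 S.isOpen_U.isClosed_compl isClosed_closure

/-- The sublevel sets of `t` are relatively compact. -/
theorem exists_isCompact_superset [ProperSpace M] [CompactSpace X] (T : ℝ) :
    ∃ A : Set M, IsCompact A ∧ ∀ x, S.t x ≤ T → x ∈ A := by
  refine ⟨closure S.U ∪ S.Φ '' (Icc 0 T ×ˢ univ), S.isBounded_U.isCompact_closure.union ?_, ?_⟩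
  · refine (isCompact_Icc.prod isCompact_univ).image_of_continuousOn (S.smooth.continuousOn.mono ?_)
    rw [S.source_eq]
    exact prod_mono Icc_subset_Ici_self subset_rfl
  · intro x hx
    by_cases hxU : x ∈ S.U
    · exact Or.inl (subset_closure hxU)
    · obtain ⟨y, hy⟩ := S.exists_eq_map hxU
      exact Or.inr ⟨(S.t x, y), ⟨⟨S.t_nonneg x, hx⟩, mem_univ _⟩, hy.symm⟩

theorem contMDiffAt_map {t : ℝ} (ht : 0 < t) (y : X) :
    ContMDiffAt (𝓘(ℝ, ℝ).prod (𝓡 m)) (𝓡 n) ∞ S.Φ (t, y) := by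
  refine S.smooth.contMDiffAt ?_
  rw [S.source_eq]
  exact prod_mem_nhds (Ici_mem_nhds ht) univ_mem

/-- The dimension of the cross-section. -/
theorem dim_eq (S : ACylStructure n m M X) [ProperSpace M] [Nonempty X] : n = m + 1 := by
  obtain ⟨R, hR0, hR⟩ := S.exists_t_le_of_mem_closure_U
  obtain ⟨y⟩ := ‹Nonempty X›
  -- At height `R + 1` the point is off the closure of `U`, so `Φ` and its inverse are both defined
  -- near it and their differentials are mutually inverse.
  have ht : 0 < R + 1 := by linarith
  set p : ℝ × X := (R + 1, y) with hp
  have htx : S.t (S.Φ p) = R + 1 := S.t_map ht.le y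
  have hx : S.Φ p ∉ closure S.U := fun h ↦ by linarith [hR _ h]
  have hd : MDifferentiableAt (𝓘(ℝ, ℝ).prod (𝓡 m)) (𝓡 n) S.Φ p :=
    (S.contMDiffAt_map ht y).mdifferentiableAt (by simp)
  have hnhds : S.Φ.target ∈ 𝓝 (S.Φ p) := by
    rw [S.target_eq]
    exact mem_of_superset (isClosed_closure.isOpen_compl.mem_nhds hx)
      (compl_subset_compl.2 subset_closure)
  have hds : MDifferentiableAt (𝓡 n) (𝓘(ℝ, ℝ).prod (𝓡 m)) S.Φ.symm (S.Φ p) :=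
    (S.smooth_symm.contMDiffAt hnhds).mdifferentiableAt (by simp)
  have hpp : S.Φ.symm (S.Φ p) = p := S.Φ.left_inv (S.mem_source ht.le y)
  have hev1 : S.Φ.symm ∘ S.Φ =ᶠ[𝓝 p] id := by
    have : S.Φ.source ∈ 𝓝 p := by
      rw [S.source_eq]
      exact prod_mem_nhds (Ici_mem_nhds ht) univ_mem
    filter_upwards [this] with z hz
    exact S.Φ.left_inv hz
  have hev2 : S.Φ ∘ S.Φ.symm =ᶠ[𝓝 (S.Φ p)] id := by
    filter_upwards [hnhds] with z hz
    exact S.Φ.right_inv hz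
  have hc1 := mfderiv_comp p hds hd
  have hc2 := mfderiv_comp (S.Φ p) (hpp.symm ▸ hd) hds
  rw [hev1.mfderiv_eq, mfderiv_id] at hc1
  rw [hev2.mfderiv_eq, mfderiv_id] at hc2
  have key : ∀ (A : ℝ × EuclideanSpace ℝ (Fin m) →L[ℝ] EuclideanSpace ℝ (Fin n))
      (B : EuclideanSpace ℝ (Fin n) →L[ℝ] ℝ × EuclideanSpace ℝ (Fin m)), B.comp A = .id ℝ _ →
        m + 1 ≤ n := by
    intro A B h
    have := LinearMap.finrank_le_finrank_of_injective (f := (A : _ →ₗ[ℝ] _))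
      (Function.LeftInverse.injective (g := B) fun v ↦ congrArg (fun L ↦ L v) h)
    simpa [add_comm] using this
  have key2 : ∀ (A : ℝ × EuclideanSpace ℝ (Fin m) →L[ℝ] EuclideanSpace ℝ (Fin n))
      (B : EuclideanSpace ℝ (Fin n) →L[ℝ] ℝ × EuclideanSpace ℝ (Fin m)), A.comp B = .id ℝ _ →
        n ≤ m + 1 := by
    intro A B h
    have := LinearMap.finrank_le_finrank_of_injective (f := (B : _ →ₗ[ℝ] _))
      (Function.LeftInverse.injective (g := A) fun v ↦ congrArg (fun L ↦ L v) h)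
    simpa [add_comm] using this
  exact le_antisymm (key2 _ _ hc2.symm) (key _ _ hc1.symm)

end ACylStructure

end Topology

/-! ### Comparison with the product metric on the end -/

section CylindricalEnd

variable {n m : ℕ} {M : Type*} [MetricSpace M]
  [ChartedSpace (EuclideanSpace ℝ (Fin n)) M]
  [RiemannianBundle (fun x : M ↦ TangentSpace (𝓡 n) x)]
  {X : Type*} [TopologicalSpace X]

theorem pullbackMetric_self (Φ : ℝ × X → M) (c : OpenPartialHomeomorph X (EuclideanSpace ℝ (Fin m)))
    (p v : ℝ × EuclideanSpace ℝ (Fin m)) : pullbackMetric n Φ c p v v =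
      ‖(mfderiv 𝓘(ℝ, ℝ × EuclideanSpace ℝ (Fin m)) (𝓡 n) (inCoord Φ c) p v :
        TangentSpace (𝓡 n) (inCoord Φ c p))‖ ^ 2 := by
  unfold pullbackMetric
  rw [real_inner_self_eq_norm_sq]

variable [ChartedSpace (EuclideanSpace ℝ (Fin m)) X]
  [RiemannianBundle (fun x : X ↦ TangentSpace (𝓡 m) x)]

theorem cylMetric_self (c : OpenPartialHomeomorph X (EuclideanSpace ℝ (Fin m)))
    (p v : ℝ × EuclideanSpace ℝ (Fin m)) : cylMetric c p v v =
      v.1 ^ 2 + ‖(mfderiv (𝓡 m) (𝓡 m) c.symm p.2 v.2 : TangentSpace (𝓡 m) (c.symm p.2))‖ ^ 2 := by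
  unfold cylMetric
  rw [real_inner_self_eq_norm_sq]
  ring

variable (S : ACylStructure n m M X)

namespace ACylStructure

/-- Far out on the end, the metric is comparable to the product metric. -/
theorem exists_abs_pullbackMetric_sub_le : ∃ T : ℝ, 0 ≤ T ∧ ∀ t ≥ T,
    ∀ c ∈ atlas (EuclideanSpace ℝ (Fin m)) X, ∀ y ∈ c.target,
    ∀ v : ℝ × EuclideanSpace ℝ (Fin m),
      |pullbackMetric n S.Φ c (t, y) v v - cylMetric c (t, y) v v|
        ≤ 1 / 2 * cylMetric c (t, y) v v := by
  obtain ⟨δ, hδ, hdec⟩ := S.decay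
  obtain ⟨C, hC⟩ := hdec 0
  have hlim : Tendsto (fun t : ℝ ↦ C * Real.exp (-δ * t)) atTop (𝓝 0) := by
    have h1 : Tendsto (fun t : ℝ ↦ -δ * t) atTop atBot :=
      tendsto_id.const_mul_atTop_of_neg (by linarith)
    simpa using (Real.tendsto_exp_atBot.comp h1).const_mul C
  have hsmall : ∀ᶠ t : ℝ in atTop, C * Real.exp (-δ * t) ≤ 1 / 2 :=
    hlim.eventually_le_const (by norm_num)
  obtain ⟨T, hT⟩ := eventually_atTop.1 (hC.and hsmall)
  refine ⟨max T 0, le_max_right _ _, fun t ht c hc y hy v ↦ ?_⟩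
  obtain ⟨h1, h2⟩ := hT t ((le_max_left _ _).trans ht)
  -- The decay of order `k = 0`, with both arguments of the tensor equal to `v`, so that the product
  -- of the two square roots is the metric itself.
  have h3 := h1 c hc y hy fun _ ↦ v
  have hnn : 0 ≤ cylMetric c (t, y) v v := by rw [cylMetric_self]; positivity
  have hprod : ∏ _i : Fin (2 + 0), √(cylMetric c (t, y) v v) = cylMetric c (t, y) v v := by
    rw [Finset.prod_const, Finset.card_univ, Fintype.card_fin]
    exact Real.sq_sqrt hnn
  rw [hprod] at h3
  exact h3.trans (mul_le_mul_of_nonneg_right h2 hnn)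

end ACylStructure

/-- A comparison of the metric with the product metric gives a bound for the distortion of the
coordinates on the cylinder. -/
theorem distortion_inCoord {Φ : ℝ × X → M} {c : OpenPartialHomeomorph X (EuclideanSpace ℝ (Fin m))}
    {W : Set (EuclideanSpace ℝ (Fin m))} {lam : ℝ≥0} (hc : DistortionOn c.symm W lam)
    {p : ℝ × EuclideanSpace ℝ (Fin m)} (hp : p.2 ∈ W)
    (h : ∀ v : ℝ × EuclideanSpace ℝ (Fin m),
      |pullbackMetric n Φ c p v v - cylMetric c p v v| ≤ 1 / 2 * cylMetric c p v v)
    (v : ℝ × EuclideanSpace ℝ (Fin m)) :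
    ‖v‖ ≤ (2 * max 1 lam : ℝ≥0) *
      ‖(mfderiv 𝓘(ℝ, ℝ × EuclideanSpace ℝ (Fin m)) (𝓡 n) (inCoord Φ c) p v :
        TangentSpace (𝓡 n) (inCoord Φ c p))‖ ∧
    ‖(mfderiv 𝓘(ℝ, ℝ × EuclideanSpace ℝ (Fin m)) (𝓡 n) (inCoord Φ c) p v :
        TangentSpace (𝓡 n) (inCoord Φ c p))‖ ≤ (2 * max 1 lam : ℝ≥0) * ‖v‖ := by
  have h0 := h v
  rw [pullbackMetric_self, cylMetric_self] at h0
  set D := ‖(mfderiv 𝓘(ℝ, ℝ × EuclideanSpace ℝ (Fin m)) (𝓡 n) (inCoord Φ c) p v :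
        TangentSpace (𝓡 n) (inCoord Φ c p))‖
  have hD : 0 ≤ D := norm_nonneg _
  have hl := hc.lower p.2 hp v.2
  have hu := hc.upper p.2 hp v.2
  set Y := ‖(mfderiv (𝓡 m) (𝓡 m) c.symm p.2 v.2 : TangentSpace (𝓡 m) (c.symm p.2))‖
  have hY : 0 ≤ Y := norm_nonneg _
  set L : ℝ := ((max 1 lam : ℝ≥0) : ℝ) with hL
  have hL1 : 1 ≤ L := by rw [hL]; exact_mod_cast le_max_left _ _
  have hL2 : (lam : ℝ) ≤ L := by rw [hL]; exact_mod_cast le_max_right _ _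
  have hv1 : |v.1| ≤ ‖v‖ := norm_fst_le v
  have hv2 : ‖v.2‖ ≤ ‖v‖ := norm_snd_le v
  have hc2 : ((2 * max 1 lam : ℝ≥0) : ℝ) = 2 * L := by push_cast [hL]; rfl
  rw [hc2]
  obtain ⟨h1, h2⟩ := abs_le.1 h0
  have hv1' : v.1 ^ 2 ≤ ‖v‖ ^ 2 := by rw [← sq_abs]; gcongr
  have hY1 : Y ≤ L * ‖v‖ := hu.trans (by gcongr)
  have hY2 : ‖v.2‖ ≤ L * Y := hl.trans (by gcongr)
  have hvn : 0 ≤ ‖v‖ := norm_nonneg _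
  constructor
  -- With `Q = v.1² + Y²` the hypothesis says `Q / 2 ≤ D² ≤ 3Q / 2`. Hence `v.1²` and `Y²` are at
  -- most `2D²`, and in the other direction `D² ≤ 3 (L ‖v‖)²`; the factor 2 covers both.
  · have hY3 : Y ≤ 2 * D := by
      refine (sq_le_sq₀ (by positivity) (by positivity)).1 ?_
      nlinarith [sq_nonneg v.1, sq_nonneg D]
    have hv3 : |v.1| ≤ 2 * D := by
      refine abs_le_of_sq_le_sq ?_ (by positivity)
      nlinarith [sq_nonneg Y, sq_nonneg D]
    rw [Prod.norm_def]
    refine max_le ?_ ?_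
    · calc ‖v.1‖ ≤ 1 * (2 * D) := by rw [one_mul]; exact hv3
        _ ≤ L * (2 * D) := by gcongr
        _ = _ := by ring
    · calc ‖v.2‖ ≤ L * (2 * D) := hY2.trans (by gcongr)
        _ = _ := by ring
  · refine (sq_le_sq₀ (by positivity) (by positivity)).1 ?_
    have hY4 : Y ^ 2 ≤ (L * ‖v‖) ^ 2 := by gcongr
    have hv4 : ‖v‖ ^ 2 ≤ (L * ‖v‖) ^ 2 := by
      gcongr
      exact le_mul_of_one_le_left hvn hL1
    nlinarith [sq_nonneg (L * ‖v‖)]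

/-- The coordinates on the cylindrical end are parametrizations of bounded distortion. -/
theorem ACylStructure.distortionOn_inCoord {T : ℝ} (hT : 0 ≤ T) (hTS : ∀ t ≥ T,
    ∀ c ∈ atlas (EuclideanSpace ℝ (Fin m)) X, ∀ y ∈ c.target,
    ∀ v : ℝ × EuclideanSpace ℝ (Fin m),
      |pullbackMetric n S.Φ c (t, y) v v - cylMetric c (t, y) v v|
        ≤ 1 / 2 * cylMetric c (t, y) v v) (x : X)
    {D : Set (EuclideanSpace ℝ (Fin m))} {lam : ℝ≥0}
    (hD : D ⊆ (chartAt (EuclideanSpace ℝ (Fin m)) x).target)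
    (hc : DistortionOn (chartAt (EuclideanSpace ℝ (Fin m)) x).symm D lam)
    (L : EuclideanSpace ℝ (Fin n) ≃L[ℝ] ℝ × EuclideanSpace ℝ (Fin m))
    {W : Set (EuclideanSpace ℝ (Fin n))} (hW : IsOpen W) (hLW : MapsTo L W (Ioi T ×ˢ D)) :
    DistortionOn (inCoord S.Φ (chartAt (EuclideanSpace ℝ (Fin m)) x) ∘ L) W
      (2 * max 1 lam * (1 + ‖(L : EuclideanSpace ℝ (Fin n) →L[ℝ] ℝ × EuclideanSpace ℝ (Fin m))‖₊ +
        ‖(L.symm : ℝ × EuclideanSpace ℝ (Fin m) →L[ℝ] EuclideanSpace ℝ (Fin n))‖₊)) := by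
  set c := chartAt (EuclideanSpace ℝ (Fin m)) x with hcdef
  have hDo : IsOpen D := hc.isOpen
  have hprod : ContMDiffOn 𝓘(ℝ, ℝ × EuclideanSpace ℝ (Fin m)) (𝓘(ℝ, ℝ).prod (𝓡 m)) 1
      (fun p : ℝ × EuclideanSpace ℝ (Fin m) ↦ (p.1, c.symm p.2)) (Ioi T ×ˢ D) := by
    refine ContMDiffOn.prodMk ?_ ?_
    · exact contDiff_fst.contMDiff.contMDiffOn
    · exact hc.contMDiffOn.comp contDiff_snd.contMDiff.contMDiffOn fun p hp ↦ hp.2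
  have hin : ContMDiffOn 𝓘(ℝ, ℝ × EuclideanSpace ℝ (Fin m)) (𝓡 n) 1 (inCoord S.Φ c)
      (Ioi T ×ˢ D) :=
    (S.smooth.of_le (by norm_num)).comp hprod fun p hp ↦
      S.mem_source (hT.trans (le_of_lt hp.1)) _
  have hopen : IsOpen (Ioi T ×ˢ D) := isOpen_Ioi.prod hDo
  have hLs : ContMDiff (𝓡 n) 𝓘(ℝ, ℝ × EuclideanSpace ℝ (Fin m)) 1 L := L.contDiff.contMDiff
  set N₁ := ‖(L : EuclideanSpace ℝ (Fin n) →L[ℝ] ℝ × EuclideanSpace ℝ (Fin m))‖₊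
  set N₂ := ‖(L.symm : ℝ × EuclideanSpace ℝ (Fin m) →L[ℝ] EuclideanSpace ℝ (Fin n))‖₊
  have hLu : ∀ v, ‖L v‖ ≤ N₁ * ‖v‖ := fun v ↦
    (L : EuclideanSpace ℝ (Fin n) →L[ℝ] ℝ × EuclideanSpace ℝ (Fin m)).le_opNorm v
  have hLl : ∀ v, ‖v‖ ≤ N₂ * ‖L v‖ := fun v ↦ by
    have := (L.symm : ℝ × EuclideanSpace ℝ (Fin m) →L[ℝ] EuclideanSpace ℝ (Fin n)).le_opNorm (L v)
    rwa [ContinuousLinearEquiv.coe_coe, L.symm_apply_apply] at this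
  have hder : ∀ z ∈ W, ∀ v : EuclideanSpace ℝ (Fin n),
      (mfderiv (𝓡 n) (𝓡 n) (inCoord S.Φ c ∘ L) z v : TangentSpace (𝓡 n) (inCoord S.Φ c (L z)))
      = mfderiv 𝓘(ℝ, ℝ × EuclideanSpace ℝ (Fin m)) (𝓡 n) (inCoord S.Φ c) (L z) (L v) := by
    intro z hz v
    have h1 : MDifferentiableAt 𝓘(ℝ, ℝ × EuclideanSpace ℝ (Fin m)) (𝓡 n) (inCoord S.Φ c) (L z) :=
      (hin.contMDiffAt (hopen.mem_nhds (hLW hz))).mdifferentiableAt (by norm_num)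
    rw [mfderiv_comp z h1 (hLs.mdifferentiable (by norm_num) z), mfderiv_eq_fderiv, L.fderiv]
    rfl
  have hdist : ∀ z ∈ W, ∀ v, _ := fun z hz v ↦ distortion_inCoord hc (p := L z) (hLW hz).2
    (hTS (L z).1 (le_of_lt (hLW hz).1) c (chart_mem_atlas _ x) (L z).2 (hD (hLW hz).2)) v
  refine ⟨hW, hin.comp hLs.contMDiffOn hLW, ?_, by positivity, ?_, ?_⟩
  · intro z hz z' hz' he
    have h1 := S.Φ.injOn (S.mem_source (hT.trans (le_of_lt (hLW hz).1)) _)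
      (S.mem_source (hT.trans (le_of_lt (hLW hz').1)) _) he
    rw [Prod.mk.injEq] at h1
    exact L.injective (Prod.ext h1.1 (hc.injOn (hLW hz).2 (hLW hz').2 h1.2))
  · intro z hz v
    have h2 := (hdist z hz (L v)).1
    rw [← hder z hz v] at h2
    refine (hLl v).trans ((mul_le_mul_of_nonneg_left h2 N₂.2).trans ?_)
    rw [← mul_assoc]
    refine mul_le_mul_of_nonneg_right ?_ (norm_nonneg _)
    rw [mul_comm]
    have : N₂ ≤ 1 + N₁ + N₂ := le_add_of_nonneg_left (by positivity)
    exact_mod_cast mul_le_mul_right this _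
  · intro z hz v
    have h2 := (hdist z hz (L v)).2
    rw [← hder z hz v] at h2
    refine h2.trans ((mul_le_mul_of_nonneg_left (hLu v) (NNReal.coe_nonneg _)).trans ?_)
    rw [← mul_assoc]
    refine mul_le_mul_of_nonneg_right ?_ (norm_nonneg _)
    have : N₁ ≤ 1 + N₁ + N₂ := by
      rw [add_right_comm]; exact le_add_of_nonneg_left (by positivity)
    exact_mod_cast mul_le_mul_right this _

end CylindricalEnd

/-! ### Towers of balls along the end -/

section Tower

variable {n m : ℕ} {M : Type*} [MetricSpace M] [SecondCountableTopology M]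
  [MeasurableSpace M] [BorelSpace M]
  [ChartedSpace (EuclideanSpace ℝ (Fin n)) M] [IsManifold (𝓡 n) 1 M]
  [RiemannianBundle (fun x : M ↦ TangentSpace (𝓡 n) x)]
  {X : Type*} [TopologicalSpace X]
  [ChartedSpace (EuclideanSpace ℝ (Fin m)) X] [IsManifold (𝓡 m) 1 X]
  [RiemannianBundle (fun x : X ↦ TangentSpace (𝓡 m) x)]
  [IsContinuousRiemannianBundle (EuclideanSpace ℝ (Fin m)) (fun x : X ↦ TangentSpace (𝓡 m) x)]
  (S : ACylStructure n m M X)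

/-- A sequence of sets that runs up the cylindrical end over a neighbourhood `O` in the
cross-section, with uniform Sobolev-Poincaré inequalities, volume bounds and overlaps. -/
structure IsTower (S : ACylStructure n m M X) (T : ℝ) (O : Set X) (B : ℕ → Set M) (s : ℝ)
    (ε V : ℝ≥0) : Prop where
  pos : 0 < s
  ne_zero : ε ≠ 0
  sobolevPoincareOn : ∀ q : ℝ≥0, 2 ≤ q → (2 < n → (q : ℝ) ≤ 2 * n / (n - 2)) →
    ∃ K : ℝ≥0, ∀ k, SobolevPoincareOn n q (B k) K
  le_overlap : ∀ k, (ε : ℝ≥0∞) ≤ riemVol n M (B k ∩ B (k + 1))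
  volume_le : ∀ k, riemVol n M (B k) ≤ V
  le_t : ∀ k, ∀ x ∈ B k, k * s ≤ S.t x
  t_le : ∀ x ∈ B 0, S.t x ≤ T + 2
  cover : ∀ t ≥ T + 1, ∀ y ∈ O, S.Φ (t, y) ∈ ⋃ k, B k

/-- The balls are translates of one ball in coordinates, along the `t`-direction, under one
parametrization whose distortion is bounded uniformly beyond height `T`. All constants therefore
depend only on the radius and the distortion, not on `k`. The isomorphism `L` only turns the product
into a Euclidean space, and its norms enter the radii. -/
theorem ACylStructure.exists_isTower {T : ℝ} (hT : 0 ≤ T) (hTS : ∀ t ≥ T,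
    ∀ c ∈ atlas (EuclideanSpace ℝ (Fin m)) X, ∀ y ∈ c.target,
    ∀ v : ℝ × EuclideanSpace ℝ (Fin m),
      |pullbackMetric n S.Φ c (t, y) v v - cylMetric c (t, y) v v|
        ≤ 1 / 2 * cylMetric c (t, y) v v)
    (L : EuclideanSpace ℝ (Fin n) ≃L[ℝ] ℝ × EuclideanSpace ℝ (Fin m)) (x : X) :
    ∃ O ∈ 𝓝 x, ∃ (B : ℕ → Set M) (s : ℝ) (ε V : ℝ≥0), IsTower S T O B s ε V := by
  obtain ⟨ρ₀, lam₀, hρ₀, hsub, hc⟩ := exists_distortionOn_nhds m x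
  set c := chartAt (EuclideanSpace ℝ (Fin m)) x with hcdef
  set N₁ := ‖(L : EuclideanSpace ℝ (Fin n) →L[ℝ] ℝ × EuclideanSpace ℝ (Fin m))‖₊ with hN₁
  set N₂ := ‖(L.symm : ℝ × EuclideanSpace ℝ (Fin m) →L[ℝ] EuclideanSpace ℝ (Fin n))‖₊ with hN₂
  set lam : ℝ≥0 := 2 * max 1 lam₀ * (1 + N₁ + N₂) with hlam
  have hLu : ∀ v, ‖L v‖ ≤ N₁ * ‖v‖ := fun v ↦
    (L : EuclideanSpace ℝ (Fin n) →L[ℝ] ℝ × EuclideanSpace ℝ (Fin m)).le_opNorm v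
  have hLl : ∀ w, ‖L.symm w‖ ≤ N₂ * ‖w‖ := fun w ↦
    (L.symm : ℝ × EuclideanSpace ℝ (Fin m) →L[ℝ] EuclideanSpace ℝ (Fin n)).le_opNorm w
  have hN₁0 : (0 : ℝ) ≤ N₁ := N₁.2
  have hN₂0 : (0 : ℝ) ≤ N₂ := N₂.2
  -- With `4 μ₀ ≤ 1`, a ball of radius `4r` about a centre at height `T + 1 + k s` stays above `T +
  -- k s`, and below `T + 2` for `k = 0`. With `μ₀ ≤ ρ₀` it stays over the chart ball in the
  -- cross-section.
  set μ₀ : ℝ := min ρ₀ (1 / 4)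
  have hμ₀ : 0 < μ₀ := lt_min hρ₀ (by norm_num)
  have hμ₁ : μ₀ ≤ ρ₀ := min_le_left _ _
  have hμ₂ : μ₀ ≤ 1 / 4 := min_le_right _ _
  set r : ℝ := μ₀ / (N₁ + 1) with hr
  have hr0 : 0 < r := by positivity
  have hr1 : N₁ * (4 * r) < 4 * μ₀ := by
    have : (N₁ + 1) * r = μ₀ := by rw [hr]; field_simp
    nlinarith
  set ρ : ℝ := r / (N₂ + 1) with hρ
  have hρ0 : 0 < ρ := by positivity
  have hρ1 : N₂ * ρ < r := by
    have : (N₂ + 1) * ρ = r := by rw [hρ]; field_simp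
    nlinarith
  -- A box of half-width `ρ` about a centre maps into the ball of radius `r`, which gives the cover.
  -- The spacing `ρ / 2` puts consecutive centres within `r / 2`, so both balls contain the ball of
  -- radius `r / 2` about the lower centre.
  set s : ℝ := ρ / 2 with hs
  have hs0 : 0 < s := by positivity
  set a : ℕ → EuclideanSpace ℝ (Fin n) := fun k ↦ L.symm (T + 1 + k * s, c x) with ha
  set φ := inCoord S.Φ c ∘ L with hφ
  have hball : ∀ k, ∀ z ∈ Metric.ball (a k) (4 * r),
      |(L z).1 - (T + 1 + k * s)| < 4 * μ₀ ∧ (L z).2 ∈ Metric.ball (c x) (4 * μ₀) := by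
    intro k z hz
    rw [mem_ball_iff_norm] at hz
    have h1 : ‖L z - (T + 1 + k * s, c x)‖ < 4 * μ₀ := by
      have h2 : L z - (T + 1 + k * s, c x) = L (z - a k) := by
        rw [map_sub, ha]; simp
      rw [h2]
      exact ((hLu _).trans (by gcongr)).trans_lt hr1
    refine ⟨(norm_fst_le _).trans_lt h1, ?_⟩
    rw [mem_ball_iff_norm]
    exact (norm_snd_le (L z - (T + 1 + k * s, c x))).trans_lt h1
  have hks : ∀ k : ℕ, 0 ≤ k * s := fun k ↦ by positivity
  have hD : ∀ k, DistortionOn φ (Metric.ball (a k) (4 * r)) lam := by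
    intro k
    refine S.distortionOn_inCoord hT hTS x hsub hc L Metric.isOpen_ball fun z hz ↦ ?_
    obtain ⟨h1, h2⟩ := hball k z hz
    refine ⟨?_, Metric.ball_subset_ball (by linarith) h2⟩
    rw [mem_Ioi]
    linarith [(abs_lt.1 h1).1, hks k]
  have hsub1 : ∀ k, Metric.ball (a k) r ⊆ Metric.ball (a k) (4 * r) := fun k ↦
    Metric.ball_subset_ball (by linarith)
  have hlam0 : 0 < lam := (hD 0).pos
  set v₀ : ℝ≥0 := (volume (Metric.ball (0 : EuclideanSpace ℝ (Fin n)) (r / 2))).toNNReal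
  have hv₀ : (v₀ : ℝ≥0∞) = volume (Metric.ball (0 : EuclideanSpace ℝ (Fin n)) (r / 2)) :=
    ENNReal.coe_toNNReal measure_ball_lt_top.ne
  have hv₀0 : v₀ ≠ 0 := by
    intro h
    rw [h] at hv₀
    exact (Metric.measure_ball_pos volume (0 : EuclideanSpace ℝ (Fin n))
      (half_pos hr0)).ne hv₀
  have ht : ∀ k, ∀ z ∈ Metric.ball (a k) (4 * r), S.t (φ z) = (L z).1 := by
    intro k z hz
    have := (abs_lt.1 (hball k z hz).1).1
    exact S.t_map (by linarith [hks k]) _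
  refine ⟨c.source ∩ c ⁻¹' Metric.ball (c x) ρ, ?_, fun k ↦ φ '' Metric.ball (a k) r, s,
    (lam ^ n)⁻¹ * v₀,
    lam ^ n * (volume (Metric.ball (0 : EuclideanSpace ℝ (Fin n)) r)).toNNReal, hs0, ?_, ?_, ?_,
    ?_, ?_, ?_, ?_⟩
  · exact (c.isOpen_inter_preimage Metric.isOpen_ball).mem_nhds
      ⟨mem_chart_source _ x, Metric.mem_ball_self hρ0⟩
  · exact mul_ne_zero (inv_ne_zero (pow_ne_zero _ hlam0.ne')) hv₀0
  · intro q hq hqn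
    obtain ⟨K, hK⟩ := exists_sobolevPoincareOn_image_ball n M q hq hqn hr0 lam
    exact ⟨K, fun k ↦ hK φ (a k) (hD k)⟩
  · intro k
    have hsub2 : Metric.ball (a k) (r / 2) ⊆ Metric.ball (a k) r :=
      Metric.ball_subset_ball (by linarith)
    have hdist : dist (a k) (a (k + 1)) ≤ r / 2 := by
      have h1 : a k - a (k + 1) = L.symm (-s, 0) := by
        simp only [ha]
        rw [← map_sub]
        congr 1
        ext1
        · push_cast; simp only [Prod.fst_sub]; ring
        · simp
      have h2 : ‖((-s, 0) : ℝ × EuclideanSpace ℝ (Fin m))‖ = s := by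
        simp [Prod.norm_def, abs_of_pos hs0, hs0.le]
      rw [dist_eq_norm, h1]
      refine (hLl _).trans ?_
      rw [h2]
      have h3 : N₂ * s = N₂ * ρ / 2 := by rw [hs]; ring
      linarith
    have hsub3 : Metric.ball (a k) (r / 2) ⊆ Metric.ball (a (k + 1)) r :=
      Metric.ball_subset_ball' (by linarith)
    have h1 := (hD k).volume_le_riemVol_image (S := Metric.ball (a k) (r / 2))
      Metric.isOpen_ball.measurableSet (hsub2.trans (hsub1 k))
    have h2 : riemVol n M (φ '' Metric.ball (a k) (r / 2)) ≤
        riemVol n M (φ '' Metric.ball (a k) r ∩ φ '' Metric.ball (a (k + 1)) r) :=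
      measure_mono (subset_inter (image_mono hsub2) (image_mono hsub3))
    have hl0 : (lam ^ n : ℝ≥0) ≠ 0 := pow_ne_zero _ hlam0.ne'
    rw [Measure.addHaar_ball_center, ← hv₀] at h1
    calc (((lam ^ n)⁻¹ * v₀ : ℝ≥0) : ℝ≥0∞)
        ≤ ((lam ^ n)⁻¹ : ℝ≥0) * (lam ^ n * riemVol n M (φ '' Metric.ball (a k) (r / 2))) := by
          push_cast
          gcongr
      _ = riemVol n M (φ '' Metric.ball (a k) (r / 2)) := by
          rw [← mul_assoc, ← ENNReal.coe_pow, ← ENNReal.coe_mul, inv_mul_cancel₀ hl0]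
          simp
      _ ≤ _ := h2
  · intro k
    have h1 := (hD k).riemVol_image_le (S := Metric.ball (a k) r)
      Metric.isOpen_ball.measurableSet (hsub1 k)
    rw [Measure.addHaar_ball_center] at h1
    push_cast
    rw [ENNReal.coe_toNNReal measure_ball_lt_top.ne]
    exact h1
  · rintro k _ ⟨z, hz, rfl⟩
    have h1 := (abs_lt.1 (hball k z (hsub1 k hz)).1).1
    rw [ht k z (hsub1 k hz)]
    linarith
  · rintro _ ⟨z, hz, rfl⟩
    have h1 := (abs_lt.1 (hball 0 z (hsub1 0 hz)).1).2
    rw [ht 0 z (hsub1 0 hz)]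
    simp only [Nat.cast_zero, zero_mul] at h1
    linarith
  · rintro t ht1 y ⟨hyc, hy⟩
    set k := ⌊(t - (T + 1)) / s⌋₊ with hk
    have hk1 : k * s ≤ t - (T + 1) := by
      rw [← le_div_iff₀ hs0]
      exact Nat.floor_le (div_nonneg (by linarith) hs0.le)
    have hk2 : t - (T + 1) < (k + 1) * s := by
      rw [← div_lt_iff₀ hs0]
      exact Nat.lt_floor_add_one _
    refine mem_iUnion.2 ⟨k, L.symm (t, c y), ?_, ?_⟩
    · have h1 : L.symm (t, c y) - a k = L.symm (t - (T + 1 + k * s), c y - c x) := by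
        simp only [ha]
        rw [← map_sub]
        rfl
      rw [mem_ball_iff_norm, h1]
      refine lt_of_le_of_lt ((hLl _).trans (mul_le_mul_of_nonneg_left ?_ hN₂0)) hρ1
      rw [Prod.norm_def]
      refine max_le ?_ ?_
      · simp only [Real.norm_eq_abs]
        rw [abs_le]
        constructor <;> linarith
      · rw [mem_preimage, mem_ball_iff_norm] at hy
        exact hy.le
    · simp only [hφ, Function.comp_apply, L.apply_symm_apply, inCoord]
      rw [c.left_inv hyc]

end Tower

/-! ### Countable sums of norms and exponentials -/

section Sums

/-- With total sum `s`, each term satisfies `aₖ^q = aₖ · aₖ^(q-1) ≤ aₖ · s^(q-1)`. -/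
theorem tsum_rpow_le_rpow_tsum {q : ℝ} (hq : 1 ≤ q) (a : ℕ → ℝ≥0∞) :
    ∑' k, a k ^ q ≤ (∑' k, a k) ^ q := by
  have h : ∀ x : ℝ≥0∞, x ^ q = x * x ^ (q - 1) := fun x ↦ by
    conv_lhs => rw [show q = 1 + (q - 1) by ring]
    rw [ENNReal.rpow_add_of_nonneg _ _ zero_le_one (by linarith), ENNReal.rpow_one]
  rw [h (∑' k, a k), ← ENNReal.tsum_mul_right]
  refine ENNReal.tsum_le_tsum fun k ↦ ?_
  rw [h]
  exact mul_le_mul_right (ENNReal.rpow_le_rpow (ENNReal.le_tsum k) (by linarith)) _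

theorem eLpNorm_restrict_iUnion_le {α F : Type*} [MeasurableSpace α] [NormedAddCommGroup F]
    {ν : Measure α} (f : α → F) {q : ℝ≥0} (hq : 1 ≤ q) (B : ℕ → Set α) :
    eLpNorm f q (ν.restrict (⋃ k, B k)) ≤ ∑' k, eLpNorm f q (ν.restrict (B k)) := by
  have hq0 : q ≠ 0 := (zero_lt_one.trans_le hq).ne'
  have hq1 : (1 : ℝ) ≤ q := by exact_mod_cast hq
  rw [← ENNReal.rpow_le_rpow_iff (z := (q : ℝ)) (by positivity)]
  refine le_trans ?_ (tsum_rpow_le_rpow_tsum hq1 _)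
  simp only [eLpNorm_nnreal_pow_eq_lintegral hq0]
  exact lintegral_iUnion_le _ _

theorem tsum_ofReal_exp_lt_top {a : ℝ} (ha : 0 < a) :
    ∑' k : ℕ, ENNReal.ofReal (Real.exp (-(a * k))) < ⊤ := by
  have h : ∀ k : ℕ, ENNReal.ofReal (Real.exp (-(a * k))) = ENNReal.ofReal (Real.exp (-a)) ^ k := by
    intro k
    rw [← ENNReal.ofReal_pow (Real.exp_pos _).le, ← Real.exp_nat_mul]
    congr 2; ring
  simp only [h]
  rw [ENNReal.tsum_geometric, ENNReal.inv_lt_top, tsub_pos_iff_lt, ENNReal.ofReal_lt_one,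
    Real.exp_lt_one_iff]
  linarith

/-- Half of the exponential rate absorbs the linear growth, and the other half remains for
summation. -/
theorem add_one_mul_exp_le {a : ℝ} (ha : 0 < a) (x : ℝ) (hx : 0 ≤ x) :
    (x + 1) * Real.exp (-(2 * a * x)) ≤ (1 + 1 / a) * Real.exp (-(a * x)) := by
  have h1 : x + 1 ≤ (1 + 1 / a) * Real.exp (a * x) := by
    have h2 := Real.add_one_le_exp (a * x)
    calc x + 1 ≤ (1 + 1 / a) * (a * x + 1) := by
          have : (1 + 1 / a) * (a * x + 1) = x + 1 + (a * x + 1 / a) := by field_simp; ring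
          rw [this]
          exact le_add_of_nonneg_right (by positivity)
      _ ≤ _ := by gcongr
  calc (x + 1) * Real.exp (-(2 * a * x))
      ≤ (1 + 1 / a) * Real.exp (a * x) * Real.exp (-(2 * a * x)) := by gcongr
    _ = _ := by rw [mul_assoc, ← Real.exp_add]; congr 2; ring

end Sums

/-! ### Summation along a tower -/

section TowerEstimates

variable {n m : ℕ} {M : Type*} [MetricSpace M]
  [MeasurableSpace M] [BorelSpace M]
  [ChartedSpace (EuclideanSpace ℝ (Fin n)) M]
  [RiemannianBundle (fun x : M ↦ TangentSpace (𝓡 n) x)]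
  {X : Type*} [TopologicalSpace X]
  [ChartedSpace (EuclideanSpace ℝ (Fin m)) X]
  [RiemannianBundle (fun x : X ↦ TangentSpace (𝓡 m) x)]
  {S : ACylStructure n m M X} {T : ℝ} {O : Set X} {B : ℕ → Set M} {s : ℝ} {ε V : ℝ≥0}

theorem IsTower.lintegral_exp_lt_top (hB : IsTower S T O B s ε V) {p : ℝ} (hp : 0 < p) :
    ∫⁻ x in ⋃ k, B k, ENNReal.ofReal (Real.exp (-p * S.t x)) ∂(riemVol n M) < ⊤ := by
  have hs := hB.pos
  have hmeas : Measurable fun x ↦ ENNReal.ofReal (Real.exp (-p * S.t x)) :=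
    ENNReal.measurable_ofReal.comp (Real.measurable_exp.comp (S.measurable_t.const_mul _))
  calc _ ≤ ∑' k, ∫⁻ x in B k, ENNReal.ofReal (Real.exp (-p * S.t x)) ∂(riemVol n M) :=
        lintegral_iUnion_le _ _
    _ ≤ ∑' k : ℕ, ENNReal.ofReal (Real.exp (-(p * s * k))) * V := by
        refine ENNReal.tsum_le_tsum fun k ↦ ?_
        calc _ ≤ ∫⁻ x in B k, ENNReal.ofReal (Real.exp (-(p * s * k))) ∂(riemVol n M) := by
              refine setLIntegral_mono measurable_const fun x hx ↦ ?_
              refine ENNReal.ofReal_le_ofReal (Real.exp_le_exp.2 ?_)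
              have := mul_le_mul_of_nonneg_left (hB.le_t k x hx) hp.le
              linarith
          _ ≤ _ := by
              rw [setLIntegral_const]
              gcongr
              exact hB.volume_le k
    _ < ⊤ := by
        rw [ENNReal.tsum_mul_right]
        exact ENNReal.mul_lt_top (tsum_ofReal_exp_lt_top (by positivity)) ENNReal.coe_lt_top

/-- The Sobolev-Poincaré inequalities along a tower add up to a weighted inequality. -/
theorem IsTower.exists_weighted_le (hB : IsTower S T O B s ε V) {q : ℝ≥0} (hq : 2 ≤ q)
    (hqn : 2 < n → (q : ℝ) ≤ 2 * n / (n - 2)) {μ : ℝ} (hμ : 0 < μ) {B' : Set M} (hBB' : B 0 ⊆ B')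
    (K' : ℝ≥0) :
    ∃ A : ℝ≥0, ∀ (u : M → ℝ) (c : ℝ), ContMDiff (𝓡 n) 𝓘(ℝ, ℝ) ∞ u →
      eLpNorm (fun x ↦ u x - c) q ((riemVol n M).restrict B') ≤
        K' * eLpNorm (gradNorm n u) 2 (riemVol n M) →
      eLpNorm (fun x ↦ Real.exp (-μ * S.t x) * (u x - c)) q ((riemVol n M).restrict (⋃ k, B k)) ≤
        A * eLpNorm (gradNorm n u) 2 (riemVol n M) := by
  have hs := hB.pos
  have hq1 : 1 ≤ q := one_le_two.trans hq
  obtain ⟨K, hK⟩ := hB.sobolevPoincareOn q hq hqn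
  set a : ℝ := μ * s / 2 with ha
  have ha0 : 0 < a := by positivity
  set e : ℝ≥0 := (ε ^ (1 / (q : ℝ)) : ℝ≥0)⁻¹ with he
  -- One bound for both kinds of jump: `e (K + K')` between `B'` and the lowest ball, `e (K + K)`
  -- between consecutive balls.
  set A₁ : ℝ≥0 := e * (K' + 2 * K) with hA₁
  set A₂ : ℝ≥0 := K + A₁ * V ^ (1 / (q : ℝ)) with hA₂
  set σ : ℝ≥0 := (∑' k : ℕ, ENNReal.ofReal (Real.exp (-(a * k)))).toNNReal with hσ
  have hσ' : (σ : ℝ≥0∞) = ∑' k : ℕ, ENNReal.ofReal (Real.exp (-(a * k))) :=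
    ENNReal.coe_toNNReal (tsum_ofReal_exp_lt_top ha0).ne
  refine ⟨(1 + 1 / a).toNNReal * A₂ * σ, fun u c hu hc ↦ ?_⟩
  have hum : AEStronglyMeasurable u (riemVol n M) := hu.continuous.aestronglyMeasurable
  set D := eLpNorm (gradNorm n u) 2 (riemVol n M)
  choose b hb using fun k ↦ hK k u hu
  have hε := hB.ne_zero
  -- Telescoping from the core: one jump into the tower and `k` jumps up.
  have hdiff : ∀ k : ℕ, ‖b k - c‖ₑ ≤ (k + 1 : ℝ≥0) * A₁ * D := by
    intro k
    induction k with
    | zero =>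
      have h1 := enorm_sub_le_of_overlap hum hq1 (hb 0) hc hε ((hB.le_overlap 0).trans
        (measure_mono fun x hx ↦ ⟨hx.1, hBB' hx.1⟩))
      refine h1.trans ?_
      rw [← he, ← add_mul, ← mul_assoc]
      have h3 : e * (K + K') ≤ A₁ := by
        rw [hA₁, add_comm K, two_mul, ← add_assoc]
        exact mul_le_mul_right (le_add_of_nonneg_right (by positivity)) _
      have h4 : (e : ℝ≥0∞) * (K + K') ≤ A₁ := by exact_mod_cast h3
      simpa using mul_le_mul_left h4 D
    | succ k ih =>
      have h1 := enorm_sub_le_of_overlap hum hq1 (hb (k + 1)) (hb k) hε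
        ((hB.le_overlap k).trans (by rw [inter_comm]))
      have h2 : ‖b (k + 1) - c‖ₑ ≤ ‖b (k + 1) - b k‖ₑ + ‖b k - c‖ₑ := by
        have : b (k + 1) - c = (b (k + 1) - b k) + (b k - c) := by ring
        rw [this]; exact enorm_add_le _ _
      refine h2.trans ((add_le_add h1 ih).trans ?_)
      rw [← he, ← add_mul, ← mul_assoc, ← add_mul]
      refine mul_le_mul_left ?_ D
      have h3 : e * (K + K) ≤ A₁ := by
        rw [hA₁, ← two_mul]
        exact mul_le_mul_right (le_add_of_nonneg_left (by positivity)) _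
      have h4 : e * (K + K) + (k + 1) * A₁ ≤ ((k + 1 : ℕ) + 1) * A₁ := by
        calc _ ≤ A₁ + (k + 1) * A₁ := by gcongr
          _ = _ := by push_cast; ring
      exact_mod_cast h4
  have hpiece : ∀ k : ℕ, eLpNorm (fun x ↦ Real.exp (-μ * S.t x) * (u x - c)) q
      ((riemVol n M).restrict (B k)) ≤
        ENNReal.ofReal (Real.exp (-(a * k))) * ((1 + 1 / a).toNNReal * A₂ * D) := by
    intro k
    have h1 : eLpNorm (fun x ↦ Real.exp (-μ * S.t x) * (u x - c)) q
        ((riemVol n M).restrict (B k)) ≤ (Real.exp (-(2 * a * k))).toNNReal *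
          eLpNorm (fun x ↦ u x - c) q ((riemVol n M).restrict (B k)) := by
      refine eLpNorm_le_nnreal_smul_eLpNorm_of_ae_le_mul ?_ q
      -- The sets `B k` are not assumed measurable, so the bound on `t` is transferred from a
      -- measurable superset.
      have hmeas : MeasurableSet {x | k * s ≤ S.t x} :=
        measurableSet_le measurable_const S.measurable_t
      have hae : ∀ᵐ x ∂(riemVol n M).restrict (B k), k * s ≤ S.t x :=
        ae_restrict_of_ae_restrict_of_subset (t := {x | k * s ≤ S.t x}) (hB.le_t k)
          (ae_restrict_mem hmeas)
      filter_upwards [hae] with x hx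
      rw [nnnorm_mul]
      refine mul_le_mul_left ?_ _
      rw [← NNReal.coe_le_coe, coe_nnnorm, Real.norm_eq_abs, Real.abs_exp,
        Real.coe_toNNReal _ (Real.exp_pos _).le, Real.exp_le_exp]
      have := mul_le_mul_of_nonneg_left hx hμ.le
      rw [ha]
      linarith
    have h2 : eLpNorm (fun x ↦ u x - c) q ((riemVol n M).restrict (B k)) ≤
        (k + 1 : ℝ≥0) * A₂ * D := by
      refine (eLpNorm_sub_const_le_add hum hq1 (B k) c (b k)).trans ?_
      calc _ ≤ K * D + (k + 1 : ℝ≥0) * A₁ * D * V ^ (1 / (q : ℝ)) := by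
            gcongr
            · exact hb k
            · exact hdiff k
            · exact hB.volume_le k
        _ = (K + (k + 1 : ℝ≥0) * A₁ * V ^ (1 / (q : ℝ))) * D := by ring
        _ ≤ _ := by
            refine mul_le_mul_left ?_ D
            rw [← ENNReal.coe_rpow_of_nonneg V (by positivity)]
            have h3 : K ≤ (k + 1) * K :=
              le_mul_of_one_le_left (by positivity) (le_add_of_nonneg_left (by positivity))
            have h4 : K + (k + 1) * A₁ * V ^ (1 / (q : ℝ)) ≤ (k + 1) * A₂ := by
              rw [hA₂, mul_add, mul_assoc (_ + _) A₁]
              exact add_le_add_left h3 _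
            exact_mod_cast h4
    refine h1.trans ((mul_le_mul_right h2 _).trans ?_)
    have h3 : ((Real.exp (-(2 * a * k))).toNNReal : ℝ≥0∞) * (k + 1 : ℝ≥0) ≤
        ENNReal.ofReal (Real.exp (-(a * k))) * (1 + 1 / a).toNNReal := by
      have h4 := ENNReal.ofReal_le_ofReal (add_one_mul_exp_le ha0 k (by positivity))
      rw [ENNReal.ofReal_mul (by positivity), ENNReal.ofReal_mul (by positivity),
        mul_comm, mul_comm (ENNReal.ofReal (1 + 1 / a))] at h4
      have h5 : ENNReal.ofReal (k + 1) = (k + 1 : ℝ≥0) := by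
        rw [ENNReal.ofReal_add (by positivity) zero_le_one]
        simp
      rwa [h5] at h4
    calc _ = ((Real.exp (-(2 * a * k))).toNNReal : ℝ≥0∞) * (k + 1 : ℝ≥0) * (A₂ * D) := by
          simp only [mul_assoc]
      _ ≤ _ := mul_le_mul_left h3 _
      _ = _ := by simp only [mul_assoc]
  calc _ ≤ ∑' k, eLpNorm (fun x ↦ Real.exp (-μ * S.t x) * (u x - c)) q
        ((riemVol n M).restrict (B k)) := eLpNorm_restrict_iUnion_le _ hq1 _
    _ ≤ ∑' k : ℕ, ENNReal.ofReal (Real.exp (-(a * k))) * ((1 + 1 / a).toNNReal * A₂ * D) :=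
        ENNReal.tsum_le_tsum hpiece
    _ = _ := by
        rw [ENNReal.tsum_mul_right, ← hσ']
        push_cast
        ring

end TowerEstimates

/-! ### The weighted inequality on the whole manifold -/

section Core

variable {n m : ℕ} {M : Type*} [MetricSpace M] [ProperSpace M] [SecondCountableTopology M]
  [MeasurableSpace M] [BorelSpace M]
  [ChartedSpace (EuclideanSpace ℝ (Fin n)) M] [IsManifold (𝓡 n) 1 M]
  [RiemannianBundle (fun x : M ↦ TangentSpace (𝓡 n) x)]
  {X : Type*} [TopologicalSpace X] [CompactSpace X]
  [ChartedSpace (EuclideanSpace ℝ (Fin m)) X] [IsManifold (𝓡 m) 1 X]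
  [RiemannianBundle (fun x : X ↦ TangentSpace (𝓡 m) x)]
  [IsContinuousRiemannianBundle (EuclideanSpace ℝ (Fin m)) (fun x : X ↦ TangentSpace (𝓡 m) x)]
  (S : ACylStructure n m M X)

/-- The cylindrical end is covered by finitely many towers. -/
theorem ACylStructure.exists_finite_towers : ∃ (T : ℝ) (F : Finset X) (O : X → Set X)
    (B : X → ℕ → Set M) (s : X → ℝ) (ε V : X → ℝ≥0),
    (∀ j ∈ F, IsTower S T (O j) (B j) (s j) (ε j) (V j)) ∧
      ∀ x, S.t x ≤ T + 2 ∨ ∃ j ∈ F, x ∈ ⋃ k, B j k := by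
  obtain ⟨T, hT, hTS⟩ := S.exists_abs_pullbackMetric_sub_le
  have hcov : ∀ x : M, T + 2 < S.t x → ∃ y : X, x = S.Φ (S.t x, y) := fun x hx ↦
    S.exists_eq_map (S.notMem_U_of_t_pos (by linarith))
  rcases isEmpty_or_nonempty X with hX | hX
  · refine ⟨T, ∅, fun _ ↦ ∅, fun _ _ ↦ ∅, fun _ ↦ 0, fun _ ↦ 0, fun _ ↦ 0, by simp, fun x ↦ ?_⟩
    refine Or.inl (le_of_not_gt fun hx ↦ ?_)
    obtain ⟨y, -⟩ := hcov x hx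
    exact hX.elim y
  · have hdim := S.dim_eq
    have L : EuclideanSpace ℝ (Fin n) ≃L[ℝ] ℝ × EuclideanSpace ℝ (Fin m) :=
      ContinuousLinearEquiv.ofFinrankEq (by simp [hdim, add_comm])
    choose O hO B s ε V hB using S.exists_isTower hT hTS L
    obtain ⟨F, hF⟩ := CompactSpace.elim_nhds_subcover O hO
    refine ⟨T, F, O, B, s, ε, V, fun j _ ↦ hB j, fun x ↦ ?_⟩
    refine (le_or_gt (S.t x) (T + 2)).imp id fun hx ↦ ?_
    obtain ⟨y, hy⟩ := hcov x hx
    have : y ∈ ⋃ j ∈ F, O j := hF ▸ mem_univ y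
    obtain ⟨j, hj, hyj⟩ := mem_iUnion₂.1 this
    exact ⟨j, hj, by rw [hy]; exact (hB j).cover _ (by linarith) y hyj⟩

variable [PreconnectedSpace M] [Nonempty M]
  [IsContinuousRiemannianBundle (EuclideanSpace ℝ (Fin n)) (fun x : M ↦ TangentSpace (𝓡 n) x)]

/-- The weighted Sobolev-Poincaré inequality, with an unspecified constant in place of the
average. -/
theorem ACylStructure.exists_weighted_sobolevPoincare {μ : ℝ} (hμ : 0 < μ) {q : ℝ≥0} (hq : 2 ≤ q)
    (hqn : 2 < n → (q : ℝ) ≤ 2 * n / (n - 2)) :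
    ∃ A : ℝ≥0, ∀ u : M → ℝ, ContMDiff (𝓡 n) 𝓘(ℝ, ℝ) ∞ u →
      ∃ c : ℝ, eLpNorm (fun x ↦ Real.exp (-μ * S.t x) * (u x - c)) q (riemVol n M) ≤
        A * eLpNorm (gradNorm n u) 2 (riemVol n M) := by
  have hq1 : 1 ≤ q := one_le_two.trans hq
  obtain ⟨T, F, O, B, s, ε, V, hB, hcov⟩ := S.exists_finite_towers
  obtain ⟨A₀, hA₀, hA₀T⟩ := S.exists_isCompact_superset (T + 2)
  obtain ⟨B₀, K₀, -, hAB, -, hBK⟩ := exists_sobolevPoincareOn_superset (n := n) hq hqn hA₀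
  -- The constant `c` stays that of the core `B₀` throughout the induction on the towers, so the
  -- contributions can be added. Each tower is tied to the core because its lowest ball lies in `{t
  -- ≤ T + 2}`, hence in `B₀`.
  have hmain : ∀ G ⊆ F, ∃ A : ℝ≥0, ∀ (u : M → ℝ) (c : ℝ), ContMDiff (𝓡 n) 𝓘(ℝ, ℝ) ∞ u →
      eLpNorm (fun x ↦ u x - c) q ((riemVol n M).restrict B₀) ≤
        K₀ * eLpNorm (gradNorm n u) 2 (riemVol n M) →
      eLpNorm (fun x ↦ Real.exp (-μ * S.t x) * (u x - c)) q
        ((riemVol n M).restrict (B₀ ∪ ⋃ j ∈ G, ⋃ k, B j k)) ≤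
        A * eLpNorm (gradNorm n u) 2 (riemVol n M) := by
    classical
    intro G
    induction G using Finset.induction_on with
    | empty =>
      refine fun _ ↦ ⟨K₀, fun u c hu hc ↦ le_trans ?_ hc⟩
      simp only [Finset.notMem_empty, iUnion_of_empty, iUnion_empty, union_empty]
      refine eLpNorm_mono fun x ↦ ?_
      rw [norm_mul, Real.norm_eq_abs, Real.abs_exp]
      refine mul_le_of_le_one_left (norm_nonneg _) (Real.exp_le_one_iff.2 ?_)
      have := mul_nonneg hμ.le (S.t_nonneg x)
      linarith
    | insert j G hj ih =>
      intro hG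
      rw [Finset.insert_subset_iff] at hG
      obtain ⟨A, hA⟩ := ih hG.2
      obtain ⟨A', hA'⟩ := (hB j hG.1).exists_weighted_le hq hqn hμ (B' := B₀)
        (fun x hx ↦ hAB (hA₀T x ((hB j hG.1).t_le x hx))) K₀
      refine ⟨A' + A, fun u c hu hc ↦ ?_⟩
      rw [Finset.set_biUnion_insert, union_left_comm, ENNReal.coe_add, add_mul]
      exact (eLpNorm_restrict_union_le _ hq1 _ _).trans (add_le_add (hA' u c hu hc) (hA u c hu hc))
  obtain ⟨A, hA⟩ := hmain F subset_rfl
  refine ⟨A, fun u hu ↦ ?_⟩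
  obtain ⟨c, hc⟩ := hBK u hu
  refine ⟨c, ?_⟩
  have := hA u c hu hc
  rwa [show B₀ ∪ ⋃ j ∈ F, ⋃ k, B j k = univ from eq_univ_of_forall fun x ↦ ?_,
    Measure.restrict_univ] at this
  rcases hcov x with h | ⟨j, hj, h⟩
  · exact Or.inl (hAB (hA₀T x h))
  · exact Or.inr (mem_iUnion₂.2 ⟨j, hj, h⟩)

/-- The volume of the end grows at most linearly with height along each tower, so any exponential
weight is integrable. This normalizes `ψ`, puts the weight in every finite $L^p$, and shows that
`riemVol` is s-finite. -/
theorem ACylStructure.lintegral_exp_lt_top {p : ℝ} (hp : 0 < p) :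
    ∫⁻ x, ENNReal.ofReal (Real.exp (-p * S.t x)) ∂(riemVol n M) < ⊤ := by
  obtain ⟨T, F, O, B, s, ε, V, hB, hcov⟩ := S.exists_finite_towers
  obtain ⟨A₀, hA₀, hA₀T⟩ := S.exists_isCompact_superset (T + 2)
  -- Only the finite volume of the neighbourhood is wanted; `q = 2` is an admissible exponent in
  -- every dimension.
  obtain ⟨B₀, -, -, hAB, hfin, -⟩ := exists_sobolevPoincareOn_superset (n := n) (q := 2) le_rfl
    (fun hn ↦ by
      have hn' : (2 : ℝ) < n := by exact_mod_cast hn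
      rw [le_div_iff₀ (by linarith)]
      push_cast
      linarith) hA₀
  have hmain : ∀ G ⊆ F, ∫⁻ x in (B₀ ∪ ⋃ j ∈ G, ⋃ k, B j k),
      ENNReal.ofReal (Real.exp (-p * S.t x)) ∂(riemVol n M) < ⊤ := by
    classical
    intro G
    induction G using Finset.induction_on with
    | empty =>
      intro _
      simp only [Finset.notMem_empty, iUnion_of_empty, iUnion_empty, union_empty]
      refine lt_of_le_of_lt ((setLIntegral_mono (g := fun _ ↦ 1) measurable_const fun x _ ↦ ?_).trans
        (by rw [setLIntegral_one])) hfin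
      rw [ENNReal.ofReal_le_one, Real.exp_le_one_iff]
      have := mul_nonneg hp.le (S.t_nonneg x)
      linarith
    | insert j G hj ih =>
      intro hG
      rw [Finset.insert_subset_iff] at hG
      rw [Finset.set_biUnion_insert, union_left_comm]
      exact (lintegral_union_le _ _ _).trans_lt
        (ENNReal.add_lt_top.2 ⟨(hB j hG.1).lintegral_exp_lt_top hp, ih hG.2⟩)
  have := hmain F subset_rfl
  rwa [show B₀ ∪ ⋃ j ∈ F, ⋃ k, B j k = univ from eq_univ_of_forall fun x ↦ ?_,
    Measure.restrict_univ] at this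
  rcases hcov x with h | ⟨j, hj, h⟩
  · exact Or.inl (hAB (hA₀T x h))
  · exact Or.inr (mem_iUnion₂.2 ⟨j, hj, h⟩)

end Core

/-! ### Piecewise constant functions from a floor function -/

section Floor

/-- A function that is positive everywhere and has a finite integral exists only for s-finite
measures. -/
theorem sFinite_of_lintegral_lt_top {α : Type*} [MeasurableSpace α] {ν : Measure α} {w : α → ℝ}
    (hw : Measurable w) (hw0 : ∀ x, 0 < w x) (hfin : ∫⁻ x, ENNReal.ofReal (w x) ∂ν < ⊤) :
    SFinite ν := by
  have : IsFiniteMeasure (ν.withDensity fun x ↦ ENNReal.ofReal (w x)) :=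
    isFiniteMeasure_withDensity hfin.ne
  rw [← withDensity_inv_same (μ := ν) (f := fun x ↦ ENNReal.ofReal (w x)) hw.ennreal_ofReal
    (ae_of_all _ fun x ↦ by simpa using hw0 x) (ae_of_all _ fun x ↦ ENNReal.ofReal_ne_top)]
  infer_instance

/-- The level sets of `f` are disjoint, so only countably many have positive measure. The bad shifts
form a countable set, which is not all of `ℝ`. -/
theorem exists_shift_levelSet_null {α : Type*} [MeasurableSpace α] (ν : Measure α) [SFinite ν]
    {f : α → ℝ} (hf : Measurable f) : ∃ b : ℝ, ∀ k : ℤ, ν {x | f x = b + k} = 0 := by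
  have hc : {t : ℝ | 0 < ν {x | f x = t}}.Countable := Measure.countable_meas_level_set_pos hf
  have h2 : (⋃ k : ℤ, (fun b : ℝ ↦ b + k) ⁻¹' {t : ℝ | 0 < ν {x | f x = t}}).Countable :=
    countable_iUnion fun k ↦ hc.preimage (add_left_injective _)
  obtain ⟨b, hb⟩ := (ne_univ_iff_exists_notMem _).1
    (fun h ↦ not_countable_univ_iff.2 inferInstance (h ▸ h2) :
      (⋃ k : ℤ, (fun b : ℝ ↦ b + k) ⁻¹' {t : ℝ | 0 < ν {x | f x = t}}) ≠ univ)
  refine ⟨b, fun k ↦ ?_⟩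
  by_contra h
  exact hb (mem_iUnion.2 ⟨k, pos_iff_ne_zero.2 h⟩)

/-- The pieces are the preimages of the open intervals between consecutive `b + k`. Their boundaries
lie in the null levels. Their union has null complement, hence is dense as open sets have positive
measure, and local finiteness turns the closure of the union into the union of the closures. -/
theorem piecewiseConstant_comp_floor {α : Type*} [TopologicalSpace α] [MeasurableSpace α]
    {ν : Measure α} [ν.IsOpenPosMeasure] {f : α → ℝ} (hf : Continuous f) {b : ℝ}
    (hb : ∀ k : ℤ, ν {x | f x = b + k} = 0) (g : ℤ → ℝ) :
    PiecewiseConstant ν fun x ↦ g ⌊f x - b⌋ := by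
  set I : ℤ → Set ℝ := fun k ↦ Ioo (b + k) (b + k + 1) with hI
  have hfloor : ∀ {k : ℤ} {y : ℝ}, y ∈ I k → ⌊y - b⌋ = k := by
    rintro k y ⟨h1, h2⟩
    rw [Int.floor_eq_iff]
    constructor <;> linarith
  have hlf : LocallyFinite I := by
    intro y
    refine ⟨Ioo (y - 1) (y + 1), Ioo_mem_nhds (by linarith) (by linarith),
      (finite_Icc (⌊y - b⌋ - 2) (⌊y - b⌋ + 2)).subset ?_⟩
    rintro k ⟨z, hz, hz'⟩
    have h1 := Int.floor_le (y - b)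
    have h2 := Int.lt_floor_add_one (y - b)
    obtain ⟨h3, h4⟩ := hz
    obtain ⟨h5, h6⟩ := hz'
    constructor
    · have : (⌊y - b⌋ : ℝ) - 2 < k := by linarith
      exact_mod_cast this.le
    · have : (k : ℝ) < ⌊y - b⌋ + 2 := by linarith
      exact_mod_cast this.le
  have hlf' : LocallyFinite fun k ↦ f ⁻¹' I k := hlf.preimage_continuous hf
  let e : ℕ ≃ ℤ := Equiv.intEquivNat.symm
  have hcover : ⋃ k, closure (f ⁻¹' I k) = univ := by
    rw [← hlf'.closure_iUnion]
    refine Dense.closure_eq (Measure.dense_of_ae (μ := ν) (p := fun x ↦ x ∈ ⋃ k, f ⁻¹' I k) ?_)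
    have h1 : ∀ᵐ x ∂ν, ∀ k : ℤ, f x ≠ b + k := ae_all_iff.2 fun k ↦ by
      simpa [ae_iff] using hb k
    filter_upwards [h1] with x hx
    refine mem_iUnion.2 ⟨⌊f x - b⌋, lt_of_le_of_ne ?_ (hx _).symm, ?_⟩
    · linarith [Int.floor_le (f x - b)]
    · linarith [Int.lt_floor_add_one (f x - b)]
  refine ⟨fun i ↦ f ⁻¹' I (e i), fun i ↦ isOpen_Ioo.preimage hf, fun i j hij ↦ ?_,
    hlf'.comp_injective e.injective, ?_, fun i ↦ ?_, fun i ↦ ⟨g (e i), fun x hx ↦ ?_⟩⟩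
  · refine disjoint_left.2 fun x hx hx' ↦ hij (e.injective ?_)
    rw [← hfloor hx, ← hfloor hx']
  · rw [← hcover]
    exact e.surjective.iUnion_comp fun k ↦ closure (f ⁻¹' I k)
  · refine measure_mono_null (hf.frontier_preimage_subset _) ?_
    rw [hI, frontier_Ioo (by linarith)]
    refine measure_mono_null (t := {x | f x = b + (e i : ℤ)} ∪ {x | f x = b + (e i + 1 : ℤ)}) ?_
      (measure_union_null (hb _) (hb _))
    rintro x (hx | hx)
    · exact Or.inl hx
    · right
      rw [mem_singleton_iff] at hx
      rw [mem_ofPred_eq, hx]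
      push_cast
      ring
  · simp only [hfloor hx]

end Floor

/-! ### From an arbitrary constant to the weighted average -/

section Average

variable {α : Type*} [MeasurableSpace α] {ν : Measure α}

/-- In a weighted estimate, the constant can be replaced by a weighted average. -/
theorem exists_eLpNorm_mul_sub_average_le {w ψ : α → ℝ} (hw : Measurable w)
    {q : ℝ≥0} (hq : 1 < q) (hwp : ∀ p : ℝ, 0 < p → ∫⁻ x, ‖w x‖ₑ ^ p ∂ν < ⊤)
    (hψ0 : ∀ x, 0 ≤ ψ x) {K : ℝ≥0} (hψ : ∀ x, ψ x ≤ K * w x ^ 2)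
    (hψi : Integrable ψ ν) (hψ1 : ∫ x, ψ x ∂ν = 1) :
    ∃ C : ℝ≥0, ∀ (u : α → ℝ) (c : ℝ), AEStronglyMeasurable u ν →
      Integrable (fun x ↦ u x * ψ x) ν →
      eLpNorm (fun x ↦ w x * (u x - ∫ y, u y * ψ y ∂ν)) q ν ≤
        C * eLpNorm (fun x ↦ w x * (u x - c)) q ν := by
  have hq0 : q ≠ 0 := (zero_lt_one.trans hq).ne'
  have hpq : (q : ℝ).HolderConjugate (q : ℝ).conjExponent :=
    Real.HolderConjugate.conjExponent (by exact_mod_cast hq)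
  set q' := (q : ℝ).conjExponent
  set a₁ := (∫⁻ x, ‖w x‖ₑ ^ q' ∂ν) ^ (1 / q')
  set a₂ := eLpNorm w q ν with ha₂
  have ha₁' : a₁ ≠ ⊤ :=
    ENNReal.rpow_ne_top_of_nonneg (by have := hpq.symm.pos; positivity) (hwp _ hpq.symm.pos).ne
  have ha₂' : a₂ ≠ ⊤ := by
    rw [ha₂, eLpNorm_nnreal_eq_lintegral hq0]
    exact ENNReal.rpow_ne_top_of_nonneg (by positivity) (hwp _ hpq.pos).ne
  refine ⟨1 + K * a₁.toNNReal * a₂.toNNReal, fun u c hu hi ↦ ?_⟩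
  set N := eLpNorm (fun x ↦ w x * (u x - c)) q ν with hN
  set v := ∫ y, u y * ψ y ∂ν with hv
  -- As `ψ` has integral 1, `v - c` is the integral of `(u - c) ψ`. The bound `ψ ≤ K w²` splits this
  -- into `w` times `w (u - c)`, to which Hölder's inequality applies.
  have hcv : ‖c - v‖ₑ ≤ K * a₁ * N := by
    have h1 : v - c = ∫ x, u x * ψ x - c * ψ x ∂ν := by
      rw [integral_sub hi (hψi.const_mul c), integral_const_mul, hψ1, mul_one]
    rw [← enorm_neg, neg_sub, h1]
    refine (enorm_integral_le_lintegral_enorm _).trans ?_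
    calc _ ≤ ∫⁻ x, K * (‖w x‖ₑ * ‖w x * (u x - c)‖ₑ) ∂ν := by
          refine lintegral_mono fun x ↦ ?_
          have h2 : ‖ψ x‖ₑ ≤ K * (‖w x‖ₑ * ‖w x‖ₑ) := by
            rw [← enorm_mul, ← pow_two, Real.enorm_of_nonneg (hψ0 x),
              Real.enorm_of_nonneg (sq_nonneg _), ← ENNReal.ofReal_coe_nnreal,
              ← ENNReal.ofReal_mul K.coe_nonneg]
            exact ENNReal.ofReal_le_ofReal (hψ x)
          simp only [← sub_mul, enorm_mul]
          calc _ ≤ ‖u x - c‖ₑ * (K * (‖w x‖ₑ * ‖w x‖ₑ)) := mul_le_mul_right h2 _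
            _ = _ := by ring
      _ = K * ∫⁻ x, ‖w x‖ₑ * ‖w x * (u x - c)‖ₑ ∂ν := lintegral_const_mul' _ _ ENNReal.coe_ne_top
      _ ≤ K * (a₁ * N) := by
          refine mul_le_mul_right ?_ _
          rw [hN, eLpNorm_nnreal_eq_lintegral hq0]
          exact ENNReal.lintegral_mul_le_Lp_mul_Lq ν hpq.symm hw.enorm.aemeasurable
            (hw.aestronglyMeasurable.mul (hu.sub aestronglyMeasurable_const)).enorm
      _ = _ := by ring
  have h3 : (fun x ↦ w x * (u x - v)) = (fun x ↦ w x * (u x - c)) + (c - v) • w := by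
    ext x
    simp only [Pi.add_apply, Pi.smul_apply, smul_eq_mul]
    ring
  calc _ ≤ N + ‖c - v‖ₑ * a₂ := by
        rw [h3, ← eLpNorm_const_smul]
        exact eLpNorm_add_le (hw.aestronglyMeasurable.mul (hu.sub aestronglyMeasurable_const))
          (hw.aestronglyMeasurable.const_smul _) (by exact_mod_cast hq.le)
    _ ≤ N + K * a₁ * N * a₂ := by gcongr
    _ = _ := by
        push_cast
        rw [ENNReal.coe_toNNReal ha₁', ENNReal.coe_toNNReal ha₂']
        ring

end Average

/-! ### Construction of the averaging function -/

section Weight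

variable {n m : ℕ} {M : Type*} [MetricSpace M] [ProperSpace M] [SecondCountableTopology M]
  [MeasurableSpace M] [BorelSpace M]
  [ChartedSpace (EuclideanSpace ℝ (Fin n)) M] [IsManifold (𝓡 n) 1 M]
  [RiemannianBundle (fun x : M ↦ TangentSpace (𝓡 n) x)]
  [IsContinuousRiemannianBundle (EuclideanSpace ℝ (Fin n)) (fun x : M ↦ TangentSpace (𝓡 n) x)]
  [PreconnectedSpace M] [Nonempty M]
  {X : Type*} [TopologicalSpace X] [CompactSpace X]
  [ChartedSpace (EuclideanSpace ℝ (Fin m)) X] [IsManifold (𝓡 m) 1 X]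
  [RiemannianBundle (fun x : X ↦ TangentSpace (𝓡 m) x)]
  [IsContinuousRiemannianBundle (EuclideanSpace ℝ (Fin m)) (fun x : X ↦ TangentSpace (𝓡 m) x)]
  (S : ACylStructure n m M X)

theorem ACylStructure.exists_piecewiseConstant {p : ℝ} (hp : 0 < p) :
    ∃ ψ : M → ℝ, PiecewiseConstant (riemVol n M) ψ ∧ (∀ x, 0 < ψ x) ∧
      (∃ K : ℝ, ∀ x, ψ x ≤ K * Real.exp (-p * S.t x)) ∧
      Integrable ψ (riemVol n M) ∧ ∫ x, ψ x ∂(riemVol n M) = 1 := by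
  have hexp : Measurable fun x ↦ Real.exp (-p * S.t x) :=
    Real.measurable_exp.comp (S.measurable_t.const_mul _)
  have hfin := S.lintegral_exp_lt_top hp
  have hint : Integrable (fun x ↦ Real.exp (-p * S.t x)) (riemVol n M) := by
    refine ⟨hexp.aestronglyMeasurable, ?_⟩
    rw [hasFiniteIntegral_iff_ofReal (ae_of_all _ fun x ↦ (Real.exp_pos _).le)]
    exact hfin
  have : SFinite (riemVol n M) := sFinite_of_lintegral_lt_top hexp (fun x ↦ Real.exp_pos _) hfin
  have : (riemVol n M).IsOpenPosMeasure := ⟨fun O hO hne ↦ (riemVol_pos_of_isOpen hO hne).ne'⟩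
  obtain ⟨R, -, hR⟩ := S.exists_t_le_of_mem_closure_U
  have hf := S.continuous_max_t hR
  obtain ⟨b, hb⟩ := exists_shift_levelSet_null (riemVol n M) hf.measurable
  set f : M → ℝ := fun x ↦ max (S.t x) R
  -- Passing from `t` to `max t R` only decreases the exponential, and rounding down costs the
  -- factor `exp (p (b + 1))` together with the shift.
  set g : M → ℝ := fun x ↦ Real.exp (-p * ⌊f x - b⌋) with hg
  have hgm : Measurable g := Real.measurable_exp.comp
    ((measurable_from_top.comp (hf.measurable.sub_const b).floor).const_mul _)
  have hgle : ∀ x, g x ≤ Real.exp (p * (b + 1)) * Real.exp (-p * S.t x) := fun x ↦ by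
    rw [hg, ← Real.exp_add, Real.exp_le_exp]
    have h1 : S.t x - b - 1 ≤ ⌊f x - b⌋ := by
      linarith [Int.lt_floor_add_one (f x - b), le_max_left (S.t x) R]
    have := mul_le_mul_of_nonneg_left h1 hp.le
    linarith
  have hgi : Integrable g (riemVol n M) :=
    (hint.const_mul _).mono' hgm.aestronglyMeasurable (ae_of_all _ fun x ↦ by
      rw [Real.norm_eq_abs, hg, Real.abs_exp]; exact hgle x)
  set Z := ∫ x, g x ∂(riemVol n M) with hZ
  have hZ0 : 0 < Z := by
    rw [hZ, integral_pos_iff_support_of_nonneg (fun x ↦ (Real.exp_pos _).le) hgi]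
    rw [show Function.support g = univ from eq_univ_of_forall fun x ↦ (Real.exp_pos _).ne']
    exact isOpen_univ.measure_pos _ univ_nonempty
  refine ⟨fun x ↦ Z⁻¹ * g x,
    piecewiseConstant_comp_floor hf hb fun k ↦ Z⁻¹ * Real.exp (-p * k),
    fun x ↦ mul_pos (inv_pos.2 hZ0) (Real.exp_pos _),
    ⟨Z⁻¹ * Real.exp (p * (b + 1)), fun x ↦ ?_⟩, hgi.const_mul _, ?_⟩
  · rw [mul_assoc]
    exact mul_le_mul_of_nonneg_left (hgle x) (inv_pos.2 hZ0).le
  · rw [integral_const_mul, ← hZ, inv_mul_cancel₀ hZ0.ne']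

theorem ACylStructure.lintegral_enorm_exp_rpow_lt_top {μ : ℝ} (hμ : 0 < μ) {p : ℝ} (hp : 0 < p) :
    ∫⁻ x, ‖Real.exp (-μ * S.t x)‖ₑ ^ p ∂(riemVol n M) < ⊤ := by
  have h : ∀ x, ‖Real.exp (-μ * S.t x)‖ₑ ^ p = ENNReal.ofReal (Real.exp (-(μ * p) * S.t x)) := by
    intro x
    rw [Real.enorm_of_nonneg (Real.exp_pos _).le, ENNReal.ofReal_rpow_of_pos (Real.exp_pos _),
      ← Real.exp_mul]
    congr 2
    ring
  simp only [h]
  exact S.lintegral_exp_lt_top (mul_pos hμ hp)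

end Weight

end ACyl

/-! ### The weighted Sobolev-Poincaré inequality -/

theorem propositionp {n m : ℕ}
    {M : Type*} [MetricSpace M] [CompleteSpace M] [SecondCountableTopology M]
    [MeasurableSpace M] [BorelSpace M]
    [ChartedSpace (EuclideanSpace ℝ (Fin n)) M] [IsManifold (𝓡 n) ∞ M]
    [RiemannianBundle (fun x : M ↦ TangentSpace (𝓡 n) x)]
    [IsContMDiffRiemannianBundle (𝓡 n) ∞ (EuclideanSpace ℝ (Fin n))
      (fun x : M ↦ TangentSpace (𝓡 n) x)]
    [IsRiemannianManifold (𝓡 n) M]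
    {X : Type*} [TopologicalSpace X] [T2Space X] [CompactSpace X]
    [ChartedSpace (EuclideanSpace ℝ (Fin m)) X] [IsManifold (𝓡 m) ∞ X]
    [RiemannianBundle (fun x : X ↦ TangentSpace (𝓡 m) x)]
    [IsContMDiffRiemannianBundle (𝓡 m) ∞ (EuclideanSpace ℝ (Fin m))
      (fun x : X ↦ TangentSpace (𝓡 m) x)]
    (S : ACyl.ACylStructure n m M X) (μ : ℝ) (hμ : 0 < μ) :
    ∃ ψ : M → ℝ, ACyl.PiecewiseConstant (ACyl.riemVol n M) ψ ∧ (∀ x, 0 < ψ x) ∧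
      (∃ K : ℝ, ∀ x, ψ x ≤ K * Real.exp (-2 * μ * S.t x)) ∧
      Integrable ψ (ACyl.riemVol n M) ∧ ∫ x, ψ x ∂(ACyl.riemVol n M) = 1 ∧
      ∀ σ : ℝ, 1 ≤ σ → (2 < n → σ ≤ (n : ℝ) / ((n : ℝ) - 2)) →
        ∃ C : ℝ≥0, ∀ u : M → ℝ, ContMDiff (𝓡 n) 𝓘(ℝ, ℝ) ∞ u → HasCompactSupport u →
          eLpNorm (fun x ↦ Real.exp (-μ * S.t x) *
              (u x - ∫ y, u y * ψ y ∂(ACyl.riemVol n M))) (ENNReal.ofReal (2 * σ))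
              (ACyl.riemVol n M)
            ≤ C * eLpNorm (ACyl.gradNorm n u) 2 (ACyl.riemVol n M) := by
  have : IsManifold (𝓡 n) 1 M := IsManifold.of_le (n := ∞) (by exact_mod_cast le_top)
  have : IsManifold (𝓡 m) 1 X := IsManifold.of_le (n := ∞) (by exact_mod_cast le_top)
  have : IsContinuousRiemannianBundle (EuclideanSpace ℝ (Fin n))
      (fun x : M ↦ TangentSpace (𝓡 n) x) :=
    ACyl.isContinuousRiemannianBundle_of_isContMDiff (IB := 𝓡 n) (k := ∞) inferInstance
  have : IsContinuousRiemannianBundle (EuclideanSpace ℝ (Fin m))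
      (fun x : X ↦ TangentSpace (𝓡 m) x) :=
    ACyl.isContinuousRiemannianBundle_of_isContMDiff (IB := 𝓡 m) (k := ∞) inferInstance
  have : ProperSpace M := ACyl.properSpace_of_isRiemannianManifold n M
  have : PreconnectedSpace M := ACyl.preconnectedSpace_of_isRiemannianManifold n M
  have : Nonempty M := S.isConnected_U.nonempty.to_type
  -- The rate `2 * μ` is twice that of the weight, so that `ψ` is bounded by a multiple of the
  -- squared weight. The choice precedes `σ`: one `ψ` serves all exponents.
  obtain ⟨ψ, hψc, hψ0, ⟨K, hK⟩, hψi, hψ1⟩ :=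
    S.exists_piecewiseConstant (p := 2 * μ) (by positivity)
  have hexp : Measurable fun x ↦ Real.exp (-μ * S.t x) :=
    Real.measurable_exp.comp (S.measurable_t.const_mul _)
  refine ⟨ψ, hψc, hψ0, ⟨K, fun x ↦ by simpa using hK x⟩, hψi, hψ1, fun σ hσ hσn ↦ ?_⟩
  set q : ℝ≥0 := (2 * σ).toNNReal with hq
  have hqσ : (q : ℝ) = 2 * σ := Real.coe_toNNReal _ (by linarith)
  have hq2 : 2 ≤ q := by
    rw [← NNReal.coe_le_coe, hqσ]
    push_cast
    linarith
  obtain ⟨A, hA⟩ := S.exists_weighted_sobolevPoincare hμ hq2 fun hn ↦ by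
    rw [hqσ, mul_div_assoc]
    exact mul_le_mul_of_nonneg_left (hσn hn) zero_le_two
  have hψK : ∀ x, ψ x ≤ K.toNNReal * Real.exp (-μ * S.t x) ^ 2 := fun x ↦ by
    refine (hK x).trans ?_
    rw [← Real.exp_nat_mul, show ((2 : ℕ) : ℝ) * (-μ * S.t x) = -(2 * μ) * S.t x by
      push_cast; ring]
    exact mul_le_mul_of_nonneg_right (Real.le_coe_toNNReal K) (Real.exp_pos _).le
  obtain ⟨C, hC⟩ := ACyl.exists_eLpNorm_mul_sub_average_le (K := K.toNNReal) hexp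
    (one_lt_two.trans_le hq2) (fun p hp ↦ S.lintegral_enorm_exp_rpow_lt_top hμ hp)
    (fun x ↦ (hψ0 x).le) hψK hψi hψ1
  refine ⟨C * A, fun u hu hcs ↦ ?_⟩
  obtain ⟨c, hc⟩ := hA u hu
  -- Compact support makes `u` bounded, hence `u ψ` integrable and the average meaningful.
  obtain ⟨b, hb⟩ := hcs.exists_bound_of_continuous hu.continuous
  refine (hC u c hu.continuous.aestronglyMeasurable (hψi.bdd_mul
    hu.continuous.aestronglyMeasurable (ae_of_all _ hb))).trans ?_
  rw [ENNReal.coe_mul, mul_assoc]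
  exact mul_le_mul_right hc _
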